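/- Let $S$ be a set of $n\ge 3$ points in the plane in general position (no three points are collinear). A plane path of $S$ is a path that visits every point of $S$ exactly once and is drawn with non-crossing straight line segments; two plane paths are identified if they consist of the same segments. The flip graph of $S$ is the graph whose vertices are the plane paths of $S$, two of them being adjacent if the symmetric difference of their sets of segments consists of exactly two segments. Theorem 1. Let $n\ge 3$, let $C$ be a set of $n-1$ points in the plane in convex position, and let $\xi$ be a point outside the convex hull of $C$ such that $S=C\cup\{\xi\}$ is in general position. Then the following holds. (a) The flip graph of $S$ is connected and its diameter is at most $2n$. (b) The subgraph of the flip graph of $S$ induced by the plane paths in which $\xi$ has degree $1$ is connected and, if $n\ge 5$, its diameter is at most $4n-15$. (c) The subgraph of the flip graph of $S$ induced by the plane paths in which $\xi$ has degree $2$ is connected and its diameter is at most $2n$. -/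

import Mathlib

/-- The Euclidean plane. -/
abbrev Plane : Type := EuclideanSpace ℝ (Fin 2)

/-- A set of points of the plane is in general position if no three of its points are collinear. -/
def InGeneralPosition (S : Set Plane) : Prop :=
  ∀ a ∈ S, ∀ b ∈ S, ∀ c ∈ S, a ≠ b → a ≠ c → b ≠ c → ¬ Collinear ℝ ({a, b, c} : Set Plane)

/-- A set of points of the plane is in convex position if none of its points lies in the convex
hull of the other ones. -/
def InConvexPosition (C : Set Plane) : Prop :=
  ConvexIndependent ℝ ((↑) : C → Plane)

/-- A graph with vertex set `S` is a spanning path of `S` if it is isomorphic to a path graph. -/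
def IsSpanningPath {S : Set Plane} (G : SimpleGraph S) : Prop :=
  ∃ m : ℕ, Nonempty (SimpleGraph.pathGraph m ≃g G)

/-- A graph on points of the plane is drawn without crossings by straight line segments: two
different segments meet at most in a common endpoint. -/
def IsPlane {S : Set Plane} (G : SimpleGraph S) : Prop :=
  ∀ a b c d : S, G.Adj a b → G.Adj c d → s(a, b) ≠ s(c, d) →
    segment ℝ (a : Plane) b ∩ segment ℝ (c : Plane) d ⊆
      ({(a : Plane), (b : Plane)} ∩ {(c : Plane), (d : Plane)} : Set Plane)

/-- The plane (spanning) paths of a point set `S`. -/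
def PlanePath (S : Set Plane) : Type :=
  {G : SimpleGraph S // IsSpanningPath G ∧ IsPlane G}

/-- The flip graph of `S`: its vertices are the plane paths of `S`, and two of them are adjacent
if the symmetric difference of their sets of segments consists of exactly two segments. -/
def flipGraph (S : Set Plane) : SimpleGraph (PlanePath S) where
  Adj P Q := (symmDiff P.1.edgeSet Q.1.edgeSet).ncard = 2
  symm := ⟨fun P Q h => by rwa [symmDiff_comm]⟩
  loopless := ⟨fun P h => by simp at h⟩

/-- The plane paths of `S` in which the point `x` has degree `k`. -/
def pathsWithDegree (S : Set Plane) (x : S) (k : ℕ) : Set (PlanePath S) :=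
  {P | (P.1.neighborSet x).ncard = k}

/-! Cut a plane path at `ξ`: it becomes `join ξ A B`, two arms that start at the neighbours of `ξ`
and run through `C`. In convex position, a non-crossing path with a given start must always step to
one of the two ends of the arc of unvisited points, since any other edge would separate points that
the rest still has to connect. So each arm is a zigzag (`Zig.nonCrossing`, `NonCrossing.zig`).
Reversing a suffix of a path is one flip, and such flips unwind a zigzag into a run along its arc,
in either direction, in one flip less than the number of points after its start (`zig_reach`).

If `ξ` has degree 2, the path is compared with detour paths, which follow the hull cycle with one
hull edge replaced by a detour through `ξ` and another one deleted. What has to be controlled is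
which points `ξ` can be joined to. If both neighbours of `ξ` are visible, then all points on one of
the two hull arcs between them are visible (`OuterPoint.exists_visible_arc`). If a neighbour `a` is
hidden behind the hull, then the line through `ξ` and `a` separates the two arms, and the hull edge
that crosses it in front of `a` has visible endpoints (`OuterPoint.exists_sides`). In both cases
`|C| - 1` flips lead to a detour path (`AdmitsInner.reachesDetour`), and any two detour paths are at
most 4 flips apart (`AdmitsInner.reach_detour`). With `|C| = n - 1` this gives `2(n - 2) + 4 = 2n`.
All intermediate paths keep `ξ` at degree 2, which is (c). A path that ends at `ξ` reaches a detour
path within the same number of flips (`OuterPoint.reachesDetour_of_end`), which gives (a).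

If `ξ` has degree 1, its neighbour is visible and the rest is a single zigzag. For distinct
neighbours `c` and `c'` and cyclic order `c X c' Y`, both paths are brought to the path through `c`,
`X` and then backwards through `c' Y`, with `ξ` attached to one end or to the other; these two
differ by one flip (`AdmitsOuter.reach`). The count is `2(n - 2)`, which is at most `4n - 15` for `n
≥ 6`. The case `n = 5` needs one flip fewer and is tracked separately. -/

namespace PlanePaths

/-! ### Lists: consecutive entries, zigzags, sorting -/

section Lists

variable {α : Type*}

/-- `a` and `b` are consecutive entries of the list, in this order. -/
def Consec (a b : α) : List α → Prop
  | [] => False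
  | x :: t => (a = x ∧ t.head? = some b) ∨ Consec a b t

theorem consec_append {a b : α} {l₁ l₂ : List α} :
    Consec a b (l₁ ++ l₂) ↔ Consec a b l₁ ∨ Consec a b l₂ ∨
      (l₁.getLast? = some a ∧ l₂.head? = some b) := by
  induction l₁ with
  | nil => simp [Consec]
  | cons x t ih =>
    rw [List.cons_append, Consec, Consec, ih]
    rcases t with _ | ⟨y, t⟩
    · simp [Consec, eq_comm (a := x)]
      tauto
    · simp [List.getLast?_cons_cons]
      tauto

theorem Consec.mem {a b : α} {l : List α} (h : Consec a b l) : a ∈ l ∧ b ∈ l := by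
  induction l with
  | nil => exact h.elim
  | cons x t ih =>
    rcases h with ⟨rfl, h⟩ | h
    · exact ⟨List.mem_cons_self, List.mem_cons_of_mem _ (List.mem_of_head? h)⟩
    · exact ⟨List.mem_cons_of_mem _ (ih h).1, List.mem_cons_of_mem _ (ih h).2⟩

theorem Consec.ne {a b : α} {l : List α} (h : Consec a b l) (hl : l.Nodup) : a ≠ b := by
  induction l with
  | nil => exact h.elim
  | cons x t ih =>
    rw [List.nodup_cons] at hl
    rcases h with ⟨rfl, h⟩ | h
    · rintro rfl
      exact hl.1 (List.mem_of_head? h)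
    · exact ih h hl.2

theorem consec_reverse {a b : α} {l : List α} : Consec a b l.reverse ↔ Consec b a l := by
  induction l with
  | nil => simp [Consec]
  | cons x t ih =>
    rw [List.reverse_cons, consec_append, ih, Consec]
    simp [Consec, List.getLast?_reverse, eq_comm]
    tauto

/-- A discrete intermediate value theorem. It provides the edge of a path that passes between two
sides of a chord or of a line. -/
theorem exists_consec {l : List α} (P : α → Prop) {x y : α} (hx : x ∈ l) (hy : y ∈ l)
    (hPx : P x) (hPy : ¬ P y) :
    ∃ a b, (Consec a b l ∨ Consec b a l) ∧ P a ∧ ¬ P b := by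
  induction l generalizing x y with
  | nil => simp at hx
  | cons z t ih =>
    by_cases h : (∃ u ∈ t, P u) ∧ ∃ v ∈ t, ¬ P v
    · obtain ⟨⟨u, hu, hPu⟩, v, hv, hPv⟩ := h
      obtain ⟨a, b, hab, h⟩ := ih hu hv hPu hPv
      exact ⟨a, b, hab.imp Or.inr Or.inr, h⟩
    · rcases t with _ | ⟨w, t⟩
      · simp at hx hy
        subst hx hy
        exact absurd hPx hPy
      · by_cases hw : P w
        · have hall : ∀ v ∈ w :: t, P v := by
            intro v hv
            by_contra hv'
            exact h ⟨⟨w, List.mem_cons_self, hw⟩, v, hv, hv'⟩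
          have hyz : y = z := by
            rcases List.mem_cons.1 hy with h' | h'
            · exact h'
            · exact absurd (hall y h') hPy
          subst hyz
          exact ⟨w, y, Or.inr (Or.inl ⟨rfl, rfl⟩), hw, hPy⟩
        · have hall : ∀ v ∈ w :: t, ¬ P v := by
            intro v hv hv'
            exact h ⟨⟨v, hv, hv'⟩, w, List.mem_cons_self, hw⟩
          have hxz : x = z := by
            rcases List.mem_cons.1 hx with h' | h'
            · exact h'
            · exact absurd hPx (hall x h')
          subst hxz
          exact ⟨x, w, Or.inl (Or.inl ⟨rfl, rfl⟩), hPx, hw⟩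

/-- `Zig l w`: the list `w` is obtained by successively removing the first or the last entry
of `l`. -/
inductive Zig : List α → List α → Prop
  | nil : Zig [] []
  | head (x : α) {l w : List α} : Zig l w → Zig (x :: l) (x :: w)
  | last (x : α) {l w : List α} : Zig l w → Zig (l ++ [x]) (x :: w)

theorem Zig.prepend {l w : List α} (h : Zig l w) (s : List α) : Zig (s ++ l) (s ++ w) := by
  induction s with
  | nil => exact h
  | cons x s ih => exact Zig.head x ih

theorem Zig.append {l w : List α} (h : Zig l w) (s : List α) :
    Zig (l ++ s) (s.reverse ++ w) := by
  induction s using List.reverseRecOn with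
  | nil => simpa using h
  | append_singleton s x ih =>
    rw [List.reverse_append, ← List.append_assoc]
    exact Zig.last x ih

theorem zig_self (l : List α) : Zig l l := by
  simpa using Zig.nil.prepend l

theorem zig_reverse (l : List α) : Zig l l.reverse := by
  simpa using Zig.nil.append l

theorem Zig.perm {l w : List α} (h : Zig l w) : w.Perm l := by
  induction h with
  | nil => exact List.Perm.refl _
  | head x _ ih => exact ih.cons x
  | last x _ ih => exact (ih.cons x).trans (List.perm_append_singleton x _).symm

theorem Zig.reverse_left {l w : List α} (h : Zig l w) : Zig l.reverse w := by
  induction h with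
  | nil => exact Zig.nil
  | head x _ ih => rw [List.reverse_cons]; exact Zig.last x ih
  | last x _ ih => rw [List.reverse_append]; exact Zig.head x ih

/-- Insertion sort for a relation that is total and transitive only on `s`. It is applied to the
angular order around a hull point, which is not a transitive relation on the whole plane. -/
theorem exists_pairwise_list (s : Finset α) (r : α → α → Prop)
    (htot : ∀ x ∈ s, ∀ y ∈ s, x ≠ y → r x y ∨ r y x)
    (htrans : ∀ x ∈ s, ∀ y ∈ s, ∀ z ∈ s, r x y → r y z → r x z) :
    ∃ l : List α, l.Nodup ∧ (∀ x, x ∈ l ↔ x ∈ s) ∧ l.Pairwise r := by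
  classical
  induction s using Finset.induction_on with
  | empty => exact ⟨[], by simp⟩
  | insert a s ha ih =>
    obtain ⟨l, hl, hmem, hr⟩ := ih
      (fun x hx y hy => htot x (Finset.mem_insert_of_mem hx) y (Finset.mem_insert_of_mem hy))
      (fun x hx y hy z hz => htrans x (Finset.mem_insert_of_mem hx) y
        (Finset.mem_insert_of_mem hy) z (Finset.mem_insert_of_mem hz))
    have hal : a ∉ l := fun h => ha ((hmem a).1 h)
    have has : a ∈ insert a s := Finset.mem_insert_self a s
    refine ⟨l.filter (fun x => r x a) ++ a :: l.filter (fun x => ¬ r x a), ?_, ?_, ?_⟩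
    · rw [List.nodup_middle, List.nodup_cons]
      refine ⟨by simp [hal], ?_⟩
      rw [List.nodup_append]
      refine ⟨hl.filter _, hl.filter _, ?_⟩
      intro x hx y hy hxy
      simp at hx hy
      subst hxy
      exact hy.2 hx.2
    · intro x
      simp only [List.mem_append, List.mem_cons, List.mem_filter, Finset.mem_insert, hmem,
        decide_eq_true_eq]
      tauto
    · rw [List.pairwise_append, List.pairwise_cons]
      have key : ∀ y ∈ l, ¬ r y a → r a y := by
        intro y hy hya
        have hys := Finset.mem_insert_of_mem (b := a) ((hmem y).1 hy)
        rcases htot a has y hys (fun h => hal (h ▸ hy)) with h | h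
        · exact h
        · exact absurd h hya
      refine ⟨hr.filter _, ⟨?_, hr.filter _⟩, ?_⟩
      · intro y hy
        simp at hy
        exact key y hy.1 hy.2
      · intro x hx y hy
        simp at hx hy
        rcases hy with rfl | hy
        · exact hx.2
        · exact htrans x (Finset.mem_insert_of_mem ((hmem x).1 hx.1)) a has y
            (Finset.mem_insert_of_mem ((hmem y).1 hy.1)) hx.2 (key y hy.1 hy.2)

end Lists

end PlanePaths

/-! ### Orientations, crossing segments and convex polygons -/

namespace PlanePaths

/-- Twice the signed area of the triangle `abc`. -/
def area (a b c : Plane) : ℝ := (b 0 - a 0) * (c 1 - a 1) - (b 1 - a 1) * (c 0 - a 0)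

theorem area_rotate (a b c : Plane) : area b c a = area a b c := by unfold area; ring

theorem area_swap (a b c : Plane) : area a c b = -area a b c := by unfold area; ring

theorem area_combo (a b c d : Plane) (s t : ℝ) (h : s + t = 1) :
    area a b (s • c + t • d) = s * area a b c + t * area a b d := by
  have hs : s = 1 - t := by linarith
  subst hs
  simp [area]
  ring

/-- The segments `ab` and `cd` have a common point. -/
def Meets (a b c d : Plane) : Prop := (segment ℝ a b ∩ segment ℝ c d).Nonempty

theorem Meets.symm {a b c d : Plane} (h : Meets a b c d) : Meets c d a b := by
  unfold Meets; rwa [Set.inter_comm]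

theorem Meets.swap_left {a b c d : Plane} (h : Meets a b c d) : Meets b a c d := by
  unfold Meets; rwa [segment_symm]

theorem Meets.swap_right {a b c d : Plane} (h : Meets a b c d) : Meets a b d c := by
  unfold Meets; rwa [segment_symm ℝ d c]

theorem plane_ext {p q : Plane} (h0 : p 0 = q 0) (h1 : p 1 = q 1) : p = q := by
  ext i
  fin_cases i
  · exact h0
  · exact h1

/-- The ray from `c` through `z` hits `xy` in the point whose weights are proportional to the areas
on its two sides. By `h4` the point `z` is not strictly on the side of `xy` that contains `c`, so
the hit occurs before `z` or at `z`. -/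
theorem meets_of_area {c x y z : Plane} (h1 : 0 < area c x z) (h2 : 0 < area c z y)
    (h3 : 0 ≤ area c x y) (h4 : area x y z ≤ 0) : Meets c z x y := by
  have hsum : area c x z + area c z y = area c x y - area x y z := by unfold area; ring
  have hpos : 0 < area c x z + area c z y := by linarith
  have hne := hpos.ne'
  refine ⟨(area c z y / (area c x z + area c z y)) • x +
    (area c x z / (area c x z + area c z y)) • y, ?_, ?_⟩
  · refine ⟨1 - area c x y / (area c x z + area c z y),
      area c x y / (area c x z + area c z y), ?_, by positivity, by ring, ?_⟩
    · rw [sub_nonneg, div_le_one hpos]; linarith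
    · apply plane_ext
      · simp
        field_simp
        unfold area
        ring
      · simp
        field_simp
        unfold area
        ring
  · exact ⟨_, _, by positivity, by positivity, by field_simp; ring, rfl⟩

theorem mem_hull_of_area {T : Set Plane} {a b c z : Plane} (ha : a ∈ T) (hb : b ∈ T) (hc : c ∈ T)
    (h1 : 0 ≤ area a b z) (h2 : 0 ≤ area b c z) (h3 : 0 ≤ area c a z)
    (h : 0 < area a b c) : z ∈ convexHull ℝ T := by
  have hsum : area b c z + area c a z + area a b z = area a b c := by unfold area; ring
  have hz : z = (area b c z / area a b c) • a + (area c a z / area a b c) • b +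
      (area a b z / area a b c) • c := by
    have hne := h.ne'
    apply plane_ext
    · simp
      field_simp
      unfold area
      ring
    · simp
      field_simp
      unfold area
      ring
  rw [hz]
  have hw : ∀ i ∈ (Finset.univ : Finset (Fin 3)),
      0 ≤ ![area b c z / area a b c, area c a z / area a b c, area a b z / area a b c] i := by
    intro i _
    fin_cases i
    · exact div_nonneg h2 h.le
    · exact div_nonneg h3 h.le
    · exact div_nonneg h1 h.le
  have key := (convex_convexHull ℝ T).sum_mem (z := ![a, b, c]) hw
    (by
      simp only [Fin.sum_univ_three, Matrix.cons_val]
      rw [← add_div, ← add_div, hsum, div_self h.ne'])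
    (by
      intro i _
      apply subset_convexHull
      fin_cases i
      · exact ha
      · exact hb
      · exact hc)
  simpa [Fin.sum_univ_three] using key

theorem not_meets_of_area_pos {a b c d : Plane} (hc : 0 < area a b c) (hd : 0 < area a b d) :
    ¬ Meets a b c d := by
  rintro ⟨p, ⟨s, t, hs, ht, hst, rfl⟩, s', t', hs', ht', hst', h⟩
  have e1 : area a b (s • a + t • b) = 0 := by
    rw [area_combo _ _ _ _ _ _ hst]; unfold area; ring
  rw [← h, area_combo _ _ _ _ _ _ hst'] at e1
  rcases hs'.eq_or_lt with h0 | h0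
  · subst h0
    have : t' = 1 := by linarith
    subst this
    linarith
  · nlinarith [mul_pos h0 hc, mul_nonneg ht' hd.le]

theorem not_meets_of_area_neg {a b c d : Plane} (hc : area a b c < 0) (hd : area a b d < 0) :
    ¬ Meets a b c d := by
  intro h
  refine not_meets_of_area_pos (a := b) (b := a) (c := c) (d := d) ?_ ?_ h.swap_left
  · have : area b a c = -area a b c := by unfold area; ring
    linarith
  · have : area b a d = -area a b d := by unfold area; ring
    linarith

theorem segments_inter_of_area_ne {a b d : Plane} (h : area a b d ≠ 0) :
    segment ℝ a b ∩ segment ℝ a d ⊆ {a} := by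
  rintro p ⟨⟨s, t, hs, ht, hst, rfl⟩, s', t', hs', ht', hst', hp⟩
  have e1 : area a b (s • a + t • b) = 0 := by
    rw [area_combo _ _ _ _ _ _ hst]; unfold area; ring
  rw [← hp, area_combo _ _ _ _ _ _ hst'] at e1
  have e2 : area a b a = 0 := by unfold area; ring
  have ht0 : t' = 0 := by
    rw [e2, mul_zero, zero_add] at e1
    exact (mul_eq_zero.1 e1).resolve_right h
  have hs1 : s' = 1 := by linarith
  rw [← hp, ht0, hs1]
  simp

theorem collinear_of_area_eq_zero {a b c : Plane} (hab : a ≠ b) (h : area a b c = 0) :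
    Collinear ℝ ({a, b, c} : Set Plane) := by
  rw [collinear_iff_of_mem (p₀ := a) (by simp)]
  refine ⟨b - a, ?_⟩
  intro p hp
  simp only [Set.mem_insert_iff, Set.mem_singleton_iff] at hp
  rcases hp with rfl | rfl | rfl
  · exact ⟨0, by simp⟩
  · exact ⟨1, by simp⟩
  · unfold area at h
    by_cases h0 : b 0 - a 0 = 0
    · have h1 : b 1 - a 1 ≠ 0 := by
        intro h1
        exact hab (plane_ext (by linarith) (by linarith))
      have h2 : p 0 - a 0 = 0 := by
        rw [h0, zero_mul, zero_sub, neg_eq_zero] at h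
        exact (mul_eq_zero.1 h).resolve_left h1
      refine ⟨(p 1 - a 1) / (b 1 - a 1), plane_ext ?_ ?_⟩
      · simp [h0]; linarith
      · simp; field_simp; ring
    · refine ⟨(p 0 - a 0) / (b 0 - a 0), plane_ext ?_ ?_⟩
      · simp; field_simp; ring
      · simp; field_simp; linarith

theorem area_ne_zero {S : Set Plane} (hS : InGeneralPosition S) {a b c : Plane}
    (ha : a ∈ S) (hb : b ∈ S) (hc : c ∈ S) (hab : a ≠ b) (hac : a ≠ c) (hbc : b ≠ c) :
    area a b c ≠ 0 :=
  fun h => hS a ha b hb c hc hab hac hbc (collinear_of_area_eq_zero hab h)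

/-- All triples of the list are oriented counterclockwise. -/
def CCW (l : List Plane) : Prop := ∀ x y z, [x, y, z].Sublist l → 0 < area x y z

theorem CCW.sublist {l l' : List Plane} (h : CCW l) (hl : l'.Sublist l) : CCW l' :=
  fun x y z hs => h x y z (hs.trans hl)

/-- Rotating the list rotates each of its triples, and `area` is invariant under cyclic shifts. The
cases are the number of points of the triple that come from `l₂`. -/
theorem CCW.rotate {l₁ l₂ : List Plane} (h : CCW (l₁ ++ l₂)) : CCW (l₂ ++ l₁) := by
  intro x y z hs
  rw [List.sublist_append_iff] at hs
  obtain ⟨s, t, hst, hs, ht⟩ := hs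
  have key := List.Sublist.append ht hs
  rcases s with _ | ⟨a, _ | ⟨b, _ | ⟨c, _ | ⟨d, s⟩⟩⟩⟩
  · simp at hst; subst hst
    exact h _ _ _ (by simpa using key)
  · simp at hst; obtain ⟨rfl, rfl⟩ := hst
    rw [← area_rotate]
    exact h _ _ _ (by simpa using key)
  · simp at hst; obtain ⟨rfl, rfl, rfl⟩ := hst
    rw [← area_rotate, ← area_rotate]
    exact h _ _ _ (by simpa using key)
  · simp at hst; obtain ⟨rfl, rfl, rfl, rfl⟩ := hst
    exact h _ _ _ (by simpa using key)
  · simp at hst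

/-- The list runs through the vertices of a convex polygon in cyclic order. -/
def CyclicOrder (l : List Plane) : Prop := CCW l ∨ CCW l.reverse

theorem CyclicOrder.sublist {l l' : List Plane} (h : CyclicOrder l) (hl : l'.Sublist l) :
    CyclicOrder l' :=
  h.imp (fun h => h.sublist hl) (fun h => h.sublist hl.reverse)

theorem CyclicOrder.rotate {l₁ l₂ : List Plane} (h : CyclicOrder (l₁ ++ l₂)) :
    CyclicOrder (l₂ ++ l₁) := by
  refine h.imp CCW.rotate (fun h => ?_)
  rw [List.reverse_append] at h ⊢
  exact h.rotate

theorem CyclicOrder.reverse {l : List Plane} (h : CyclicOrder l) : CyclicOrder l.reverse := by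
  unfold CyclicOrder
  rw [List.reverse_reverse]
  exact h.symm

theorem CCW.four {x y z w : Plane} (h : CCW [x, y, z, w]) :
    ¬ Meets x y z w ∧ ¬ Meets y z x w ∧ Meets x z y w := by
  have a1 := h x y z (by simp)
  have a2 := h x y w (by simp)
  have a3 := h x z w (by simp)
  have a4 := h y z w (by simp)
  refine ⟨not_meets_of_area_pos a1 a2, not_meets_of_area_pos ?_ a4, ?_⟩
  · rwa [area_rotate]
  · refine meets_of_area a1 a3 a2.le ?_
    rw [area_swap]; linarith

theorem CyclicOrder.four {x y z w : Plane} (h : CyclicOrder [x, y, z, w]) :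
    ¬ Meets x y z w ∧ ¬ Meets y z x w ∧ Meets x z y w := by
  rcases h with h | h
  · exact h.four
  · obtain ⟨h1, h2, h3⟩ := CCW.four h
    refine ⟨fun h => h1 ?_, fun h => h2 ?_, ?_⟩
    · exact h.symm.swap_left.swap_right
    · exact h.swap_left.swap_right
    · exact h3.symm.swap_left.swap_right

/-- The list enumerates the set in cyclic order. -/
structure IsHull (C : Set Plane) (l : List Plane) : Prop where
  nodup : l.Nodup
  mem_iff : ∀ x, x ∈ l ↔ x ∈ C
  cyclic : CyclicOrder l

variable {C : Set Plane}

theorem IsHull.rotate {l₁ l₂ : List Plane} (h : IsHull C (l₁ ++ l₂)) : IsHull C (l₂ ++ l₁) :=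
  ⟨(List.perm_append_comm.nodup_iff).1 h.nodup,
    fun x => by rw [← h.mem_iff, List.mem_append, List.mem_append, or_comm], h.cyclic.rotate⟩

theorem IsHull.reverse {l : List Plane} (h : IsHull C l) : IsHull C l.reverse :=
  ⟨List.nodup_reverse.2 h.nodup, fun x => by rw [List.mem_reverse, h.mem_iff], h.cyclic.reverse⟩

/-- `ξ` sees the point `c` past the segments spanned by `T`. -/
def SeesPast (ξ : Plane) (T : Set Plane) (c : Plane) : Prop :=
  ∀ x ∈ T, ∀ y ∈ T, x ≠ y → x ≠ c → y ≠ c → ¬ Meets ξ c x y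

theorem SeesPast.mono {ξ c : Plane} {T T' : Set Plane} (h : SeesPast ξ T c) (hT : T' ⊆ T) :
    SeesPast ξ T' c :=
  fun x hx y hy => h x (hT hx) y (hT hy)

theorem notMem_hull_diff (hC : InConvexPosition C) {x : Plane} (hx : x ∈ C) :
    x ∉ convexHull ℝ (C \ {x}) :=
  (convexIndependent_set_iff_notMem_convexHull_sdiff.1 hC) x hx

/-- Sort the other points by angle around a point `p` of `C`. If transitivity failed at `x, y, z`,
the triangle `xyz` would contain `p`; if a sorted triple `x, y, z` were not counterclockwise, the
triangle `pxz` would contain `y`. Convex position excludes both. -/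
theorem exists_hull (hfin : C.Finite) (hne : C.Nonempty) (hC : InConvexPosition C)
    (hgen : InGeneralPosition C) : ∃ l, IsHull C l ∧ CCW l := by
  classical
  obtain ⟨p, hp⟩ := hne
  have hs : ∀ x, x ∈ hfin.toFinset.erase p ↔ x ≠ p ∧ x ∈ C := by simp
  obtain ⟨l, hl, hmem, hr⟩ := exists_pairwise_list (hfin.toFinset.erase p)
    (fun x y => 0 < area p x y)
    (by
      intro x hx y hy hxy
      rw [hs] at hx hy
      have := area_ne_zero hgen hp hx.2 hy.2 hx.1.symm hy.1.symm hxy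
      rw [area_swap p x y]
      rcases this.lt_or_gt with h | h
      · right; linarith
      · left; exact h)
    (by
      intro x hx y hy z hz hxy hyz
      rw [hs] at hx hy hz
      by_contra hxz
      refine notMem_hull_diff hC hp (mem_hull_of_area (a := x) (b := y) (c := z) ⟨hx.2, hx.1⟩ ⟨hy.2, hy.1⟩
        ⟨hz.2, hz.1⟩ ?_ ?_ ?_ ?_)
      · rw [← area_rotate]; rw [area_rotate, area_rotate]; exact hxy.le
      · rw [area_rotate]; exact hyz.le
      · rw [area_rotate, area_swap]; linarith
      · have : area x y z = area p x y + area p y z - area p x z := by unfold area; ring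
        linarith)
  have hmem' : ∀ x, x ∈ p :: l ↔ x ∈ C := by
    intro x
    rw [List.mem_cons, hmem, hs]
    by_cases h : x = p
    · subst h; simp [hp]
    · simp [h]
  have hpl : p ∉ l := by rw [hmem, hs]; simp
  have hccw : CCW (p :: l) := by
    intro x y z hxyz
    rcases List.sublist_cons_iff.1 hxyz with h | ⟨r, hr', h⟩
    · have hh := hr.sublist h
      simp only [List.pairwise_cons, List.mem_cons, List.not_mem_nil, or_false] at hh
      have hxy := hh.1 y (Or.inl rfl)
      have hxz := hh.1 z (Or.inr rfl)
      have hyz := hh.2.1 z rfl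
      have hnd := hl.sublist h
      simp only [List.nodup_cons, List.mem_cons, List.not_mem_nil, or_false, not_or] at hnd
      have hx := (hs x).1 ((hmem x).1 (h.subset (by simp)))
      have hy := (hs y).1 ((hmem y).1 (h.subset (by simp)))
      have hz := (hs z).1 ((hmem z).1 (h.subset (by simp)))
      by_contra hneg
      refine notMem_hull_diff hC hy.2 (mem_hull_of_area (a := p) (b := x) (c := z) ⟨hp, hy.1.symm⟩
        ⟨hx.2, hnd.1.1⟩ ⟨hz.2, fun h => hnd.2.1 h.symm⟩ hxy.le ?_ ?_ hxz)
      · rw [area_swap]; linarith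
      · rw [← area_rotate]; exact hyz.le
    · simp only [List.cons.injEq] at hr'
      obtain ⟨rfl, rfl⟩ := hr'
      have hh := hr.sublist h
      simp at hh
      exact hh
  exact ⟨p :: l, ⟨List.nodup_cons.2 ⟨hpl, hl⟩, hmem', Or.inl hccw⟩, hccw⟩

/-- Rotate the second list to start at the head `a` of the first. Both tails are then sorted by the
antisymmetric angular order around `a`, hence equal. -/
theorem CCW.isRotated {l l' : List Plane} (hl : CCW l) (hl' : CCW l') (h : IsHull C l)
    (h' : IsHull C l') : ∃ M N, l = M ++ N ∧ l' = N ++ M := by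
  rcases l with _ | ⟨a, t⟩
  · have : l' = [] := by
      rw [List.eq_nil_iff_forall_not_mem]
      intro x hx
      simpa using (h.mem_iff x).2 ((h'.mem_iff x).1 hx)
    exact ⟨[], [], rfl, this⟩
  · obtain ⟨N, M, rfl⟩ := List.append_of_mem ((h'.mem_iff a).2 ((h.mem_iff a).1 (by simp)))
    have key : ∀ s : List Plane, CCW (a :: s) → s.Pairwise (fun x y => 0 < area a x y) := by
      intro s hs
      rw [List.pairwise_iff_forall_sublist]
      intro x y hxy
      exact hs a x y (hxy.cons_cons a)
    have hr := hl'.rotate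
    have hhr := h'.rotate
    rw [List.cons_append] at hr hhr
    have ht : t = M ++ N := by
      refine List.Perm.eq_of_pairwise (le := fun x y => 0 < area a x y) ?_ (key _ hl) (key _ hr) ?_
      · intro x y _ _ hxy hyx
        rw [area_swap] at hyx
        linarith
      · rw [List.perm_ext_iff_of_nodup (List.nodup_cons.1 h.nodup).2
          (List.nodup_cons.1 hhr.nodup).2]
        intro x
        have e1 := h.mem_iff x
        have e2 := hhr.mem_iff x
        have n1 := (List.nodup_cons.1 h.nodup).1
        have n2 := (List.nodup_cons.1 hhr.nodup).1
        rw [List.mem_cons] at e1 e2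
        constructor
        · intro hx
          rcases e2.2 (e1.1 (Or.inr hx)) with rfl | hx'
          · exact absurd hx n1
          · exact hx'
        · intro hx
          rcases e1.2 (e2.1 (Or.inr hx)) with rfl | hx'
          · exact absurd hx n2
          · exact hx'
    exact ⟨a :: M, N, by rw [ht]; rfl, rfl⟩

end PlanePaths

/-! ### Visibility of hull points from `ξ` -/

namespace PlanePaths

/-- Points in convex position and a point outside of their convex hull, in general position. -/
structure OuterPoint (C : Set Plane) (ξ : Plane) : Prop where
  fin : C.Finite
  convex : InConvexPosition C
  outside : ξ ∉ convexHull ℝ C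
  general : InGeneralPosition (insert ξ C)

variable {C : Set Plane} {ξ : Plane}

theorem OuterPoint.notMem (h : OuterPoint C ξ) : ξ ∉ C :=
  fun hξ => h.outside (subset_convexHull ℝ C hξ)

theorem OuterPoint.area_ne (h : OuterPoint C ξ) {a b : Plane} (ha : a ∈ C) (hb : b ∈ C)
    (hab : a ≠ b) : area a b ξ ≠ 0 :=
  area_ne_zero h.general (Or.inr ha) (Or.inr hb) (Or.inl rfl) hab
    (fun e => h.notMem (e ▸ ha)) (fun e => h.notMem (e ▸ hb))

/-- Seen from `c`, the point `ξ` lies in the angle between `x` and `y`. It must lie beyond `xy`,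
since otherwise it would be in the triangle `cxy`. -/
theorem OuterPoint.area_neg (h : OuterPoint C ξ) {c x y : Plane} (hc : c ∈ C) (hx : x ∈ C)
    (hy : y ∈ C) (h1 : 0 < area c x ξ) (h2 : 0 < area c ξ y) (h3 : 0 < area c x y) :
    area x y ξ < 0 := by
  by_contra hneg
  refine h.outside (mem_hull_of_area hc hx hy h1.le (not_lt.1 hneg) ?_ h3)
  rw [← area_rotate y c ξ]
  exact h2.le

theorem OuterPoint.meets (h : OuterPoint C ξ) {c x y : Plane} (hc : c ∈ C) (hx : x ∈ C)
    (hy : y ∈ C) (h1 : 0 < area c x ξ) (h2 : 0 < area c ξ y) (h3 : 0 < area c x y) :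
    Meets ξ c x y :=
  (meets_of_area h1 h2 h3.le (h.area_neg hc hx hy h1 h2 h3).le).swap_left

/-- The converse of `OuterPoint.meets`: evaluate the affine functions `area a x` and `area a y` at
the common point, written as a convex combination in both ways. -/
theorem OuterPoint.area_pos_of_meets (h : OuterPoint C ξ) {a x y : Plane} (ha : a ∈ C)
    (hx : x ∈ C) (hy : y ∈ C) (hxa : x ≠ a) (hya : y ≠ a) (hm : Meets ξ a x y)
    (hD : 0 < area a x y) : 0 < area a x ξ ∧ 0 < area a ξ y := by
  obtain ⟨p, ⟨s, t, hs, ht, hst, rfl⟩, s', t', hs', ht', hst', hp⟩ := hm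
  have e1 : s * area a x ξ = t' * area a x y := by
    have e := congrArg (area a x) hp
    rw [area_combo _ _ _ _ _ _ hst, area_combo _ _ _ _ _ _ hst'] at e
    have z1 : area a x x = 0 := by unfold area; ring
    have z2 : area a x a = 0 := by unfold area; ring
    rw [z1, z2] at e
    linarith
  have e2 : s * area a ξ y = s' * area a x y := by
    have e := congrArg (area a y) hp
    rw [area_combo _ _ _ _ _ _ hst, area_combo _ _ _ _ _ _ hst'] at e
    have z1 : area a y y = 0 := by unfold area; ring
    have z2 : area a y a = 0 := by unfold area; ring
    rw [z1, z2, area_swap a x y, area_swap a ξ y] at e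
    linarith
  have n1 := h.area_ne ha hx hxa.symm
  have n2 := h.area_ne ha hy hya.symm
  rw [area_swap] at n2
  -- With `s = 0` the common point is `a`, both affine functions vanish there, and both weights on
  -- `xy` would have to be zero.
  have hs0 : 0 < s := by
    rcases hs.eq_or_lt with h0 | h0
    · subst h0
      have : t' = 0 := by
        rcases mul_eq_zero.1 ((zero_mul (area a x ξ)).symm.trans e1).symm with h | h
        · exact h
        · linarith
      have : s' = 0 := by
        rcases mul_eq_zero.1 ((zero_mul (area a ξ y)).symm.trans e2).symm with h | h
        · exact h
        · linarith
      linarith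
    · exact h0
  constructor
  · have : 0 ≤ s * area a x ξ := by rw [e1]; positivity
    exact lt_of_le_of_ne (nonneg_of_mul_nonneg_right this hs0) n1.symm
  · have : 0 ≤ s * area a ξ y := by rw [e2]; positivity
    refine lt_of_le_of_ne (nonneg_of_mul_nonneg_right this hs0) ?_
    intro e
    rw [← e] at n2
    simp at n2

theorem exists_split {α : Type*} (P : α → Prop) (l : List α)
    (h : l.Pairwise (fun x y => P x → P y)) :
    ∃ R L, l = R ++ L ∧ (∀ x ∈ R, ¬ P x) ∧ ∀ x ∈ L, P x := by
  induction l with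
  | nil => exact ⟨[], [], by simp⟩
  | cons a t ih =>
    rw [List.pairwise_cons] at h
    by_cases ha : P a
    · exact ⟨[], a :: t, rfl, by simp, by
        intro x hx
        rcases List.mem_cons.1 hx with rfl | hx
        · exact ha
        · exact h.1 x hx ha⟩
    · obtain ⟨R, L, rfl, hR, hL⟩ := ih h.2
      refine ⟨a :: R, L, rfl, ?_, hL⟩
      intro x hx
      rcases List.mem_cons.1 hx with rfl | hx
      · exact ha
      · exact hR x hx

theorem pair_sublist_or {α : Type*} {l : List α} {x y : α} (hx : x ∈ l) (hy : y ∈ l)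
    (hxy : x ≠ y) : [x, y].Sublist l ∨ [y, x].Sublist l := by
  obtain ⟨s, t, rfl⟩ := List.append_of_mem hx
  rcases List.mem_append.1 hy with h | h
  · right
    exact (List.singleton_sublist.2 h).append (List.singleton_sublist.2 List.mem_cons_self)
  · left
    rcases List.mem_cons.1 h with h | h
    · exact absurd h.symm hxy
    · exact List.Sublist.trans ((List.singleton_sublist.2 h).cons_cons x)
        (List.sublist_append_right s _)

/-- The angles of the points of `l` at `a` increase within less than a half turn. A blocking segment
shows that the ray from `a` to `ξ` points into this angular range, so the points to its right come
before the points to its left. -/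
theorem OuterPoint.blocked_sides (h : OuterPoint C ξ) {a : Plane} {l : List Plane}
    (hl : IsHull C (a :: l)) (hccw : CCW (a :: l)) (hvis : ¬ SeesPast ξ C a) :
    (∃ x y, x ∈ l ∧ y ∈ l ∧ area a ξ x < 0 ∧ 0 < area a ξ y) ∧
      l.Pairwise (fun x y => 0 < area a ξ x → 0 < area a ξ y) := by
  have haC : a ∈ C := (hl.mem_iff a).1 List.mem_cons_self
  have hmem : ∀ x ∈ l, x ∈ C ∧ x ≠ a := fun x hx =>
    ⟨(hl.mem_iff x).1 (List.mem_cons_of_mem _ hx),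
      fun e => (List.nodup_cons.1 hl.nodup).1 (e ▸ hx)⟩
  have hD : ∀ x y, [x, y].Sublist l → 0 < area a x y :=
    fun x y hxy => hccw a x y (hxy.cons_cons a)
  obtain ⟨x, y, hxy, h1, h2⟩ : ∃ x y, [x, y].Sublist l ∧ 0 < area a x ξ ∧ 0 < area a ξ y := by
    unfold SeesPast at hvis
    push Not at hvis
    obtain ⟨x, hx, y, hy, hxy, hxa, hya, hm⟩ := hvis
    have hxl := (List.mem_cons.1 ((hl.mem_iff x).2 hx)).resolve_left hxa
    have hyl := (List.mem_cons.1 ((hl.mem_iff y).2 hy)).resolve_left hya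
    rcases pair_sublist_or hxl hyl hxy with hs | hs
    · exact ⟨x, y, hs, h.area_pos_of_meets haC hx hy hxa hya hm (hD _ _ hs)⟩
    · exact ⟨y, x, hs, h.area_pos_of_meets haC hy hx hya hxa hm.swap_right (hD _ _ hs)⟩
  have hx' : area a ξ x < 0 := by rw [area_swap] at h1; linarith
  refine ⟨⟨x, y, hxy.subset (by simp), hxy.subset (by simp), hx', h2⟩, ?_⟩
  rw [List.pairwise_iff_forall_sublist]
  intro z z' hzz hz
  by_contra hz'
  have hz'l := hmem z' (hzz.subset (by simp))
  have hneg : area a ξ z' < 0 := by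
    have := h.area_ne haC hz'l.1 hz'l.2.symm
    rw [area_swap] at this
    exact lt_of_le_of_ne (not_lt.1 hz') (fun e => this (by rw [e]; simp))
  rcases l with _ | ⟨f, t⟩
  · simp at hxy
  have first : ∀ w ∈ f :: t, 0 ≤ area a f w := by
    intro w hw
    rcases List.mem_cons.1 hw with rfl | hw
    · unfold area; ring_nf; exact le_rfl
    · exact (hD f w ((List.singleton_sublist.2 hw).cons_cons f)).le
  have second : ∀ v w, [v, w].Sublist (f :: t) → 0 < area a f w := by
    intro v w hvw
    refine hD f w ?_
    rcases List.sublist_cons_iff.1 hvw with hs | ⟨r, hr, hs⟩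
    · exact (List.Sublist.trans (List.sublist_cons_self v [w]) hs).cons_cons f
    · simp only [List.cons.injEq] at hr
      obtain ⟨rfl, rfl⟩ := hr
      exact hs.cons_cons _
  -- Three-term Plücker relations for the directions from `a`. With `f` the first point of the list,
  -- the blocking pair forces `area a f ξ` to be positive, while a pair violating monotonicity makes
  -- its product with a positive area negative.
  have id1 : area a f ξ * area a x y = area a ξ y * area a f x + area a x ξ * area a f y := by
    unfold area; ring
  have id2 : area a f ξ * area a z z' = area a ξ z' * area a f z - area a ξ z * area a f z' := by
    unfold area; ring
  have p1 := hD x y hxy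
  have p2 := hD z z' hzz
  have p3 := first x (hxy.subset (by simp))
  have p4 := first z (hzz.subset (by simp))
  have p5 := second x y hxy
  have p6 := second z z' hzz
  have q1 : 0 < area a f ξ := by
    have : 0 < area a f ξ * area a x y := by
      rw [id1]
      have := mul_nonneg h2.le p3
      have := mul_pos h1 p5
      linarith
    exact pos_of_mul_pos_left this p1.le
  have q2 : area a f ξ * area a z z' < 0 := by
    rw [id2]
    have := mul_nonneg (neg_nonneg.2 hneg.le) p4
    have := mul_pos hz p6
    linarith
  exact absurd (mul_pos q1 p2) (not_lt.2 q2.le)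

/-- The line `uv` separates `ξ` from `C`, and the segment from `ξ` touches it only at `c`. A
blocking segment would thus pass through `c`, contrary to general position. -/
theorem OuterPoint.seesPast_of_supporting (h : OuterPoint C ξ) {u v c : Plane} (hcC : c ∈ C)
    (hsup : ∀ z ∈ C, 0 ≤ area u v z) (hneg : area u v ξ < 0) (hc : area u v c = 0) :
    SeesPast ξ C c := by
  rintro x hx y hy hxy hxc hyc ⟨p, ⟨s, t, hs, ht, hst, rfl⟩, s', t', hs', ht', hst', hp⟩
  have e := congrArg (area u v) hp
  rw [area_combo _ _ _ _ _ _ hst, area_combo _ _ _ _ _ _ hst', hc] at e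
  have h1 := mul_nonneg hs' (hsup x hx)
  have h2 := mul_nonneg ht' (hsup y hy)
  have hs0 : s = 0 := by
    rcases hs.eq_or_lt with h0 | h0
    · exact h0.symm
    · have := mul_pos h0 (neg_pos.2 hneg)
      linarith
  have ht1 : t = 1 := by linarith
  rw [hs0, ht1, zero_smul, one_smul, zero_add] at hp
  refine area_ne_zero h.general (Or.inr hx) (Or.inr hy) (Or.inr hcC) hxy hxc hyc ?_
  rw [← hp, area_combo _ _ _ _ _ _ hst']
  unfold area
  ring

/-- The structure of the hull around a point of `C` that is hidden from `ξ`. -/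
structure IsSplit (C : Set Plane) (ξ a : Plane) (R L : List Plane) : Prop where
  left_ne : R ≠ []
  right_ne : L ≠ []
  meets : ∀ x ∈ R, ∀ y ∈ L, Meets ξ a x y
  sees_left : SeesPast ξ {x | x ∈ a :: R} a
  sees_right : SeesPast ξ {x | x ∈ L} a
  last_visible : ∀ u ∈ R.getLast?, SeesPast ξ C u
  head_visible : ∀ v ∈ L.head?, SeesPast ξ C v

theorem seesPast_cons {T : Set Plane} {a : Plane} (h : SeesPast ξ T a) :
    SeesPast ξ (insert a T) a := by
  intro x hx y hy hxy hxa hya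
  exact h x (hx.resolve_left hxa) y (hy.resolve_left hya) hxy hxa hya

theorem IsSplit.reverse {a : Plane} {R L : List Plane} (hs : IsSplit C ξ a R L) :
    IsSplit C ξ a L.reverse R.reverse := by
  refine ⟨by simpa using hs.right_ne, by simpa using hs.left_ne, ?_, ?_, ?_, ?_, ?_⟩
  · intro x hx y hy
    exact (hs.meets y (by simpa using hy) x (by simpa using hx)).swap_right
  · refine (seesPast_cons hs.sees_right).mono ?_
    intro x hx
    simpa using hx
  · refine hs.sees_left.mono ?_
    intro x hx
    simp at hx ⊢
    exact Or.inr hx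
  · intro u hu
    rw [List.getLast?_reverse] at hu
    exact hs.head_visible u hu
  · intro v hv
    rw [List.head?_reverse] at hv
    exact hs.last_visible v hv

/-- `R` and `L` are the points to the right and to the left of the ray from `a` to `ξ`. Segments
between the two sides block `a`; segments within one side do not reach the line through `a` and `ξ`.
-/
theorem OuterPoint.exists_split_ccw (h : OuterPoint C ξ) {a : Plane} {l : List Plane}
    (hl : IsHull C (a :: l)) (hccw : CCW (a :: l)) (hvis : ¬ SeesPast ξ C a) :
    ∃ R L, l = R ++ L ∧ IsSplit C ξ a R L := by
  obtain ⟨⟨x, y, hxl, hyl, hx, hy⟩, hpw⟩ := h.blocked_sides hl hccw hvis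
  obtain ⟨R, L, rfl, hR, hL⟩ := exists_split _ l hpw
  have haC : a ∈ C := (hl.mem_iff a).1 List.mem_cons_self
  have hmem : ∀ x ∈ R ++ L, x ∈ C ∧ x ≠ a := fun x hx =>
    ⟨(hl.mem_iff x).1 (List.mem_cons_of_mem _ hx),
      fun e => (List.nodup_cons.1 hl.nodup).1 (e ▸ hx)⟩
  have hR' : ∀ z ∈ R, 0 < area a z ξ := by
    intro z hz
    have hzl := hmem z (List.mem_append_left _ hz)
    have n := h.area_ne haC hzl.1 hzl.2.symm
    have := hR z hz
    rw [area_swap] at this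
    exact lt_of_le_of_ne (by linarith) n.symm
  have hcross : ∀ x ∈ R, ∀ y ∈ L, 0 < area a x y := fun x hx y hy =>
    hccw a x y (((List.singleton_sublist.2 hx).append (List.singleton_sublist.2 hy)).cons_cons a)
  have hRne : R ≠ [] := by
    rintro rfl
    exact absurd (hL x hxl) (not_lt.2 hx.le)
  have hLne : L ≠ [] := by
    rintro rfl
    exact hR y (by simpa using hyl) hy
  -- The points next to the change of side span a hull edge that has `ξ` strictly on its outer side,
  -- so its line is supporting and both endpoints are visible.
  have hedge : ∀ u ∈ R.getLast?, ∀ v ∈ L.head?,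
      area u v ξ < 0 ∧ ∀ z ∈ C, 0 ≤ area u v z := by
    intro u hu v hv
    obtain ⟨R', rfl⟩ : ∃ R', R = R' ++ [u] := ⟨R.dropLast, by
      rw [Option.mem_def] at hu
      exact (List.dropLast_append_getLast? u hu).symm⟩
    obtain ⟨L', rfl⟩ : ∃ L', L = v :: L' := List.head?_eq_some_iff.1 hv
    have huR : u ∈ R' ++ [u] := by simp
    have hvL : v ∈ v :: L' := by simp
    refine ⟨h.area_neg haC (hmem u (by simp)).1 (hmem v (by simp)).1 (hR' u huR) (hL v hvL)
      (hcross u huR v hvL), ?_⟩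
    intro z hz
    have hz' := (hl.mem_iff z).2 hz
    have e : a :: (R' ++ [u] ++ v :: L') = (a :: R') ++ ([u, v] ++ L') := by simp
    rw [e] at hz' hccw
    rcases List.mem_append.1 hz' with hz' | hz'
    · rw [area_rotate z u v]
      refine (hccw z u v ?_).le
      exact (List.singleton_sublist.2 hz').append (List.sublist_append_left [u, v] L')
    · rcases List.mem_append.1 hz' with hz' | hz'
      · simp only [List.mem_cons, List.not_mem_nil, or_false] at hz'
        rcases hz' with rfl | rfl
        · unfold area; ring_nf; exact le_rfl
        · unfold area; ring_nf; exact le_rfl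
      · refine (hccw u v z ?_).le
        exact List.Sublist.trans ((List.Sublist.refl [u, v]).append
          (List.singleton_sublist.2 hz')) (List.sublist_append_right _ _)
  refine ⟨R, L, rfl, hRne, hLne, ?_, ?_, ?_, ?_, ?_⟩
  · intro x hx y hy
    exact h.meets haC (hmem x (List.mem_append_left _ hx)).1 (hmem y (List.mem_append_right _ hy)).1
      (hR' x hx) (hL y hy) (hcross x hx y hy)
  · intro x hx y hy _ hxa hya hm
    have hx := hR' x ((List.mem_cons.1 hx).resolve_left hxa)
    have hy := hR' y ((List.mem_cons.1 hy).resolve_left hya)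
    rw [area_swap] at hx hy
    exact not_meets_of_area_neg (by linarith) (by linarith) hm.swap_left
  · intro x hx y hy _ _ _ hm
    exact not_meets_of_area_pos (hL x hx) (hL y hy) hm.swap_left
  · intro u hu
    obtain ⟨v, L', rfl⟩ := List.exists_cons_of_ne_nil hLne
    obtain ⟨h1, h2⟩ := hedge u hu v rfl
    exact h.seesPast_of_supporting
      (hmem u (List.mem_append_left _ (List.mem_of_getLast? hu))).1 h2 h1 (by unfold area; ring)
  · intro v hv
    obtain ⟨u, hu⟩ : ∃ u, R.getLast? = some u := ⟨_, List.getLast?_eq_some_getLast hRne⟩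
    obtain ⟨h1, h2⟩ := hedge u hu v hv
    exact h.seesPast_of_supporting
      (hmem v (List.mem_append_right _ (List.mem_of_head? hv))).1 h2 h1 (by unfold area; ring)

theorem OuterPoint.exists_isSplit (h : OuterPoint C ξ) {a : Plane} {l : List Plane}
    (hl : IsHull C (a :: l)) (hvis : ¬ SeesPast ξ C a) :
    ∃ R L, l = R ++ L ∧ IsSplit C ξ a R L := by
  rcases hl.cyclic with hc | hc
  · exact h.exists_split_ccw hl hc hvis
  · rw [List.reverse_cons] at hc
    have hl' := hl.reverse
    rw [List.reverse_cons] at hl'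
    obtain ⟨R, L, he, hs⟩ := h.exists_split_ccw hl'.rotate hc.rotate hvis
    have he' : l.reverse = R ++ L := he
    exact ⟨L.reverse, R.reverse, by rw [← List.reverse_append, ← he', List.reverse_reverse],
      hs.reverse⟩

/-- The arc `X` lies on the same side of `ab` as `ξ`. A hidden `x` in `X` would have hull points on
both sides of its ray to `ξ`, and the positions of `a` and `b` relative to that ray lead to a
contradiction. -/
theorem OuterPoint.visible_arc_ccw (h : OuterPoint C ξ) {a b : Plane} {X Y : List Plane}
    (hl : IsHull C (a :: X ++ b :: Y)) (hccw : CCW (a :: X ++ b :: Y)) (ha : SeesPast ξ C a)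
    (hb : SeesPast ξ C b) (hab : area a b ξ < 0) : ∀ x ∈ X, SeesPast ξ C x := by
  intro x hx
  by_contra hvis
  obtain ⟨X₁, X₂, rfl⟩ := List.append_of_mem hx
  have e : a :: (X₁ ++ x :: X₂) ++ b :: Y = (a :: X₁) ++ (x :: (X₂ ++ b :: Y)) := by simp
  have hmem : ∀ z ∈ a :: (X₁ ++ x :: X₂) ++ b :: Y, z ∈ C := fun z hz => (hl.mem_iff z).1 hz
  have haC := hmem a (by simp)
  have hbC := hmem b (by simp)
  have hxC := hmem x (by simp)
  have hl' := hl
  have hccw' := hccw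
  rw [e] at hl' hccw'
  have hl'' := hl'.rotate
  have hccw'' := hccw'.rotate
  rw [List.cons_append] at hl'' hccw''
  obtain ⟨⟨r, z, hr, hz, hrn, hzp⟩, hpw⟩ := h.blocked_sides hl'' hccw'' hvis
  have hnd := (List.nodup_cons.1 hl''.nodup).1
  have hax : a ≠ x := by rintro rfl; simp at hnd
  have hbx : b ≠ x := by rintro rfl; simp at hnd
  have na := h.area_ne hxC haC hax.symm
  have nb := h.area_ne hxC hbC hbx.symm
  rw [area_swap] at na nb
  have hxba : 0 < area x b a := by
    apply hccw''
    simp only [List.append_assoc, List.cons_append]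
    refine List.Sublist.cons_cons _ ?_
    refine List.Sublist.trans ?_ (List.sublist_append_right _ _)
    refine List.Sublist.cons_cons _ ?_
    refine List.Sublist.trans ?_ (List.sublist_append_right _ _)
    simp
  -- If `a` and `b` are both to the right of the ray, a point `z` to its left lies between `a` and
  -- `x`, and `az` blocks `b`. If `b` is to the left, so is `a`, and a point `r` to the right lies
  -- between `x` and `b`, so that `rb` blocks `a`. If only `b` is to the right, then `ξ` lies beyond
  -- `ba`, on the wrong side of `ab`.
  rcases lt_trichotomy (area x ξ b) 0 with sb | sb | sb
  · rcases lt_trichotomy (area x ξ a) 0 with sa | sa | sa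
    · -- `z` lies between `a` and `x`
      have hzX : z ∈ X₁ := by
        have hp : (X₂ ++ b :: Y ++ [a]).Pairwise (fun x_1 y => 0 < area x ξ x_1 → 0 < area x ξ y) ∧
            ∀ w ∈ X₂ ++ b :: Y, 0 < area x ξ w → 0 < area x ξ a := by
          have e2 : X₂ ++ b :: Y ++ a :: X₁ = (X₂ ++ b :: Y ++ [a]) ++ X₁ := by simp
          rw [e2, List.pairwise_append] at hpw
          refine ⟨hpw.1, ?_⟩
          have := (List.pairwise_append.1 hpw.1).2.2
          intro w hw
          exact this w hw a (by simp)
        rcases List.mem_append.1 hz with hz | hz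
        · exact absurd (hp.2 z hz hzp) (not_lt.2 sa.le)
        · rcases List.mem_cons.1 hz with rfl | hz
          · exact absurd hzp (not_lt.2 sa.le)
          · exact hz
      have hzC := hmem z (by simp [hzX])
      have hza : z ≠ a := by
        rintro rfl
        exact absurd hzp (not_lt.2 sa.le)
      have hzb : z ≠ b := by
        rintro rfl
        exact absurd hzp (not_lt.2 sb.le)
      have t1 : 0 < area x b z := by
        apply hccw''
        simp only [List.append_assoc, List.cons_append]
        refine List.Sublist.cons_cons _ ?_
        refine List.Sublist.trans ?_ (List.sublist_append_right _ _)
        refine List.Sublist.cons_cons _ ?_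
        refine List.Sublist.trans ?_ (List.sublist_append_right _ _)
        simp [hzX]
      have t2 : 0 < area a z b := by
        apply hccw
        refine List.Sublist.append (l₁ := [a, z]) ?_ (by simp)
        simp [hzX]
      have t3 : area b z ξ < 0 := h.area_neg hxC hbC hzC (by rw [area_swap]; linarith) hzp t1
      refine hb a haC z hzC hza.symm ?_ hzb (h.meets hbC haC hzC ?_ ?_ ?_)
      · rintro rfl
        simp [area] at hab
      · have : area b a ξ = -area a b ξ := by unfold area; ring
        linarith
      · rw [area_swap]; linarith
      · rw [← area_rotate b a z]
        exact t2
    · rw [sa] at na; simp at na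
    · have := h.area_neg hxC hbC haC (by rw [area_swap]; linarith) sa hxba
      have : area b a ξ = -area a b ξ := by unfold area; ring
      linarith
  · rw [sb] at nb; simp at nb
  · have sa : 0 < area x ξ a := by
      have := (List.pairwise_append.1 hpw).2.2 b (by simp) a (by simp)
      exact this sb
    have hrX : r ∈ X₂ := by
      have e2 : X₂ ++ b :: Y ++ a :: X₁ = X₂ ++ b :: (Y ++ a :: X₁) := by simp
      rw [e2] at hr hpw
      have hp := (List.pairwise_cons.1 (List.pairwise_append.1 hpw).2.1).1
      rcases List.mem_append.1 hr with hr | hr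
      · exact hr
      · rcases List.mem_cons.1 hr with rfl | hr
        · linarith
        · have := hp r hr sb
          linarith
    have hrC := hmem r (by simp [hrX])
    have hra : r ≠ a := by
      rintro rfl
      linarith
    have hrb : r ≠ b := by
      rintro rfl
      linarith
    have t1 : 0 < area x r a := by
      apply hccw''
      simp only [List.append_assoc, List.cons_append]
      refine List.Sublist.cons_cons _ ?_
      refine List.Sublist.append (l₁ := [r]) (by simpa using hrX) ?_
      simp
    have t2 : 0 < area a r b := by
      apply hccw
      refine List.Sublist.append (l₁ := [a, r]) ?_ (by simp)
      simp [hrX]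
    have t3 : area r a ξ < 0 := h.area_neg hxC hrC haC (by rw [area_swap]; linarith) sa t1
    refine ha r hrC b hbC hrb hra ?_ (h.meets haC hrC hbC ?_ ?_ t2)
    · rintro rfl
      simp [area] at hab
    · have : area a r ξ = -area r a ξ := by unfold area; ring
      linarith
    · rw [area_swap]; linarith

/-- Of the two arcs between `a` and `b`, the one on the side of `ξ` is visible. The enumeration is
reversed if this is the arc from `b` to `a`. -/
theorem OuterPoint.exists_visible_arc (h : OuterPoint C ξ) {a b : Plane} (haC : a ∈ C)
    (hbC : b ∈ C) (hab : a ≠ b) (ha : SeesPast ξ C a) (hb : SeesPast ξ C b) :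
    ∃ X Y, IsHull C (a :: X ++ b :: Y) ∧ ∀ x ∈ X, SeesPast ξ C x := by
  obtain ⟨l, hl, hccw⟩ := exists_hull h.fin ⟨a, haC⟩ h.convex
    (fun x hx y hy z hz => h.general x (Or.inr hx) y (Or.inr hy) z (Or.inr hz))
  obtain ⟨s, t, rfl⟩ := List.append_of_mem ((hl.mem_iff a).2 haC)
  have hl' := hl.rotate
  have hccw' := hccw.rotate
  rw [List.cons_append] at hl' hccw'
  have hbm : b ∈ t ++ s :=
    (List.mem_cons.1 ((hl'.mem_iff b).2 hbC)).resolve_left hab.symm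
  obtain ⟨X, Y, hXY⟩ := List.append_of_mem hbm
  rw [hXY, ← List.cons_append] at hl' hccw'
  rcases lt_or_gt_of_ne (h.area_ne haC hbC hab) with hneg | hpos
  · exact ⟨X, Y, hl', h.visible_arc_ccw hl' hccw' ha hb hneg⟩
  · have hl2 := hl'.rotate
    have hccw2 := hccw'.rotate
    have hY := h.visible_arc_ccw hl2 hccw2 hb ha (by
      have : area b a ξ = -area a b ξ := by unfold area; ring
      linarith)
    have hl3 := hl2.rotate.reverse
    refine ⟨Y.reverse, X.reverse, ?_, by simpa using hY⟩
    have e : (a :: X ++ b :: Y).reverse = (Y.reverse ++ b :: X.reverse) ++ [a] := by simp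
    have := hl'.reverse
    rw [e] at this
    simpa using this.rotate

end PlanePaths

/-! ### Paths as lists, and flips as operations on lists -/

namespace PlanePaths

variable {S : Set Plane}

/-- The graph of the path that visits the entries of the list in order. -/
def pathOf (S : Set Plane) (p : List Plane) : SimpleGraph S where
  Adj u v := (Consec (u : Plane) v p ∨ Consec (v : Plane) u p) ∧ u ≠ v
  symm := ⟨fun _ _ h => ⟨h.1.symm, h.2.symm⟩⟩
  loopless := ⟨fun _ h => h.2 rfl⟩

theorem pathOf_congr {p q : List Plane}
    (h : ∀ u v, (Consec u v p ∨ Consec v u p) ↔ (Consec u v q ∨ Consec v u q)) :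
    pathOf S p = pathOf S q := by
  ext u v
  simp only [pathOf, h]

theorem pathOf_reverse (p : List Plane) : pathOf S p.reverse = pathOf S p :=
  pathOf_congr fun u v => by rw [consec_reverse, consec_reverse, or_comm]

/-- The list visits each point of `S` once, along non-crossing segments. -/
structure PlaneList (S : Set Plane) (p : List Plane) : Prop where
  nodup : p.Nodup
  mem_iff : ∀ x, x ∈ p ↔ x ∈ S
  noncrossing : ∀ a b c d, Consec a b p → Consec c d p → a ≠ c → a ≠ d → b ≠ c → b ≠ d →
    ¬ Meets a b c d

theorem PlaneList.reverse {p : List Plane} (h : PlaneList S p) : PlaneList S p.reverse := by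
  refine ⟨List.nodup_reverse.2 h.nodup, fun x => by rw [List.mem_reverse, h.mem_iff], ?_⟩
  intro a b c d hab hcd h1 h2 h3 h4 hm
  rw [consec_reverse] at hab hcd
  exact h.noncrossing b a d c hab hcd h4 h3 h2 h1 hm.swap_left.swap_right

theorem consec_iff_getElem? {α : Type*} {a b : α} {l : List α} :
    Consec a b l ↔ ∃ i, l[i]? = some a ∧ l[i + 1]? = some b := by
  induction l with
  | nil => simp [Consec]
  | cons x t ih =>
    rw [Consec, ih]
    constructor
    · rintro (⟨rfl, h⟩ | ⟨i, h⟩)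
      · exact ⟨0, by simp, by simpa [List.head?_eq_getElem?] using h⟩
      · exact ⟨i + 1, by simpa using h⟩
    · rintro ⟨i, h1, h2⟩
      rcases i with _ | i
      · left
        refine ⟨by simpa using h1.symm, by simpa [List.head?_eq_getElem?] using h2⟩
      · right
        exact ⟨i, by simpa using h1, by simpa using h2⟩

theorem isSpanningPath_pathOf {p : List Plane} (hn : p.Nodup) (hm : ∀ x, x ∈ p ↔ x ∈ S) :
    IsSpanningPath (pathOf S p) := by
  let f : Fin p.length → S := fun i => ⟨p[i], (hm _).1 (List.getElem_mem _)⟩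
  have hf : Function.Bijective f := by
    constructor
    · intro i j hij
      exact Fin.ext ((hn.getElem_inj_iff).1 (congrArg Subtype.val hij))
    · rintro ⟨x, hx⟩
      obtain ⟨i, hi, rfl⟩ := List.getElem_of_mem ((hm x).2 hx)
      exact ⟨⟨i, hi⟩, rfl⟩
  refine ⟨p.length, ⟨⟨Equiv.ofBijective f hf, ?_⟩⟩⟩
  have key : ∀ i j : Fin p.length, Consec p[i] p[j] p ↔ i.val + 1 = j.val := by
    intro i j
    rw [consec_iff_getElem?]
    constructor
    · rintro ⟨k, h1, h2⟩
      rw [List.getElem?_eq_some_iff] at h1 h2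
      obtain ⟨h1', h1⟩ := h1
      obtain ⟨h2', h2⟩ := h2
      have e1 := (hn.getElem_inj_iff).1 h1
      have e2 := (hn.getElem_inj_iff).1 h2
      omega
    · intro h
      refine ⟨i, by simp, ?_⟩
      rw [h]
      simp
  intro i j
  rw [SimpleGraph.pathGraph_adj]
  change (Consec p[i] p[j] p ∨ Consec p[j] p[i] p) ∧ f i ≠ f j ↔ _
  rw [key, key]
  constructor
  · exact fun h => h.1
  · intro h
    refine ⟨h, fun e => ?_⟩
    have := hf.1 e
    subst this
    omega

theorem exists_list_of_isSpanningPath {G : SimpleGraph S} (hG : IsSpanningPath G) :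
    ∃ p : List Plane, p.Nodup ∧ (∀ x, x ∈ p ↔ x ∈ S) ∧ G = pathOf S p := by
  obtain ⟨m, ⟨f⟩⟩ := hG
  have hinj : Function.Injective fun i => (f i : Plane) :=
    fun i j h => f.injective (Subtype.ext h)
  refine ⟨List.ofFn fun i => (f i : Plane), List.nodup_ofFn.2 hinj, ?_, ?_⟩
  · intro x
    rw [List.mem_ofFn]
    constructor
    · rintro ⟨i, rfl⟩
      exact (f i).2
    · intro hx
      obtain ⟨i, hi⟩ := f.surjective ⟨x, hx⟩
      exact ⟨i, by rw [hi]⟩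
  · have key : ∀ i j : Fin m, Consec (f i : Plane) (f j) (List.ofFn fun i => (f i : Plane)) ↔
        i.val + 1 = j.val := by
      intro i j
      rw [consec_iff_getElem?]
      constructor
      · rintro ⟨k, h1, h2⟩
        rw [List.getElem?_eq_some_iff] at h1 h2
        obtain ⟨h1', h1⟩ := h1
        obtain ⟨h2', h2⟩ := h2
        rw [List.getElem_ofFn] at h1 h2
        have e1 := congrArg Fin.val (hinj h1)
        have e2 := congrArg Fin.val (hinj h2)
        simp at e1 e2
        omega
      · intro h
        refine ⟨i, by simp, ?_⟩
        rw [h]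
        simp
    ext u v
    obtain ⟨i, rfl⟩ := f.surjective u
    obtain ⟨j, rfl⟩ := f.surjective v
    rw [f.map_adj_iff, SimpleGraph.pathGraph_adj]
    change _ ↔ (_ ∨ _) ∧ _
    rw [key, key]
    constructor
    · intro h
      refine ⟨h, fun e => ?_⟩
      have := f.injective e
      subst this
      omega
    · exact fun h => h.1

theorem segments_inter_subset (hS : InGeneralPosition S) {a b d : Plane} (ha : a ∈ S) (hb : b ∈ S)
    (hd : d ∈ S) (hab : a ≠ b) (had : a ≠ d) (hbd : b ≠ d) :
    segment ℝ a b ∩ segment ℝ a d ⊆ ({a, b} ∩ {a, d} : Set Plane) := by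
  intro p hp
  have := segments_inter_of_area_ne (area_ne_zero hS ha hb hd hab had hbd) hp
  rw [Set.mem_singleton_iff] at this
  subst this
  simp

/-- `PlaneList` only restricts segments without a common endpoint. For two segments that share an
endpoint, general position suffices. -/
theorem PlaneList.isPlane (hS : InGeneralPosition S) {p : List Plane} (h : PlaneList S p) :
    IsPlane (pathOf S p) := by
  intro a b c d hab hcd hne
  have hab' : (a : Plane) ≠ b := fun e => hab.2 (Subtype.ext e)
  have hcd' : (c : Plane) ≠ d := fun e => hcd.2 (Subtype.ext e)
  by_cases h1 : (a : Plane) = c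
  · rw [← h1] at hcd' ⊢
    have : (b : Plane) ≠ d := fun e => hne (by rw [Subtype.ext h1, Subtype.ext e])
    exact segments_inter_subset hS a.2 b.2 d.2 hab' hcd' this
  by_cases h2 : (a : Plane) = d
  · rw [← h2] at hcd' ⊢
    have : (b : Plane) ≠ c := fun e => hne (by rw [Subtype.ext h2, Subtype.ext e, Sym2.eq_swap])
    rw [segment_symm ℝ (c : Plane), Set.pair_comm (c : Plane)]
    exact segments_inter_subset hS a.2 b.2 c.2 hab' hcd'.symm this
  by_cases h3 : (b : Plane) = c
  · rw [← h3] at hcd' ⊢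
    rw [segment_symm ℝ (a : Plane), Set.pair_comm (a : Plane)]
    exact segments_inter_subset hS b.2 a.2 d.2 hab'.symm hcd' h2
  by_cases h4 : (b : Plane) = d
  · rw [← h4] at hcd' ⊢
    rw [segment_symm ℝ (a : Plane), Set.pair_comm (a : Plane), segment_symm ℝ (c : Plane),
      Set.pair_comm (c : Plane)]
    exact segments_inter_subset hS b.2 a.2 c.2 hab'.symm hcd'.symm h1
  have hdis : ¬ Meets (a : Plane) b c d := by
    intro hm
    rcases hab.1 with ha | ha <;> rcases hcd.1 with hc | hc
    · exact h.noncrossing _ _ _ _ ha hc h1 h2 h3 h4 hm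
    · exact h.noncrossing _ _ _ _ ha hc h2 h1 h4 h3 hm.swap_right
    · exact h.noncrossing _ _ _ _ ha hc h3 h4 h1 h2 hm.swap_left
    · exact h.noncrossing _ _ _ _ ha hc h4 h3 h2 h1 hm.swap_left.swap_right
  intro q hq
  exact absurd ⟨q, hq⟩ hdis

theorem exists_planeList (P : PlanePath S) : ∃ p, PlaneList S p ∧ P.1 = pathOf S p := by
  obtain ⟨p, hn, hm, hp⟩ := exists_list_of_isSpanningPath P.2.1
  refine ⟨p, ⟨hn, hm, ?_⟩, hp⟩
  intro a b c d hab hcd h1 h2 h3 h4 hmeet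
  have hplane := P.2.2
  rw [hp] at hplane
  have ma := (hm a).1 hab.mem.1
  have mb := (hm b).1 hab.mem.2
  have mc := (hm c).1 hcd.mem.1
  have md := (hm d).1 hcd.mem.2
  obtain ⟨q, hq⟩ := hmeet
  have := hplane ⟨a, ma⟩ ⟨b, mb⟩ ⟨c, mc⟩ ⟨d, md⟩
    ⟨Or.inl hab, fun e => hab.ne hn (congrArg Subtype.val e)⟩
    ⟨Or.inl hcd, fun e => hcd.ne hn (congrArg Subtype.val e)⟩
    (by
      intro e
      rw [Sym2.eq_iff] at e
      rcases e with e | e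
      · exact h1 (congrArg Subtype.val e.1)
      · exact h2 (congrArg Subtype.val e.1)) hq
  obtain ⟨u, v⟩ := this
  simp only [Set.mem_insert_iff, Set.mem_singleton_iff] at u v
  rcases u with rfl | rfl <;> rcases v with rfl | rfl <;> contradiction

theorem ncard_symmDiff_edgeSet {V : Type*} {G H : SimpleGraph V} {K : V → V → Prop} {x y z w : V}
    (hG : ∀ u v, G.Adj u v ↔ K u v ∨ s(u, v) = s(x, y))
    (hH : ∀ u v, H.Adj u v ↔ K u v ∨ s(u, v) = s(z, w))
    (hxy : ¬ K x y) (hyx : ¬ K y x) (hzw : ¬ K z w) (hwz : ¬ K w z) (hne : s(x, y) ≠ s(z, w)) :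
    (symmDiff G.edgeSet H.edgeSet).ncard = 2 := by
  have : symmDiff G.edgeSet H.edgeSet = {s(x, y), s(z, w)} := by
    ext e
    induction e with
    | _ u v =>
      rw [Set.mem_symmDiff, SimpleGraph.mem_edgeSet, SimpleGraph.mem_edgeSet, hG, hH]
      simp only [Set.mem_insert_iff, Set.mem_singleton_iff]
      have k1 : s(u, v) = s(x, y) → ¬ K u v := by
        intro e
        rcases Sym2.eq_iff.1 e with ⟨rfl, rfl⟩ | ⟨rfl, rfl⟩ <;> assumption
      have k2 : s(u, v) = s(z, w) → ¬ K u v := by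
        intro e
        rcases Sym2.eq_iff.1 e with ⟨rfl, rfl⟩ | ⟨rfl, rfl⟩ <;> assumption
      have k3 : s(u, v) = s(x, y) → ¬ s(u, v) = s(z, w) := fun e e' => hne (e.symm.trans e')
      tauto
  rw [this, Set.ncard_pair hne]

/-- Two lists with the same adjacencies. -/
def SameAdj (p q : List Plane) : Prop :=
  q = p ∨ q = p.reverse

theorem SameAdj.consec_iff {p q : List Plane} (h : SameAdj p q) (u v : Plane) :
    (Consec u v p ∨ Consec v u p) ↔ (Consec u v q ∨ Consec v u q) := by
  rcases h with rfl | rfl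
  · rfl
  · rw [consec_reverse, consec_reverse, or_comm]

theorem SameAdj.mem_iff {p q : List Plane} (h : SameAdj p q) (u : Plane) : u ∈ p ↔ u ∈ q := by
  rcases h with rfl | rfl <;> simp

theorem pathOf_append_adj {p₁ p₂ : List Plane} {X Y : S} (hx : p₁.getLast? = some (X : Plane))
    (hy : p₂.head? = some (Y : Plane)) (hXY : X ≠ Y) (u v : S) :
    (pathOf S (p₁ ++ p₂)).Adj u v ↔ (((Consec (u : Plane) v p₁ ∨ Consec (v : Plane) u p₁) ∨
      (Consec (u : Plane) v p₂ ∨ Consec (v : Plane) u p₂)) ∧ u ≠ v) ∨ s(u, v) = s(X, Y) := by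
  change (Consec (u : Plane) v (p₁ ++ p₂) ∨ Consec (v : Plane) u (p₁ ++ p₂)) ∧ u ≠ v ↔ _
  rw [consec_append, consec_append, hx, hy, Sym2.eq_iff, Option.some.injEq, Option.some.injEq,
    Option.some.injEq, Option.some.injEq, ← Subtype.ext_iff, ← Subtype.ext_iff, ← Subtype.ext_iff,
    ← Subtype.ext_iff]
  constructor
  · rintro ⟨(h | h | ⟨rfl, rfl⟩) | h | h | ⟨rfl, rfl⟩, hne⟩
    · exact Or.inl ⟨Or.inl (Or.inl h), hne⟩
    · exact Or.inl ⟨Or.inr (Or.inl h), hne⟩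
    · exact Or.inr (Or.inl ⟨rfl, rfl⟩)
    · exact Or.inl ⟨Or.inl (Or.inr h), hne⟩
    · exact Or.inl ⟨Or.inr (Or.inr h), hne⟩
    · exact Or.inr (Or.inr ⟨rfl, rfl⟩)
  · rintro (⟨(h | h) | h | h, hne⟩ | ⟨rfl, rfl⟩ | ⟨rfl, rfl⟩)
    · exact ⟨Or.inl (Or.inl h), hne⟩
    · exact ⟨Or.inr (Or.inl h), hne⟩
    · exact ⟨Or.inl (Or.inr (Or.inl h)), hne⟩
    · exact ⟨Or.inr (Or.inr (Or.inl h)), hne⟩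
    · exact ⟨Or.inl (Or.inr (Or.inr ⟨rfl, rfl⟩)), hXY⟩
    · exact ⟨Or.inr (Or.inr (Or.inr ⟨rfl, rfl⟩)), hXY.symm⟩

/-- Every edge inside the two parts survives a reversal, so only the edge joining them can change.
The graphs coincide if a part is empty or the new joining edge equals the old one. -/
theorem adj_or_eq_of_exchange {P Q : PlanePath S} {p₁ p₂ q₁ q₂ : List Plane}
    (hp : PlaneList S (p₁ ++ p₂)) (h₁ : SameAdj p₁ q₁) (h₂ : SameAdj p₂ q₂)
    (hP : P.1 = pathOf S (p₁ ++ p₂)) (hQ : Q.1 = pathOf S (q₁ ++ q₂)) :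
    P = Q ∨ (flipGraph S).Adj P Q := by
  rcases p₁.eq_nil_or_concat with rfl | ⟨s, x, rfl⟩
  · left
    apply Subtype.ext
    have : q₁ = [] := by rcases h₁ with rfl | rfl <;> rfl
    subst this
    rw [hP, hQ]
    exact pathOf_congr h₂.consec_iff
  rcases p₂ with _ | ⟨y, t⟩
  · left
    apply Subtype.ext
    have : q₂ = [] := by rcases h₂ with rfl | rfl <;> rfl
    subst this
    rw [hP, hQ, List.append_nil, List.append_nil]
    exact pathOf_congr h₁.consec_iff
  generalize hp₁ : s.concat x = p₁ at *
  generalize hp₂ : y :: t = p₂ at *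
  have hx : p₁.getLast? = some x := by rw [← hp₁]; simp
  have hy : p₂.head? = some y := by rw [← hp₂]; simp
  have hq₁ : q₁ ≠ [] := by
    rintro rfl
    have := (h₁.mem_iff x).1 (List.mem_of_getLast? hx)
    simp at this
  have hq₂ : q₂ ≠ [] := by
    rintro rfl
    have := (h₂.mem_iff y).1 (List.mem_of_head? hy)
    simp at this
  obtain ⟨z, hz⟩ : ∃ z, q₁.getLast? = some z := ⟨_, List.getLast?_eq_some_getLast hq₁⟩
  obtain ⟨w, hw⟩ : ∃ w, q₂.head? = some w := ⟨_, List.head?_eq_some_head hq₂⟩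
  have hxm := List.mem_of_getLast? hx
  have hym := List.mem_of_head? hy
  have hzm := (h₁.mem_iff z).2 (List.mem_of_getLast? hz)
  have hwm := (h₂.mem_iff w).2 (List.mem_of_head? hw)
  have hdisj : ∀ a ∈ p₁, ∀ b ∈ p₂, a ≠ b := (List.nodup_append.1 hp.nodup).2.2
  have hmS : ∀ a ∈ p₁ ++ p₂, a ∈ S := fun a ha => (hp.mem_iff a).1 ha
  let X : S := ⟨x, hmS x (List.mem_append_left _ hxm)⟩
  let Y : S := ⟨y, hmS y (List.mem_append_right _ hym)⟩
  let Z : S := ⟨z, hmS z (List.mem_append_left _ hzm)⟩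
  let W : S := ⟨w, hmS w (List.mem_append_right _ hwm)⟩
  let K : S → S → Prop := fun u v => ((Consec (u : Plane) v p₁ ∨ Consec (v : Plane) u p₁) ∨
    (Consec (u : Plane) v p₂ ∨ Consec (v : Plane) u p₂)) ∧ u ≠ v
  have hXY : X ≠ Y := fun e => hdisj x hxm y hym (congrArg Subtype.val e)
  have hZW : Z ≠ W := fun e => hdisj z hzm w hwm (congrArg Subtype.val e)
  have hG : ∀ u v, P.1.Adj u v ↔ K u v ∨ s(u, v) = s(X, Y) := by
    intro u v
    rw [hP, pathOf_append_adj (X := X) (Y := Y) hx hy hXY]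
  have hH : ∀ u v, Q.1.Adj u v ↔ K u v ∨ s(u, v) = s(Z, W) := by
    intro u v
    rw [hQ, pathOf_append_adj (X := Z) (Y := W) hz hw hZW, ← h₁.consec_iff, ← h₂.consec_iff]
  have hK : ∀ u v : S, (u : Plane) ∈ p₁ → (v : Plane) ∈ p₂ → ¬ K u v ∧ ¬ K v u := by
    intro u v hu hv
    have n1 : (v : Plane) ∉ p₁ := fun h => hdisj _ h _ hv rfl
    have n2 : (u : Plane) ∉ p₂ := fun h => hdisj _ hu _ h rfl
    constructor <;> rintro ⟨(h | h) | h | h, -⟩ <;>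
      first
      | exact n1 h.mem.1
      | exact n1 h.mem.2
      | exact n2 h.mem.1
      | exact n2 h.mem.2
  by_cases hne : s(X, Y) = s(Z, W)
  · left
    apply Subtype.ext
    ext u v
    rw [hG, hH, hne]
  · right
    exact ncard_symmDiff_edgeSet hG hH (hK X Y hxm hym).1 (hK X Y hxm hym).2 (hK Z W hzm hwm).1
      (hK Z W hzm hwm).2 hne

/-! ### Counting flips and unwinding zigzags -/

/-- `Q` is reached from `P` by at most `k` flips between paths in `D`. -/
inductive Reach (D : Set (PlanePath S)) : ℕ → PlanePath S → PlanePath S → Prop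
  | refl {P : PlanePath S} (k : ℕ) : P ∈ D → Reach D k P P
  | step {P Q R : PlanePath S} {k : ℕ} : P ∈ D → (flipGraph S).Adj P Q → Reach D k Q R →
      Reach D (k + 1) P R

theorem Reach.mem {D : Set (PlanePath S)} {k : ℕ} {P Q : PlanePath S} (h : Reach D k P Q) :
    P ∈ D ∧ Q ∈ D := by
  induction h with
  | refl k h => exact ⟨h, h⟩
  | step h _ _ ih => exact ⟨h, ih.2⟩

theorem Reach.mono {D : Set (PlanePath S)} {k l : ℕ} {P Q : PlanePath S} (h : Reach D k P Q)
    (hkl : k ≤ l) : Reach D l P Q := by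
  induction h generalizing l with
  | refl k h => exact Reach.refl l h
  | step h hadj _ ih =>
    obtain ⟨l, rfl⟩ : ∃ l', l = l' + 1 := ⟨l - 1, by omega⟩
    exact Reach.step h hadj (ih (by omega))

theorem Reach.trans {D : Set (PlanePath S)} {k l : ℕ} {P Q R : PlanePath S} (h : Reach D k P Q)
    (h' : Reach D l Q R) : Reach D (k + l) P R := by
  induction h with
  | refl k h => exact h'.mono (by omega)
  | step h hadj _ ih =>
    rw [Nat.add_right_comm]
    exact Reach.step h hadj (ih h')

theorem Reach.symm {D : Set (PlanePath S)} {k : ℕ} {P Q : PlanePath S} (h : Reach D k P Q) :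
    Reach D k Q P := by
  induction h with
  | refl k h => exact Reach.refl k h
  | step h hadj h' ih =>
    have := ih.trans (Reach.step (k := 0) h'.mem.1 hadj.symm (Reach.refl 0 h))
    exact this.mono (by omega)

theorem Reach.edist_le {D : Set (PlanePath S)} {k : ℕ} {P Q : PlanePath S} (h : Reach D k P Q)
    (hP : P ∈ D) (hQ : Q ∈ D) :
    ((flipGraph S).induce D).edist ⟨P, hP⟩ ⟨Q, hQ⟩ ≤ (k : ℕ∞) := by
  induction h with
  | refl k h => simp
  | @step P R Q k h hadj h' ih =>
    have hadj' : ((flipGraph S).induce D).Adj ⟨P, hP⟩ ⟨R, h'.mem.1⟩ := hadj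
    calc ((flipGraph S).induce D).edist ⟨P, hP⟩ ⟨Q, hQ⟩
        ≤ ((flipGraph S).induce D).edist ⟨P, hP⟩ ⟨R, h'.mem.1⟩ +
          ((flipGraph S).induce D).edist ⟨R, h'.mem.1⟩ ⟨Q, hQ⟩ := SimpleGraph.edist_triangle
      _ ≤ 1 + k := by
          gcongr
          · exact (SimpleGraph.edist_eq_one_iff_adj.2 hadj').le
          · exact ih h'.mem.1 hQ
      _ = ((k + 1 : ℕ) : ℕ∞) := by push_cast; rw [add_comm]

theorem Reach.of_univ_edist_le {k : ℕ} {P Q : PlanePath S} (h : Reach Set.univ k P Q) :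
    (flipGraph S).edist P Q ≤ (k : ℕ∞) := by
  induction h with
  | refl k h => simp
  | @step P R Q k h hadj h' ih =>
    calc (flipGraph S).edist P Q
        ≤ (flipGraph S).edist P R + (flipGraph S).edist R Q := SimpleGraph.edist_triangle
      _ ≤ 1 + k := by
          gcongr
          exact (SimpleGraph.edist_eq_one_iff_adj.2 hadj).le
      _ = ((k + 1 : ℕ) : ℕ∞) := by push_cast; rw [add_comm]

/-- The list represents a path in `D`. -/
structure Good (D : Set (PlanePath S)) (p : List Plane) : Prop where
  planeList : PlaneList S p
  exists_path : ∃ P ∈ D, P.1 = pathOf S p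

/-- Reachability within `D`, for paths represented by lists. -/
def ListReach (D : Set (PlanePath S)) (k : ℕ) (p q : List Plane) : Prop :=
  ∃ P Q : PlanePath S, P.1 = pathOf S p ∧ Q.1 = pathOf S q ∧ Reach D k P Q

variable {D : Set (PlanePath S)} {k l : ℕ} {p q r : List Plane}

theorem ListReach.trans (h : ListReach D k p q) (h' : ListReach D l q r) :
    ListReach D (k + l) p r := by
  obtain ⟨P, Q, hP, hQ, h⟩ := h
  obtain ⟨Q', R, hQ', hR, h'⟩ := h'
  have : Q = Q' := Subtype.ext (hQ.trans hQ'.symm)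
  subst this
  exact ⟨P, R, hP, hR, h.trans h'⟩

theorem ListReach.symm (h : ListReach D k p q) : ListReach D k q p := by
  obtain ⟨P, Q, hP, hQ, h⟩ := h
  exact ⟨Q, P, hQ, hP, h.symm⟩

theorem ListReach.mono (h : ListReach D k p q) (hkl : k ≤ l) : ListReach D l p q := by
  obtain ⟨P, Q, hP, hQ, h⟩ := h
  exact ⟨P, Q, hP, hQ, h.mono hkl⟩

theorem ListReach.reverse_left (h : ListReach D k p q) : ListReach D k p.reverse q := by
  obtain ⟨P, Q, hP, hQ, h⟩ := h
  exact ⟨P, Q, by rw [hP, pathOf_reverse], hQ, h⟩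

theorem ListReach.reverse_right (h : ListReach D k p q) : ListReach D k p q.reverse := by
  obtain ⟨P, Q, hP, hQ, h⟩ := h
  exact ⟨P, Q, hP, by rw [hQ, pathOf_reverse], h⟩

theorem Good.refl (h : Good D p) : ListReach D 0 p p := by
  obtain ⟨P, hP, e⟩ := h.exists_path
  exact ⟨P, P, e, e, Reach.refl 0 hP⟩

theorem Good.reverse (h : Good D p) : Good D p.reverse := by
  obtain ⟨P, hP, e⟩ := h.exists_path
  exact ⟨h.planeList.reverse, P, hP, by rw [e, pathOf_reverse]⟩

theorem Good.exchange {p₁ p₂ q₁ q₂ : List Plane} (hp : Good D (p₁ ++ p₂)) (hq : Good D (q₁ ++ q₂))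
    (h₁ : SameAdj p₁ q₁) (h₂ : SameAdj p₂ q₂) : ListReach D 1 (p₁ ++ p₂) (q₁ ++ q₂) := by
  obtain ⟨P, hP, eP⟩ := hp.exists_path
  obtain ⟨Q, hQ, eQ⟩ := hq.exists_path
  refine ⟨P, Q, eP, eQ, ?_⟩
  rcases adj_or_eq_of_exchange hp.planeList h₁ h₂ eP eQ with rfl | h
  · exact Reach.refl 1 hP
  · exact Reach.step hP h (Reach.refl 0 hQ)

theorem Good.reverse_suffix {p₁ p₂ : List Plane} (hp : Good D (p₁ ++ p₂))
    (hq : Good D (p₁ ++ p₂.reverse)) : ListReach D 1 (p₁ ++ p₂) (p₁ ++ p₂.reverse) :=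
  hp.exchange hq (Or.inl rfl) (Or.inr rfl)

theorem Good.reverse_prefix {p₁ p₂ : List Plane} (hp : Good D (p₁ ++ p₂))
    (hq : Good D (p₁.reverse ++ p₂)) : ListReach D 1 (p₁ ++ p₂) (p₁.reverse ++ p₂) :=
  hp.exchange hq (Or.inr rfl) (Or.inl rfl)

/-- Read backwards, `p₂ ++ p₁` is `p₁.reverse ++ p₂.reverse`, which is an exchange with the cut at
the same place. -/
theorem Good.swap {p₁ p₂ : List Plane} (hp : Good D (p₁ ++ p₂)) (hq : Good D (p₂ ++ p₁)) :
    ListReach D 1 (p₁ ++ p₂) (p₂ ++ p₁) := by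
  have hq' : Good D (p₁.reverse ++ p₂.reverse) := by
    rw [← List.reverse_append]; exact hq.reverse
  have := (hp.exchange hq' (Or.inr rfl) (Or.inr rfl)).reverse_right
  simpa using this

theorem Good.swap_reverse {p₁ p₂ : List Plane} (hp : Good D (p₁ ++ p₂))
    (hq : Good D (p₂ ++ p₁.reverse)) : ListReach D 1 (p₁ ++ p₂) (p₂ ++ p₁.reverse) := by
  have hq' : Good D (p₁ ++ p₂.reverse) := by
    have := hq.reverse
    simpa using this
  have := (hp.exchange hq' (Or.inl rfl) (Or.inr rfl)).reverse_right
  simpa using this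

/-- Unwind the tail first. Taking the first point of the arc fits the forward run, taking the last
one fits the backward run, and reversing the suffix turns one into the other. Proving both targets
together lets each step of the induction use the one that fits, at the cost of one flip. -/
theorem zig_reach {p₀ l w : List Plane} (hw : Zig l w)
    (hgood : ∀ w, Zig l w → Good D (p₀ ++ w)) :
    ListReach D (l.length - 1) (p₀ ++ w) (p₀ ++ l) ∧
      ListReach D (l.length - 1) (p₀ ++ w) (p₀ ++ l.reverse) := by
  induction hw generalizing p₀ with
  | nil =>
    have := (hgood [] Zig.nil).refl
    exact ⟨this, this⟩
  | @head x l w hw ih =>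
    have h1 := (ih (p₀ := p₀ ++ [x]) (by
      intro w' hw'
      simpa using hgood _ (Zig.head x hw'))).1
    simp only [List.append_assoc, List.singleton_append] at h1
    refine ⟨h1.mono (by simp), ?_⟩
    have h2 := (hgood _ (zig_self _)).reverse_suffix (hgood _ (zig_reverse _))
    -- On a single point the two runs coincide and no flip is needed; this is where the `- 1` in the
    -- bound comes from.
    rcases l with _ | ⟨y, l⟩
    · simpa using h1
    · exact (h1.trans h2).mono (by simp)
  | @last x l w hw ih =>
    have h1 := (ih (p₀ := p₀ ++ [x]) (by
      intro w' hw'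
      simpa using hgood _ (Zig.last x hw'))).2
    simp only [List.append_assoc, List.singleton_append] at h1
    have e : x :: l.reverse = (l ++ [x]).reverse := by simp
    rw [e] at h1
    refine ⟨?_, h1.mono (by simp)⟩
    have h2 := (hgood _ (zig_reverse _)).reverse_suffix (by
      rw [List.reverse_reverse]
      exact hgood _ (zig_self _))
    rw [List.reverse_reverse] at h2
    rcases l.eq_nil_or_concat with rfl | ⟨l, y, rfl⟩
    · simpa using h1
    · exact (h1.trans h2).mono (by simp)

theorem zig_reach_head {p₀ l w : List Plane} {x : Plane} (hw : Zig l w)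
    (hgood : ∀ w, Zig (x :: l) w → Good D (p₀ ++ w)) :
    ListReach D (l.length - 1) (p₀ ++ x :: w) (p₀ ++ x :: l) := by
  have := (zig_reach (p₀ := p₀ ++ [x]) hw (by
      intro w' hw'
      simpa using hgood _ (Zig.head x hw'))).1
  simpa using this

/-- A zigzag starting at the head of `Y ++ X` gets close to the path that runs through `Y` and then
back through `X`. -/
theorem zig_reach_turn {p₀ l w X Y : List Plane} (hw : Zig l w) (hl : l = Y ++ X)
    (hgood : ∀ w, Zig l w → Good D (p₀ ++ w))
    (hhead : Y = [] ∨ ∃ x l' w', l = x :: l' ∧ w = x :: w' ∧ Zig l' w') :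
    ListReach D (l.length - 1) (p₀ ++ w) (p₀ ++ (Y ++ X.reverse)) := by
  rcases Y with _ | ⟨y, Y⟩
  · rw [List.nil_append] at hl
    subst hl
    exact (zig_reach hw hgood).2
  · obtain ⟨x, l', w', rfl, rfl, hw'⟩ := hhead.resolve_left (by simp)
    rw [List.cons_append] at hl
    obtain ⟨rfl, rfl⟩ := List.cons.inj hl
    have h1 := zig_reach_head hw' hgood
    have hz := hgood _ (((zig_reverse X).prepend Y).head x)
    have h2 : ListReach D 1 (p₀ ++ x :: (Y ++ X)) (p₀ ++ (x :: Y ++ X.reverse)) := by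
      have e : p₀ ++ x :: (Y ++ X) = (p₀ ++ x :: Y) ++ X := by simp
      have e' : p₀ ++ (x :: Y ++ X.reverse) = (p₀ ++ x :: Y) ++ X.reverse := by simp
      have g1 := hgood _ (zig_self _)
      have g2 : Good D (p₀ ++ (x :: Y ++ X.reverse)) := hz
      rw [e'] at g2 ⊢
      rw [e] at g1 ⊢
      exact g1.reverse_suffix g2
    rcases h : Y ++ X with _ | ⟨z, t⟩
    · obtain ⟨rfl, rfl⟩ := List.append_eq_nil_iff.1 h
      simpa using h1
    · rw [h] at h1 h2
      exact (h1.trans h2).mono (by simp)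

end PlanePaths

/-! ### Zigzags are the non-crossing paths in convex position; paths cut at `ξ` -/

namespace PlanePaths

/-- Disjoint segments of the list do not cross. -/
def NonCrossing (p : List Plane) : Prop :=
  ∀ a b c d, Consec a b p → Consec c d p → a ≠ c → a ≠ d → b ≠ c → b ≠ d → ¬ Meets a b c d

theorem NonCrossing.cons {a : Plane} {w : List Plane} (hw : NonCrossing w)
    (h : ∀ x ∈ w.head?, ∀ c d, Consec c d w → a ≠ c → a ≠ d → x ≠ c → x ≠ d → ¬ Meets a x c d) :
    NonCrossing (a :: w) := by
  intro s t c d hst hcd h1 h2 h3 h4 hm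
  rcases hst with ⟨rfl, ht⟩ | hst <;> rcases hcd with ⟨rfl, hd⟩ | hcd
  · exact h1 rfl
  · exact h t ht c d hcd h1 h2 h3 h4 hm
  · exact h d hd s t hst (Ne.symm h1) (Ne.symm h3) (Ne.symm h2) (Ne.symm h4) hm.symm
  · exact hw s t c d hst hcd h1 h2 h3 h4 hm

theorem NonCrossing.of_cons {a : Plane} {w : List Plane} (h : NonCrossing (a :: w)) :
    NonCrossing w :=
  fun s t c d hst hcd => h s t c d (Or.inr hst) (Or.inr hcd)

/-- Each step goes to a cyclic neighbour among the points that remain, that is, along an edge of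
their hull, which no later segment crosses. -/
theorem Zig.nonCrossing {a : Plane} {l w : List Plane} (hw : Zig l w) (hc : CyclicOrder (a :: l))
    (hn : (a :: l).Nodup) : NonCrossing (a :: w) := by
  induction hw generalizing a with
  | nil =>
    intro s t c d hst
    simp [Consec] at hst
  | @head x l w hw ih =>
    refine (ih (hc.sublist (List.sublist_cons_self _ _)) (List.nodup_cons.1 hn).2).cons ?_
    intro y hy c d hcd _ _ h3 h4
    simp at hy
    subst hy
    rcases hcd with ⟨rfl, -⟩ | hcd
    · exact absurd rfl h3
    have hn' : w.Nodup := hw.perm.nodup_iff.2 (List.nodup_cons.1 (List.nodup_cons.1 hn).2).2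
    have hcl := hw.perm.mem_iff.1 hcd.mem.1
    have hdl := hw.perm.mem_iff.1 hcd.mem.2
    rcases pair_sublist_or hcl hdl (hcd.ne hn') with hs | hs
    · exact (hc.sublist ((hs.cons_cons x).cons_cons a)).four.1
    · exact fun hm => (hc.sublist ((hs.cons_cons x).cons_cons a)).four.1 hm.swap_right
  | @last x l w hw ih =>
    have hs' : (l ++ [x]).Sublist (a :: (l ++ [x])) := List.sublist_cons_self _ _
    have hnx : (x :: l).Nodup :=
      (List.perm_append_singleton x l).nodup_iff.1 (hn.sublist hs')
    refine (ih (hc.sublist hs').rotate hnx).cons ?_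
    intro y hy c d hcd _ _ h3 h4
    simp at hy
    subst hy
    rcases hcd with ⟨rfl, -⟩ | hcd
    · exact absurd rfl h3
    have hn' : w.Nodup := hw.perm.nodup_iff.2 (List.nodup_cons.1 hnx).2
    have hcl := hw.perm.mem_iff.1 hcd.mem.1
    have hdl := hw.perm.mem_iff.1 hcd.mem.2
    rcases pair_sublist_or hcl hdl (hcd.ne hn') with hs | hs
    · exact fun hm => (hc.sublist ((hs.append_right [x]).cons_cons a)).four.2.1 hm.symm
    · exact fun hm => (hc.sublist ((hs.append_right [x]).cons_cons a)).four.2.1 hm.symm.swap_left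

/-- If the first step from `a` went to a point `x` in the interior of the arc, there would be
unvisited points on both sides of the chord `ax`, and the rest of the path would cross it. -/
theorem NonCrossing.zig {a : Plane} {l w : List Plane} (h : NonCrossing (a :: w))
    (hp : w.Perm l) (hc : CyclicOrder (a :: l)) (hn : (a :: l).Nodup) : Zig l w := by
  induction w generalizing a l with
  | nil =>
    have := hp.nil_eq
    subst this
    exact Zig.nil
  | cons x w ih =>
    obtain ⟨l₁, l₂, rfl⟩ := List.append_of_mem (hp.mem_iff.1 List.mem_cons_self)
    have hp' : w.Perm (l₁ ++ l₂) := (hp.trans List.perm_middle).cons_inv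
    have hs : (l₁ ++ x :: l₂).Sublist (a :: (l₁ ++ x :: l₂)) := List.sublist_cons_self _ _
    have hn' : (x :: (l₁ ++ l₂)).Nodup := (List.perm_middle.nodup_iff).1 (hn.sublist hs)
    by_cases h1 : l₁ = []
    · subst h1
      exact Zig.head x (ih h.of_cons hp' (hc.sublist hs) hn')
    by_cases h2 : l₂ = []
    · subst h2
      rw [List.append_nil] at hp' hn'
      exact Zig.last x (ih h.of_cons hp' (hc.sublist hs).rotate hn')
    exfalso
    obtain ⟨u, hu⟩ := List.exists_mem_of_ne_nil _ h1
    obtain ⟨v, hv⟩ := List.exists_mem_of_ne_nil _ h2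
    have hn2 := (List.nodup_cons.1 hn').2
    have hvu : v ∉ l₁ := fun hv' => (List.nodup_append.1 hn2).2.2 v hv' v hv rfl
    obtain ⟨c, d, hcd, hcl, hdl⟩ := exists_consec (· ∈ l₁) (hp'.mem_iff.2 (List.mem_append_left _ hu))
      (hp'.mem_iff.2 (List.mem_append_right _ hv)) hu hvu
    have hdw : d ∈ w := by
      rcases hcd with h | h
      · exact h.mem.2
      · exact h.mem.1
    have hdl2 : d ∈ l₂ := (List.mem_append.1 (hp'.mem_iff.1 hdw)).resolve_left hdl
    have hm : Meets a x c d := by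
      refine (CyclicOrder.four (x := a) (y := c) (z := x) (w := d) (hc.sublist ?_)).2.2
      refine List.Sublist.cons_cons a ?_
      exact (List.singleton_sublist.2 hcl).append ((List.singleton_sublist.2 hdl2).cons_cons x)
    have ha := (List.nodup_cons.1 hn).1
    have hx := (List.nodup_cons.1 hn').1
    have hac : a ≠ c := fun e => ha (by rw [e]; simp [hcl])
    have had : a ≠ d := fun e => ha (by rw [e]; simp [hdl2])
    have hxc : x ≠ c := fun e => hx (by rw [e]; simp [hcl])
    have hxd : x ≠ d := fun e => hx (by rw [e]; simp [hdl2])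
    rcases hcd with hcd | hcd
    · exact h a x c d (Or.inl ⟨rfl, rfl⟩) (Or.inr (Or.inr hcd)) hac had hxc hxd hm
    · exact h a x d c (Or.inl ⟨rfl, rfl⟩) (Or.inr (Or.inr hcd)) had hac hxd hxc hm.swap_right

/-- `p` is a zigzag through the points of the list `I`, which is in cyclic order. -/
def PathOn (I p : List Plane) : Prop :=
  ∃ Y a X w, I = Y ++ a :: X ∧ p = a :: w ∧ Zig (X ++ Y) w

theorem pathOn_self {I : List Plane} (h : I ≠ []) : PathOn I I := by
  obtain ⟨a, X, rfl⟩ := List.exists_cons_of_ne_nil h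
  exact ⟨[], a, X, X, rfl, rfl, by simpa using zig_self X⟩

theorem PathOn.ne_nil {I p : List Plane} (h : PathOn I p) : p ≠ [] := by
  obtain ⟨Y, a, X, w, rfl, rfl, hz⟩ := h
  simp

theorem PathOn.perm {I p : List Plane} (h : PathOn I p) : p.Perm I := by
  obtain ⟨Y, a, X, w, rfl, rfl, hz⟩ := h
  exact ((hz.perm.trans List.perm_append_comm).cons a).trans List.perm_middle.symm

theorem PathOn.nonCrossing {I p : List Plane} (h : PathOn I p) (hc : CyclicOrder I)
    (hn : I.Nodup) : NonCrossing p := by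
  obtain ⟨Y, a, X, w, rfl, rfl, hz⟩ := h
  have hc' := hc.rotate
  exact hz.nonCrossing hc' ((List.perm_append_comm.nodup_iff).1 hn)

theorem pathOn_reverse {I : List Plane} (h : I ≠ []) : PathOn I I.reverse := by
  rcases I.eq_nil_or_concat with rfl | ⟨Y, a, rfl⟩
  · exact absurd rfl h
  · exact ⟨Y, a, [], Y.reverse, by simp, by simp, by simpa using zig_reverse Y⟩

theorem pathOn_mk {Y X w : List Plane} {a : Plane} (h : Zig (X ++ Y) w) :
    PathOn (Y ++ a :: X) (a :: w) :=
  ⟨Y, a, X, w, rfl, rfl, h⟩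

/-- The path that arrives at `ξ` along the reverse of `A` and continues along `B`. -/
def join (ξ : Plane) (A B : List Plane) : List Plane := A.reverse ++ ξ :: B

variable {C : Set Plane} {ξ : Plane}

theorem join_reverse (A B : List Plane) : (join ξ A B).reverse = join ξ B A := by
  simp [join]

theorem consec_join {a b : Plane} {A B : List Plane} : Consec a b (join ξ A B) ↔
    Consec b a A ∨ Consec a b B ∨ (A.head? = some a ∧ b = ξ) ∨ (a = ξ ∧ B.head? = some b) := by
  unfold join
  rw [consec_append, consec_reverse, Consec, List.getLast?_reverse]
  simp only [List.head?_cons, Option.some.injEq, eq_comm (a := ξ)]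
  tauto

theorem nonCrossing_join {A B : List Plane} (hA : NonCrossing A) (hB : NonCrossing B)
    (hAB : ∀ a b c d, Consec a b A → Consec c d B → ¬ Meets a b c d)
    (hξA : ∀ a, (A.head? = some a ∨ B.head? = some a) → ∀ c d, Consec c d A → c ≠ a → d ≠ a →
      ¬ Meets ξ a c d)
    (hξB : ∀ a, (A.head? = some a ∨ B.head? = some a) → ∀ c d, Consec c d B → c ≠ a → d ≠ a →
      ¬ Meets ξ a c d) :
    NonCrossing (join ξ A B) := by
  intro a b c d hab hcd h1 h2 h3 h4 hm
  rw [consec_join] at hab hcd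
  rcases hab with hab | hab | ⟨hab, rfl⟩ | ⟨rfl, hab⟩ <;>
    rcases hcd with hcd | hcd | ⟨hcd, rfl⟩ | ⟨rfl, hcd⟩
  · exact hA b a d c hab hcd h4 h3 h2 h1 hm.swap_left.swap_right
  · exact hAB b a c d hab hcd hm.swap_left
  · exact hξA c (Or.inl hcd) b a hab h3 h1 hm.symm.swap_left.swap_right
  · exact hξA d (Or.inr hcd) b a hab h4 h2 hm.symm.swap_right
  · exact hAB d c a b hcd hab hm.symm.swap_left
  · exact hB a b c d hab hcd h1 h2 h3 h4 hm
  · exact hξB c (Or.inl hcd) a b hab h1 h3 hm.symm.swap_left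
  · exact hξB d (Or.inr hcd) a b hab h2 h4 hm.symm
  · exact hξA a (Or.inl hab) d c hcd h2.symm h1.symm hm.swap_left.swap_right
  · exact hξB a (Or.inl hab) c d hcd h1.symm h2.symm hm.swap_left
  · exact h4 rfl
  · exact h3 rfl
  · exact hξA b (Or.inr hab) d c hcd h4.symm h3.symm hm.swap_right
  · exact hξB b (Or.inr hab) c d hcd h3.symm h4.symm hm
  · exact h2 rfl
  · exact h1 rfl

/-- Zigzags on disjoint arcs of a convex polygon do not cross each other, so only the segments at
`ξ` need visibility. It is required past each arc separately because no path segment connects the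
two arcs; a point hidden by segments between the arcs is still admissible. -/
theorem OuterPoint.planeList_join (h : OuterPoint C ξ) {I J A B : List Plane}
    (hI : IsHull C (I ++ J)) (hA : PathOn I A ∨ (I = [] ∧ A = [])) (hB : PathOn J B)
    (hsee : ∀ a, (A.head? = some a ∨ B.head? = some a) →
      SeesPast ξ {x | x ∈ I} a ∧ SeesPast ξ {x | x ∈ J} a) :
    PlaneList (insert ξ C) (join ξ A B) := by
  have hpA : A.Perm I := by
    rcases hA with hA | ⟨rfl, rfl⟩
    · exact hA.perm
    · exact List.Perm.refl _
  have hpB := hB.perm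
  have hnd := List.nodup_append.1 hI.nodup
  have hnA : A.Nodup := hpA.nodup_iff.2 hnd.1
  have hnB : B.Nodup := hpB.nodup_iff.2 hnd.2.1
  have hncA : NonCrossing A := by
    rcases hA with hA | ⟨rfl, rfl⟩
    · exact hA.nonCrossing (hI.cyclic.sublist (List.sublist_append_left _ _)) hnd.1
    · intro a b c d hab
      exact hab.elim
  have hncB := hB.nonCrossing (hI.cyclic.sublist (List.sublist_append_right _ _)) hnd.2.1
  have hperm : (join ξ A B).Perm (ξ :: (I ++ J)) := by
    unfold join
    exact List.perm_middle.trans ((((List.reverse_perm A).trans hpA).append hpB).cons ξ)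
  refine ⟨?_, ?_, nonCrossing_join hncA hncB ?_ ?_ ?_⟩
  · rw [hperm.nodup_iff, List.nodup_cons]
    refine ⟨fun hm => h.notMem ((hI.mem_iff _).1 hm), hI.nodup⟩
  · intro x
    rw [hperm.mem_iff, List.mem_cons, hI.mem_iff, Set.mem_insert_iff]
  · intro a b c d hab hcd hm
    have key : ∀ s t u v, [s, t].Sublist I → [u, v].Sublist J → ¬ Meets s t u v :=
      fun s t u v hs hu => (hI.cyclic.sublist (hs.append hu)).four.1
    rcases pair_sublist_or (hpA.mem_iff.1 hab.mem.1) (hpA.mem_iff.1 hab.mem.2) (hab.ne hnA)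
      with h1 | h1 <;>
    rcases pair_sublist_or (hpB.mem_iff.1 hcd.mem.1) (hpB.mem_iff.1 hcd.mem.2) (hcd.ne hnB)
      with h2 | h2
    · exact key _ _ _ _ h1 h2 hm
    · exact key _ _ _ _ h1 h2 hm.swap_right
    · exact key _ _ _ _ h1 h2 hm.swap_left
    · exact key _ _ _ _ h1 h2 hm.swap_left.swap_right
  · intro a ha c d hcd h1 h2
    exact (hsee a ha).1 c (hpA.mem_iff.1 hcd.mem.1) d (hpA.mem_iff.1 hcd.mem.2) (hcd.ne hnA) h1 h2
  · intro a ha c d hcd h1 h2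
    exact (hsee a ha).2 c (hpB.mem_iff.1 hcd.mem.1) d (hpB.mem_iff.1 hcd.mem.2) (hcd.ne hnB) h1 h2

theorem neighborSet_pathOf_join {S : Set Plane} (hξ : ξ ∈ S) {A B : List Plane}
    (hn : (join ξ A B).Nodup) (hm : ∀ x ∈ join ξ A B, x ∈ S) :
    Subtype.val '' ((pathOf S (join ξ A B)).neighborSet ⟨ξ, hξ⟩) =
      {x | A.head? = some x} ∪ {x | B.head? = some x} := by
  have hn' : ξ ∉ A ∧ ξ ∉ B := by
    unfold join at hn
    rw [List.nodup_middle, List.nodup_cons] at hn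
    simpa using hn.1
  have e1 : ∀ x, Consec ξ x (join ξ A B) ↔ B.head? = some x := by
    intro x
    rw [consec_join]
    constructor
    · rintro (h | h | ⟨h, -⟩ | ⟨-, h⟩)
      · exact absurd h.mem.2 hn'.1
      · exact absurd h.mem.1 hn'.2
      · exact absurd (List.mem_of_head? h) hn'.1
      · exact h
    · exact fun h => Or.inr (Or.inr (Or.inr ⟨rfl, h⟩))
  have e2 : ∀ x, Consec x ξ (join ξ A B) ↔ A.head? = some x := by
    intro x
    rw [consec_join]
    constructor
    · rintro (h | h | ⟨h, -⟩ | ⟨-, h⟩)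
      · exact absurd h.mem.1 hn'.1
      · exact absurd h.mem.2 hn'.2
      · exact h
      · exact absurd (List.mem_of_head? h) hn'.2
    · exact fun h => Or.inr (Or.inr (Or.inl ⟨h, rfl⟩))
  ext x
  simp only [Set.mem_image, Set.mem_union, Set.mem_ofPred_eq]
  constructor
  · rintro ⟨y, hy, rfl⟩
    rcases hy.1 with h | h
    · exact Or.inr ((e1 _).1 h)
    · exact Or.inl ((e2 _).1 h)
  · intro h
    have hc : Consec ξ x (join ξ A B) ∨ Consec x ξ (join ξ A B) :=
      h.symm.imp (e1 x).2 (e2 x).2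
    have hx : x ∈ join ξ A B := hc.elim (fun h => h.mem.2) (fun h => h.mem.1)
    have hne : ξ ≠ x := hc.elim (fun h => h.ne hn) (fun h => (h.ne hn).symm)
    exact ⟨⟨x, hm x hx⟩, ⟨hc, fun e => hne (congrArg Subtype.val e)⟩, rfl⟩

theorem ncard_neighborSet_of_ne_nil {S : Set Plane} (hξ : ξ ∈ S) {A B : List Plane}
    (hp : PlaneList S (join ξ A B)) (hA : A ≠ []) (hB : B ≠ []) :
    ((pathOf S (join ξ A B)).neighborSet ⟨ξ, hξ⟩).ncard = 2 := by
  rw [← Set.ncard_image_of_injective _ Subtype.val_injective,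
    neighborSet_pathOf_join hξ hp.nodup (fun x hx => (hp.mem_iff x).1 hx)]
  obtain ⟨a, A, rfl⟩ := List.exists_cons_of_ne_nil hA
  obtain ⟨b, B, rfl⟩ := List.exists_cons_of_ne_nil hB
  have hab : a ≠ b := by
    have := hp.nodup
    unfold join at this
    exact (List.nodup_append.1 this).2.2 a (by simp) b (by simp)
  have : {x | (a :: A).head? = some x} ∪ {x | (b :: B).head? = some x} = ({a, b} : Set Plane) := by
    ext x
    simp
    grind
  rw [this, Set.ncard_pair hab]

theorem ncard_neighborSet_of_nil {S : Set Plane} (hξ : ξ ∈ S) {B : List Plane}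
    (hp : PlaneList S (join ξ [] B)) (hB : B ≠ []) :
    ((pathOf S (join ξ [] B)).neighborSet ⟨ξ, hξ⟩).ncard = 1 := by
  rw [← Set.ncard_image_of_injective _ Subtype.val_injective,
    neighborSet_pathOf_join hξ hp.nodup (fun x hx => (hp.mem_iff x).1 hx)]
  obtain ⟨b, B, rfl⟩ := List.exists_cons_of_ne_nil hB
  have : {x | ([] : List Plane).head? = some x} ∪ {x | (b :: B).head? = some x} =
      ({b} : Set Plane) := by
    ext x
    simp [eq_comm]
  rw [this, Set.ncard_singleton]

end PlanePaths

/-! ### Flip sequences from two zigzag arms to a detour path -/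

namespace PlanePaths

variable {C : Set Plane} {ξ : Plane} {D : Set (PlanePath (insert ξ C))} {k : ℕ}

/-- `D` contains the plane paths in which `ξ` is an inner vertex. -/
def AdmitsInner (D : Set (PlanePath (insert ξ C))) : Prop :=
  ∀ A B, A ≠ [] → B ≠ [] → PlaneList (insert ξ C) (join ξ A B) →
    ∀ P : PlanePath (insert ξ C), P.1 = pathOf _ (join ξ A B) → P ∈ D

/-- `D` contains the plane paths in which `ξ` is an end. -/
def AdmitsOuter (D : Set (PlanePath (insert ξ C))) : Prop :=
  ∀ B, B ≠ [] → PlaneList (insert ξ C) (join ξ [] B) →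
    ∀ P : PlanePath (insert ξ C), P.1 = pathOf _ (join ξ [] B) → P ∈ D

theorem PlaneList.exists_planePath {S : Set Plane} (hS : InGeneralPosition S) {p : List Plane}
    (h : PlaneList S p) : ∃ P : PlanePath S, P.1 = pathOf S p :=
  ⟨⟨pathOf S p, isSpanningPath_pathOf h.nodup h.mem_iff, h.isPlane hS⟩, rfl⟩

theorem AdmitsInner.good_of_sees (hD : AdmitsInner D) (h : OuterPoint C ξ) {I J A B : List Plane}
    (hI : IsHull C (I ++ J)) (hA : PathOn I A) (hB : PathOn J B)
    (hsee : ∀ a, (A.head? = some a ∨ B.head? = some a) →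
      SeesPast ξ {x | x ∈ I} a ∧ SeesPast ξ {x | x ∈ J} a) :
    Good D (join ξ A B) := by
  have hp := h.planeList_join hI (Or.inl hA) hB hsee
  obtain ⟨P, hP⟩ := hp.exists_planePath h.general
  exact ⟨hp, P, hD A B hA.ne_nil hB.ne_nil hp P hP, hP⟩

theorem IsHull.sees {I J : List Plane} (hI : IsHull C (I ++ J)) {a : Plane}
    (ha : SeesPast ξ C a) : SeesPast ξ {x | x ∈ I} a ∧ SeesPast ξ {x | x ∈ J} a :=
  ⟨ha.mono fun x hx => (hI.mem_iff x).1 (List.mem_append_left _ hx),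
    ha.mono fun x hx => (hI.mem_iff x).1 (List.mem_append_right _ hx)⟩

theorem AdmitsInner.good (hD : AdmitsInner D) (h : OuterPoint C ξ) {I J A B : List Plane}
    (hI : IsHull C (I ++ J)) (hA : PathOn I A) (hB : PathOn J B)
    (hsA : ∀ a ∈ A.head?, SeesPast ξ C a) (hsB : ∀ b ∈ B.head?, SeesPast ξ C b) :
    Good D (join ξ A B) := by
  refine hD.good_of_sees h hI hA hB ?_
  rintro a (ha | ha)
  · exact hI.sees (hsA a ha)
  · exact hI.sees (hsB a ha)

theorem AdmitsOuter.good (hD : AdmitsOuter D) (h : OuterPoint C ξ) {c : Plane} {l w : List Plane}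
    (hI : IsHull C (c :: l)) (hw : Zig l w) (hc : SeesPast ξ C c) :
    Good D (join ξ [] (c :: w)) := by
  have hp : PlaneList (insert ξ C) (join ξ [] (c :: w)) := by
    refine h.planeList_join (I := []) (J := c :: l) hI (Or.inr ⟨rfl, rfl⟩)
      ⟨[], c, l, w, rfl, rfl, by simpa using hw⟩ ?_
    rintro a (ha | ha)
    · simp at ha
    · simp at ha
      subst ha
      exact IsHull.sees (I := []) hI hc
  obtain ⟨P, hP⟩ := hp.exists_planePath h.general
  exact ⟨hp, P, hD _ (by simp) hp P hP, hP⟩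

theorem ListReach.join_comm {A B q : List Plane} (hr : ListReach D k (join ξ A B) q) :
    ListReach D k (join ξ B A) q := by
  rw [← join_reverse]
  exact hr.reverse_left

theorem ListReach.join_comm_right {A B q : List Plane} (hr : ListReach D k q (join ξ A B)) :
    ListReach D k q (join ξ B A) := by
  rw [← join_reverse]
  exact hr.reverse_right

theorem Good.join_comm {A B : List Plane} (hg : Good D (join ξ A B)) : Good D (join ξ B A) := by
  rw [← join_reverse]
  exact hg.reverse

theorem reach_reverse_right {A B : List Plane} (h₁ : Good D (join ξ A B))
    (h₂ : Good D (join ξ A B.reverse)) : ListReach D 1 (join ξ A B) (join ξ A B.reverse) := by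
  have e : ∀ B, join ξ A B = (A.reverse ++ [ξ]) ++ B := by simp [join]
  rw [e] at h₁ h₂ ⊢
  rw [e]
  exact h₁.reverse_suffix h₂

theorem reach_reverse_left {A B : List Plane} (h₁ : Good D (join ξ A B))
    (h₂ : Good D (join ξ A.reverse B)) : ListReach D 1 (join ξ A B) (join ξ A.reverse B) :=
  (reach_reverse_right h₁.join_comm h₂.join_comm).join_comm.join_comm_right

theorem reach_reverse_tail {A B M : List Plane} (h₁ : Good D (join ξ A (B ++ M)))
    (h₂ : Good D (join ξ A (B ++ M.reverse))) :
    ListReach D (min M.length 1) (join ξ A (B ++ M)) (join ξ A (B ++ M.reverse)) := by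
  rcases M with _ | ⟨x, M⟩
  · exact h₁.refl
  · have e : ∀ M, join ξ A (B ++ M) = (A.reverse ++ ξ :: B) ++ M := by simp [join]
    rw [e] at h₁ h₂ ⊢
    rw [e]
    exact (h₁.reverse_suffix h₂).mono (by simp)

/-- The tail `M` of one arm is reattached by its first point to the end of the other arm;
`reach_move_reverse` attaches it by its last point. The bound `min M.length 1` charges nothing for
an empty tail, which matters in the totals below. -/
theorem reach_move {A B M : List Plane} (h₁ : Good D (join ξ (A ++ M) B))
    (h₂ : Good D (join ξ A (B ++ M))) :
    ListReach D (min M.length 1) (join ξ (A ++ M) B) (join ξ A (B ++ M)) := by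
  rcases M with _ | ⟨x, M⟩
  · rw [List.append_nil, List.append_nil] at *
    exact h₁.refl
  · have e₁ : join ξ (A ++ x :: M) B = (x :: M).reverse ++ (A.reverse ++ ξ :: B) := by simp [join]
    have e₂ : join ξ A (B ++ x :: M) = (A.reverse ++ ξ :: B) ++ (x :: M).reverse.reverse := by
      simp [join]
    rw [e₁] at h₁ ⊢
    rw [e₂] at h₂ ⊢
    exact (h₁.swap_reverse h₂).mono (by simp)

theorem reach_move_reverse {A B M : List Plane} (h₁ : Good D (join ξ A (B ++ M)))
    (h₂ : Good D (join ξ (A ++ M.reverse) B)) :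
    ListReach D 1 (join ξ A (B ++ M)) (join ξ (A ++ M.reverse) B) := by
  have e₁ : join ξ A (B ++ M) = (A.reverse ++ ξ :: B) ++ M := by simp [join]
  have e₂ : join ξ (A ++ M.reverse) B = M ++ (A.reverse ++ ξ :: B) := by simp [join]
  rw [e₁] at h₁ ⊢
  rw [e₂] at h₂ ⊢
  exact h₁.swap h₂

theorem zig_reach_right {A l w : List Plane} {b : Plane} (hw : Zig l w)
    (hgood : ∀ w, Zig l w → Good D (join ξ A (b :: w))) :
    ListReach D (l.length - 1) (join ξ A (b :: w)) (join ξ A (b :: l)) ∧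
      ListReach D (l.length - 1) (join ξ A (b :: w)) (join ξ A (b :: l.reverse)) := by
  have e : ∀ w, join ξ A (b :: w) = (A.reverse ++ [ξ, b]) ++ w := by simp [join]
  simp only [e] at hgood ⊢
  exact zig_reach hw hgood

theorem zig_reach_left {B l w : List Plane} {a : Plane} (hw : Zig l w)
    (hgood : ∀ w, Zig l w → Good D (join ξ (a :: w) B)) :
    ListReach D (l.length - 1) (join ξ (a :: w) B) (join ξ (a :: l) B) ∧
      ListReach D (l.length - 1) (join ξ (a :: w) B) (join ξ (a :: l.reverse) B) := by
  have := zig_reach_right (A := B) (b := a) hw (fun w hw => (hgood w hw).join_comm)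
  exact ⟨this.1.join_comm.join_comm_right, this.2.join_comm.join_comm_right⟩

theorem zig_reach_turn_right {A l w X Y : List Plane} {b : Plane} (hw : Zig l w) (hl : l = Y ++ X)
    (hgood : ∀ w, Zig l w → Good D (join ξ A (b :: w)))
    (hhead : Y = [] ∨ ∃ x l' w', l = x :: l' ∧ w = x :: w' ∧ Zig l' w') :
    ListReach D (l.length - 1) (join ξ A (b :: w)) (join ξ A (b :: (Y ++ X.reverse))) := by
  have e : ∀ w, join ξ A (b :: w) = (A.reverse ++ [ξ, b]) ++ w := by simp [join]
  simp only [e] at hgood ⊢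
  exact zig_reach_turn hw hl hgood hhead

/-- The path that runs once around the hull, except for a detour to `ξ`. -/
def IsHullDetour (C : Set Plane) (ξ : Plane) (p : List Plane) : Prop :=
  ∃ P Q, p = P ++ ξ :: Q ∧ IsHull C (Q ++ P) ∧ P ≠ [] ∧ Q ≠ [] ∧
    (∀ u ∈ P.getLast?, SeesPast ξ C u) ∧ ∀ v ∈ Q.head?, SeesPast ξ C v

/-- A path close to `p` is a detour path. -/
def ReachesDetour (D : Set (PlanePath (insert ξ C))) (k : ℕ) (p : List Plane) : Prop :=
  ∃ q, IsHullDetour C ξ q ∧ ListReach D k p q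

theorem head?_of_mem {a b : Plane} {l : List Plane} (h : b ∈ (a :: l).head?)
    (ha : SeesPast ξ C a) : SeesPast ξ C b := by
  simp at h
  exact h ▸ ha

/-- The arm from `a` covers `X₂` and `Y₂`, the arm from `b` covers `Y₁` and `X₁`, and the latter
starts away from the visible arc. Unwind the first to `a`, `Y₂` and `X₂` backwards, and the second
to `b`, `Y₁`, `X₁` backwards. Passing `X₂` to the second arm makes it end at the hull neighbour of
`a`, which is visible. Reversing that arm and then its tail gives a detour between `a` and this
neighbour. -/
theorem AdmitsInner.reachesDetour_of_head (hD : AdmitsInner D) (h : OuterPoint C ξ) {a b : Plane}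
    {X₁ X₂ Y₁ Y₂ w w' : List Plane} (hl : IsHull C (a :: (X₂ ++ X₁) ++ b :: (Y₁ ++ Y₂)))
    (ha : SeesPast ξ C a) (hb : SeesPast ξ C b) (hX : ∀ x ∈ (X₂ ++ X₁).head?, SeesPast ξ C x)
    (hw : Zig (X₂ ++ Y₂) w) (hw' : Zig (Y₁ ++ X₁) w')
    (hhead : Y₁ = [] ∨ ∃ x l v, Y₁ ++ X₁ = x :: l ∧ w' = x :: v ∧ Zig l v) :
    ReachesDetour D (X₁.length + X₂.length + Y₁.length + Y₂.length + 1)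
      (join ξ (a :: w) (b :: w')) := by
  have hl' : IsHull C ((Y₂ ++ a :: X₂) ++ (X₁ ++ b :: Y₁)) := by
    have := IsHull.rotate (l₁ := a :: (X₂ ++ X₁) ++ b :: Y₁) (l₂ := Y₂) (by simpa using hl)
    simpa using this
  have hl'' : IsHull C ((Y₂ ++ [a]) ++ ((X₂ ++ X₁) ++ b :: Y₁)) := by simpa using hl'
  have g0 : ∀ w w', Zig (X₂ ++ Y₂) w → Zig (Y₁ ++ X₁) w' → Good D (join ξ (a :: w) (b :: w')) :=
    fun w w' hw hw' => hD.good h hl' (pathOn_mk hw) (pathOn_mk hw') (fun x hx => head?_of_mem hx ha)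
      (fun x hx => head?_of_mem hx hb)
  have s1 := (zig_reach_left hw (fun v hv => g0 v w' hv hw')).2
  have s2 := zig_reach_turn_right hw' rfl (fun v hv => g0 _ v (zig_reverse _) hv) hhead
  have g2 := g0 _ _ (zig_reverse _) ((zig_reverse X₁).prepend Y₁)
  have hA : PathOn (Y₂ ++ [a]) (a :: Y₂.reverse) :=
    pathOn_mk (X := []) (by simpa using zig_reverse Y₂)
  have g3 : Good D (join ξ (a :: Y₂.reverse) (b :: (Y₁ ++ X₁.reverse) ++ X₂.reverse)) := by
    refine hD.good h hl'' hA ?_ (fun x hx => head?_of_mem hx ha) (fun x hx => head?_of_mem hx hb)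
    have := (zig_reverse (X₂ ++ X₁)).prepend Y₁
    rw [List.reverse_append, ← List.append_assoc Y₁ X₁.reverse] at this
    exact pathOn_mk this
  have s3 := reach_move (A := a :: Y₂.reverse) (M := X₂.reverse) (B := b :: (Y₁ ++ X₁.reverse))
    (by simpa using g2) g3
  have e3 : a :: Y₂.reverse ++ X₂.reverse = a :: (X₂ ++ Y₂).reverse := by simp
  rw [e3] at s3
  have s13 := (s1.trans s2).trans s3
  have hrot : IsHull C (((X₂ ++ X₁) ++ b :: Y₁) ++ (Y₂ ++ [a])) := hl''.rotate
  -- If nothing lies between `a` and `b`, they are hull neighbours and the detour is already in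
  -- place.
  rcases hX' : X₂ ++ X₁ with _ | ⟨x, X⟩
  · obtain ⟨rfl, rfl⟩ := List.append_eq_nil_iff.1 hX'
    refine ⟨_, ⟨Y₂ ++ [a], b :: Y₁, ?_, by simpa using hrot, by simp, by simp, by simpa using ha,
      by simpa using hb⟩, s13.mono ?_⟩
    · simp [join]
    · simp; omega
  · have hx : SeesPast ξ C x := hX x (by rw [hX']; rfl)
    have eB : b :: (Y₁ ++ X₁.reverse) ++ X₂.reverse = ((x :: X) ++ (b :: Y₁).reverse).reverse := by
      rw [← hX']; simp
    rw [hX'] at hl'' hrot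
    have gx : ∀ v, Zig (X ++ b :: Y₁) v → Good D (join ξ (a :: Y₂.reverse) (x :: v)) := by
      intro v hv
      refine hD.good h hl'' hA ?_ (fun y hy => head?_of_mem hy ha) (fun y hy => head?_of_mem hy hx)
      exact pathOn_mk (Y := []) (by simpa using hv)
    have g4 : Good D (join ξ (a :: Y₂.reverse) ((x :: X) ++ (b :: Y₁).reverse)) :=
      gx _ ((zig_reverse (b :: Y₁)).prepend X)
    have g5 : Good D (join ξ (a :: Y₂.reverse) ((x :: X) ++ b :: Y₁)) := gx _ (zig_self _)
    rw [eB] at g3 s13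
    have s4 := (reach_reverse_right g4 g3).symm
    have s5 : ListReach D (min Y₁.length 1)
        (join ξ (a :: Y₂.reverse) ((x :: X) ++ (b :: Y₁).reverse))
        (join ξ (a :: Y₂.reverse) ((x :: X) ++ b :: Y₁)) := by
      rcases Y₁ with _ | ⟨y, Y⟩
      · exact g4.refl
      · exact ((reach_reverse_tail g5 g4).symm).mono (by simp)
    refine ⟨_, ⟨Y₂ ++ [a], (x :: X) ++ b :: Y₁, ?_, hrot, by simp, by simp,
      by simpa using ha, by simpa using hx⟩, ((s13.trans s4).trans s5).mono ?_⟩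
    · simp [join]
    · have := congrArg List.length hX'
      simp at this ⊢
      omega

/-- Both arms start towards the visible arc. After unwinding, `Y₂` passes to the arm of `b`, the arm
`a, X₂` is reversed, `Y₁` and `Y₂` pass to it, and the arm of `b` is reversed. The detour now leaves
the hull where `X₂` and `X₁` meet, which is inside the visible arc or at its ends. -/
theorem AdmitsInner.reachesDetour_of_ends (hD : AdmitsInner D) (h : OuterPoint C ξ) {a b : Plane}
    {X₁ X₂ Y₁ Y₂ w w' : List Plane} (hl : IsHull C (a :: (X₂ ++ X₁) ++ b :: (Y₁ ++ Y₂)))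
    (ha : SeesPast ξ C a) (hb : SeesPast ξ C b) (hX : ∀ x ∈ X₂ ++ X₁, SeesPast ξ C x)
    (hw' : Zig (Y₁ ++ X₁) w')
    (hhead : ∃ x l v, X₂ ++ Y₂ = x :: l ∧ w = x :: v ∧ Zig l v)
    (hhead' : ∃ x l v, Y₁ ++ X₁ = l ++ [x] ∧ w' = x :: v ∧ Zig l v) :
    ReachesDetour D (X₁.length + X₂.length + Y₁.length + Y₂.length + 1)
      (join ξ (a :: w) (b :: w')) := by
  obtain ⟨x, l, v, hxl, rfl, hv⟩ := hhead
  obtain ⟨x', l', v', hxl', rfl, hv'⟩ := hhead'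
  have hl' : IsHull C ((Y₂ ++ a :: X₂) ++ (X₁ ++ b :: Y₁)) := by
    have := IsHull.rotate (l₁ := a :: (X₂ ++ X₁) ++ b :: Y₁) (l₂ := Y₂) (by simpa using hl)
    simpa using this
  have hl3 : IsHull C (([] ++ a :: X₂) ++ (X₁ ++ b :: (Y₁ ++ Y₂))) := by simpa using hl
  have hl5 : IsHull C (((Y₁ ++ Y₂) ++ a :: X₂) ++ (X₁ ++ [b])) := by
    have := IsHull.rotate (l₁ := a :: (X₂ ++ X₁) ++ [b]) (l₂ := Y₁ ++ Y₂) (by simpa using hl)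
    simpa using this
  have g0 : ∀ w w', Zig (X₂ ++ Y₂) w → Zig (Y₁ ++ X₁) w' → Good D (join ξ (a :: w) (b :: w')) :=
    fun w w' hw hw' => hD.good h hl' (pathOn_mk hw) (pathOn_mk hw') (fun x hx => head?_of_mem hx ha)
      (fun x hx => head?_of_mem hx hb)
  -- The first step of this arm already agrees with the run, so unwinding takes one flip less than
  -- in general. This pays for the additional move.
  have s1 : ListReach D (l.length - 1) (join ξ (a :: x :: v) (b :: x' :: v'))
      (join ξ (a :: (X₂ ++ Y₂)) (b :: x' :: v')) := by
    have := zig_reach_head (D := D) (p₀ := (b :: x' :: v').reverse ++ [ξ, a]) (x := x) hv (by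
      intro u hu
      have := (g0 u _ (by rw [hxl]; exact hu) hw').join_comm
      simpa [join] using this)
    rw [← hxl] at this
    have e : ∀ u, (b :: x' :: v').reverse ++ [ξ, a] ++ u = join ξ (b :: x' :: v') (a :: u) := by
      simp [join]
    rw [e, e] at this
    exact this.join_comm.join_comm_right
  have s2 : ListReach D (X₁.length + Y₁.length - 1) (join ξ (a :: (X₂ ++ Y₂)) (b :: x' :: v'))
      (join ξ (a :: (X₂ ++ Y₂)) (b :: (X₁.reverse ++ Y₁))) := by
    have := zig_reach_turn_right (D := D) (ξ := ξ) (A := a :: (X₂ ++ Y₂)) (b := b)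
      (l := (Y₁ ++ X₁).reverse) (w := x' :: v') (X := Y₁.reverse) (Y := X₁.reverse)
      hw'.reverse_left (by simp)
      (fun u hu => g0 _ u (zig_self _) (by simpa using hu.reverse_left))
      (Or.inr ⟨x', l'.reverse, v', by rw [hxl']; simp, rfl, hv'.reverse_left⟩)
    rw [List.reverse_reverse] at this
    exact this.mono (by simp)
  have g2 := g0 _ _ (zig_self _) ((zig_self Y₁).append X₁)
  have g3 : Good D (join ξ (a :: X₂) (b :: (X₁.reverse ++ (Y₁ ++ Y₂)))) :=
    hD.good h hl3 (pathOn_mk (by simpa using zig_self X₂))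
      (pathOn_mk ((zig_self (Y₁ ++ Y₂)).append X₁)) (fun x hx => head?_of_mem hx ha)
      (fun x hx => head?_of_mem hx hb)
  have s3 := reach_move (A := a :: X₂) (M := Y₂) (B := b :: (X₁.reverse ++ Y₁)) (by simpa using g2)
    (by simpa using g3)
  have e3 : b :: (X₁.reverse ++ Y₁) ++ Y₂ = b :: (X₁.reverse ++ (Y₁ ++ Y₂)) := by simp
  rw [e3] at s3
  have e3' : a :: X₂ ++ Y₂ = a :: (X₂ ++ Y₂) := rfl
  rw [e3'] at s3
  have hlast : ∀ y ∈ (a :: X₂).reverse.head?, SeesPast ξ C y := by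
    intro y hy
    rw [List.head?_reverse] at hy
    rcases List.mem_cons.1 (List.mem_of_getLast? hy) with rfl | hy
    · exact ha
    · exact hX y (List.mem_append_left _ hy)
  have g4 : Good D (join ξ (a :: X₂).reverse (b :: (X₁.reverse ++ (Y₁ ++ Y₂)))) :=
    hD.good h hl3 (pathOn_reverse (by simp))
      (pathOn_mk ((zig_self (Y₁ ++ Y₂)).append X₁)) hlast
      (fun x hx => head?_of_mem hx hb)
  have s4 : ListReach D (min X₂.length 1) (join ξ (a :: X₂) (b :: (X₁.reverse ++ (Y₁ ++ Y₂))))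
      (join ξ (a :: X₂).reverse (b :: (X₁.reverse ++ (Y₁ ++ Y₂)))) := by
    rcases X₂ with _ | ⟨z, X₂⟩
    · exact g3.refl
    · exact (reach_reverse_left g3 g4).mono (by simp)
  have hlast' : ∀ y ∈ ((a :: X₂).reverse ++ (Y₁ ++ Y₂).reverse).head?, SeesPast ξ C y := by
    intro y hy
    rw [Option.mem_def, List.head?_append_of_ne_nil _ (by simp)] at hy
    exact hlast y hy
  have hA5 : PathOn ((Y₁ ++ Y₂) ++ a :: X₂) ((a :: X₂).reverse ++ (Y₁ ++ Y₂).reverse) := by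
    rw [← List.reverse_append]
    exact pathOn_reverse (by simp)
  have g5 : Good D (join ξ ((a :: X₂).reverse ++ (Y₁ ++ Y₂).reverse) (b :: X₁.reverse)) :=
    hD.good h hl5 hA5 (pathOn_mk (by simpa using zig_reverse X₁)) hlast'
      (fun x hx => head?_of_mem hx hb)
  have s5 := reach_move_reverse (A := (a :: X₂).reverse) (B := b :: X₁.reverse) (M := Y₁ ++ Y₂)
    (by simpa using g4) g5
  have e5 : b :: X₁.reverse ++ (Y₁ ++ Y₂) = b :: (X₁.reverse ++ (Y₁ ++ Y₂)) := by simp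
  rw [e5] at s5
  have hhd : ∀ y ∈ (X₁ ++ [b]).head?, SeesPast ξ C y := by
    intro y hy
    rcases X₁ with _ | ⟨z, X₁⟩
    · simp at hy
      exact hy ▸ hb
    · simp at hy
      exact hX y (by simp [hy])
  have g6 : Good D (join ξ ((a :: X₂).reverse ++ (Y₁ ++ Y₂).reverse) (X₁ ++ [b])) :=
    hD.good h hl5 hA5 (pathOn_self (by simp)) hlast' hhd
  have e6 : (b :: X₁.reverse).reverse = X₁ ++ [b] := by simp
  have s6 : ListReach D (min X₁.length 1)
      (join ξ ((a :: X₂).reverse ++ (Y₁ ++ Y₂).reverse) (b :: X₁.reverse))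
      (join ξ ((a :: X₂).reverse ++ (Y₁ ++ Y₂).reverse) (X₁ ++ [b])) := by
    rcases X₁ with _ | ⟨z, X₁⟩
    · exact g5.refl
    · have := reach_reverse_right g5 (by rw [e6]; exact g6)
      rw [e6] at this
      exact this.mono (by simp)
  refine ⟨_, ⟨(Y₁ ++ Y₂) ++ a :: X₂, X₁ ++ [b], ?_, hl5.rotate, by simp, by simp, ?_, hhd⟩,
    (((((s1.trans s2).trans s3).trans s4).trans s5).trans s6).mono ?_⟩
  · simp [join]
  · intro u hu
    refine hlast u ?_
    rw [List.head?_reverse]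
    rwa [List.getLast?_append_of_ne_nil _ (by simp)] at hu
  · have h1 := congrArg List.length hxl
    have h2 := congrArg List.length hxl'
    simp at h1 h2
    omega

theorem Zig.cases_ends {l w : List Plane} (h : Zig l w) : (l = [] ∧ w = []) ∨
    (∃ x l' w', l = x :: l' ∧ w = x :: w' ∧ Zig l' w') ∨
    ∃ x l' w', l = l' ++ [x] ∧ w = x :: w' ∧ Zig l' w' := by
  cases h with
  | nil => exact Or.inl ⟨rfl, rfl⟩
  | head x h => exact Or.inr (Or.inl ⟨x, _, _, rfl, rfl, h⟩)
  | last x h => exact Or.inr (Or.inr ⟨x, _, _, rfl, rfl, h⟩)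

/-- The first steps of the arms decide. If the arm of `b` starts away from the visible arc,
`AdmitsInner.reachesDetour_of_head` applies; if that of `a` does, its mirror image applies with `a`
and `b` exchanged. -/
theorem AdmitsInner.reachesDetour_of_visible (hD : AdmitsInner D) (h : OuterPoint C ξ)
    {a b : Plane} {X₁ X₂ Y₁ Y₂ w w' : List Plane}
    (hl : IsHull C (a :: (X₂ ++ X₁) ++ b :: (Y₁ ++ Y₂)))
    (ha : SeesPast ξ C a) (hb : SeesPast ξ C b) (hX : ∀ x ∈ X₂ ++ X₁, SeesPast ξ C x)
    (hw : Zig (X₂ ++ Y₂) w) (hw' : Zig (Y₁ ++ X₁) w') :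
    ReachesDetour D (X₁.length + X₂.length + Y₁.length + Y₂.length + 1)
      (join ξ (a :: w) (b :: w')) := by
  have hX' : ∀ x ∈ (X₂ ++ X₁).head?, SeesPast ξ C x := fun x hx => hX x (List.mem_of_head? hx)
  have hcase1 := hD.reachesDetour_of_head h hl ha hb hX' hw hw'
  have hcase2 : (Y₂ = [] ∨ ∃ x l v, X₂ ++ Y₂ = l ++ [x] ∧ w = x :: v ∧ Zig l v) →
      ReachesDetour D (X₁.length + X₂.length + Y₁.length + Y₂.length + 1)
        (join ξ (a :: w) (b :: w')) := by
    intro hc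
    have hrev : IsHull C (b :: (X₁.reverse ++ X₂.reverse) ++ a :: (Y₂.reverse ++ Y₁.reverse)) := by
      have e : (a :: (X₂ ++ X₁) ++ b :: (Y₁ ++ Y₂)).reverse =
          (Y₂.reverse ++ Y₁.reverse) ++ (b :: (X₁.reverse ++ X₂.reverse) ++ [a]) := by simp
      have := hl.reverse
      rw [e] at this
      simpa using this.rotate
    obtain ⟨q, hq, hr⟩ := hD.reachesDetour_of_head h hrev hb ha
      (fun x hx => hX x (by
        have := List.mem_of_head? hx
        simp only [List.mem_append, List.mem_reverse] at this ⊢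
        exact this.symm))
      (by simpa using hw'.reverse_left) (by simpa using hw.reverse_left)
      (by
        rcases hc with hc | ⟨x, l, v, h1, h2, h3⟩
        · left; simpa using hc
        · right
          refine ⟨x, l.reverse, v, ?_, h2, h3.reverse_left⟩
          rw [← List.reverse_append, h1]
          simp)
    exact ⟨q, hq, hr.join_comm.mono (by simp; omega)⟩
  rcases hw'.cases_ends with ⟨h1, h2⟩ | hh | hh
  · exact hcase1 (Or.inl (List.append_eq_nil_iff.1 h1).1)
  · exact hcase1 (Or.inr hh)
  · rcases hw.cases_ends with ⟨h1, h2⟩ | hh' | hh'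
    · exact hcase2 (Or.inl (List.append_eq_nil_iff.1 h1).2)
    · exact hD.reachesDetour_of_ends h hl ha hb hX hw' hh' hh
    · exact hcase2 (Or.inr hh')

/-- Unwind both arms, reverse the arm of `a` so that `ξ` is joined to the visible last point of `R`,
pass `Y` to it, and reverse the arm of `b` so that `ξ` is joined to the visible first point of the
other side. The detour then replaces the hull edge between the two sides. -/
theorem AdmitsInner.reachesDetour_of_hidden (hD : AdmitsInner D) (h : OuterPoint C ξ)
    {a b : Plane} {R X Y w w' : List Plane}
    (hl : IsHull C ((a :: R) ++ (X ++ b :: Y))) (hR : R ≠ [])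
    (haR : SeesPast ξ {x | x ∈ a :: R} a) (haL : SeesPast ξ {x | x ∈ X ++ b :: Y} a)
    (hbR : SeesPast ξ {x | x ∈ a :: R} b) (hbL : SeesPast ξ {x | x ∈ X ++ b :: Y} b)
    (hbY : Y = [] ∨ SeesPast ξ C b)
    (hu : ∀ u ∈ R.getLast?, SeesPast ξ C u) (hv : ∀ v ∈ (X ++ b :: Y).head?, SeesPast ξ C v)
    (hw : Zig R w) (hw' : Zig (Y ++ X) w') :
    ReachesDetour D (R.length + X.length + Y.length + 1) (join ξ (a :: w) (b :: w')) := by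
  have g0 : ∀ w w', Zig R w → Zig (Y ++ X) w' → Good D (join ξ (a :: w) (b :: w')) := by
    intro w w' hw hw'
    refine hD.good_of_sees h hl (pathOn_mk (Y := []) (by simpa using hw)) (pathOn_mk hw') ?_
    rintro c (hc | hc)
    · simp at hc
      exact hc ▸ ⟨haR, haL⟩
    · simp at hc
      exact hc ▸ ⟨hbR, hbL⟩
  have s1 := (zig_reach_left hw (fun v hv => g0 v w' hv hw')).1
  have s2 := (zig_reach_right hw' (fun v hv => g0 _ v (zig_self _) hv)).2
  have g2 := g0 _ _ (zig_self R) (zig_reverse (Y ++ X))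
  have hlast : ∀ y ∈ (a :: R).reverse.head?, SeesPast ξ C y := by
    intro y hy
    rw [List.head?_reverse] at hy
    refine hu y ?_
    rcases R with _ | ⟨r, R⟩
    · exact absurd rfl hR
    · simpa [List.getLast?_cons_cons] using hy
  have g3 : Good D (join ξ (a :: R).reverse (b :: (Y ++ X).reverse)) := by
    refine hD.good_of_sees h hl (pathOn_reverse (by simp)) (pathOn_mk (zig_reverse _)) ?_
    rintro c (hc | hc)
    · exact hl.sees (hlast c hc)
    · simp at hc
      exact hc ▸ ⟨hbR, hbL⟩
  have s3 := reach_reverse_left g2 g3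
  have hl4 : IsHull C ((Y ++ a :: R) ++ (X ++ [b])) := by
    have := IsHull.rotate (l₁ := a :: R ++ (X ++ [b])) (l₂ := Y) (by simpa using hl)
    simpa using this
  have hA : PathOn (Y ++ a :: R) ((a :: R).reverse ++ Y.reverse) := by
    rw [← List.reverse_append]
    exact pathOn_reverse (by simp)
  have hlast' : ∀ y ∈ ((a :: R).reverse ++ Y.reverse).head?, SeesPast ξ C y := by
    intro y hy
    rw [Option.mem_def, List.head?_append_of_ne_nil _ (by simp)] at hy
    exact hlast y hy
  have g4 : Good D (join ξ ((a :: R).reverse ++ Y.reverse) (b :: X.reverse)) := by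
    -- Passing `Y` across changes the arcs, so `b` has to be fully visible; if `Y` is empty, nothing
    -- moves and the partial visibility of `b` is enough.
    rcases hbY with rfl | hb
    · simpa using g3
    · exact hD.good h hl4 hA (pathOn_mk (by simpa using zig_reverse X)) hlast'
        (fun x hx => head?_of_mem hx hb)
  have s4 := (reach_move (A := b :: X.reverse) (M := Y.reverse) (B := (a :: R).reverse)
    (by simpa using g3.join_comm) g4.join_comm).join_comm.join_comm_right
  have e4 : b :: X.reverse ++ Y.reverse = b :: (Y ++ X).reverse := by simp
  rw [e4] at s4
  have hhd : ∀ y ∈ (X ++ [b]).head?, SeesPast ξ C y := by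
    intro y hy
    rcases X with _ | ⟨z, X⟩
    · exact hv y (by simpa using hy)
    · exact hv y (by simpa using hy)
  have g5 : Good D (join ξ ((a :: R).reverse ++ Y.reverse) (X ++ [b])) :=
    hD.good h hl4 hA (pathOn_self (by simp)) hlast' hhd
  have e5 : (b :: X.reverse).reverse = X ++ [b] := by simp
  have s5 : ListReach D (min X.length 1)
      (join ξ ((a :: R).reverse ++ Y.reverse) (b :: X.reverse))
      (join ξ ((a :: R).reverse ++ Y.reverse) (X ++ [b])) := by
    rcases X with _ | ⟨z, X⟩
    · exact g4.refl
    · have := reach_reverse_right g4 (by rw [e5]; exact g5)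
      rw [e5] at this
      exact this.mono (by simp)
  refine ⟨_, ⟨Y ++ a :: R, X ++ [b], ?_, hl4.rotate, by simp, by simp, ?_, hhd⟩,
    ((((s1.trans s2).trans s3).trans s4).trans s5).mono ?_⟩
  · simp [join]
  · intro u hu'
    refine hlast u ?_
    rw [List.head?_reverse]
    rwa [List.getLast?_append_of_ne_nil _ (by simp)] at hu'
  · have := List.length_pos_iff.2 hR
    simp
    omega

end PlanePaths

/-! ### Distances between detour paths -/

namespace PlanePaths

variable {C : Set Plane} {ξ : Plane} {D : Set (PlanePath (insert ξ C))} {k : ℕ}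

theorem AdmitsInner.good_detour (hD : AdmitsInner D) (h : OuterPoint C ξ) {P Q : List Plane}
    (hl : IsHull C (Q ++ P)) (hP : P ≠ []) (hQ : Q ≠ []) (hu : ∀ u ∈ P.getLast?, SeesPast ξ C u)
    (hv : ∀ v ∈ Q.head?, SeesPast ξ C v) : Good D (P ++ ξ :: Q) := by
  have := hD.good h hl.rotate (pathOn_reverse hP) (pathOn_self hQ)
    (fun a ha => hu a (by simpa using ha)) hv
  simpa [join] using this

theorem Good.move_prefix {M P Q : List Plane} (h₁ : Good D (M ++ P ++ ξ :: Q))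
    (h₂ : Good D (P ++ ξ :: (Q ++ M))) :
    ListReach D 1 (M ++ P ++ ξ :: Q) (P ++ ξ :: (Q ++ M)) := by
  have e₁ : M ++ P ++ ξ :: Q = M ++ (P ++ ξ :: Q) := by simp
  have e₂ : P ++ ξ :: (Q ++ M) = (P ++ ξ :: Q) ++ M := by simp
  rw [e₁] at h₁ ⊢
  rw [e₂] at h₂ ⊢
  exact h₁.swap h₂

/-- Equal lists mean that the detour is at the same hull edge; only the deleted hull edge differs,
and shifting it is one flip. -/
theorem reach_of_same_hull {P Q P' Q' : List Plane} (h₁ : Good D (P ++ ξ :: Q))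
    (h₂ : Good D (P' ++ ξ :: Q')) (he : Q ++ P = Q' ++ P') :
    ListReach D 1 (P ++ ξ :: Q) (P' ++ ξ :: Q') := by
  rcases List.append_eq_append_iff.1 he with ⟨M, rfl, rfl⟩ | ⟨M, rfl, rfl⟩
  · exact h₁.move_prefix h₂
  · exact (h₂.move_prefix h₁).symm

/-- The two detour edges cut the hull into arcs `M` and `N`. One flip makes the second detour edge
the deleted one. Reversing both arms, one flip each, exchanges the roles of the two edges. A last
flip moves the deleted edge into place. -/
theorem AdmitsInner.reach_of_ccw (hD : AdmitsInner D) (h : OuterPoint C ξ) {P Q P' Q' : List Plane}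
    (hl : IsHull C (Q ++ P)) (hc : CCW (Q ++ P)) (hP : P ≠ []) (hQ : Q ≠ [])
    (hu : ∀ u ∈ P.getLast?, SeesPast ξ C u) (hv : ∀ v ∈ Q.head?, SeesPast ξ C v)
    (hl' : IsHull C (Q' ++ P')) (hc' : CCW (Q' ++ P')) (hP' : P' ≠ []) (hQ' : Q' ≠ [])
    (hu' : ∀ u ∈ P'.getLast?, SeesPast ξ C u) (hv' : ∀ v ∈ Q'.head?, SeesPast ξ C v) :
    ListReach D 4 (P ++ ξ :: Q) (P' ++ ξ :: Q') := by
  have g := hD.good_detour h hl hP hQ hu hv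
  have g' := hD.good_detour h hl' hP' hQ' hu' hv'
  obtain ⟨M, N, e, e'⟩ := hc.isRotated hc' hl hl'
  by_cases hM : M = []
  · subst hM
    exact (reach_of_same_hull g g' (by rw [e, e']; simp)).mono (by omega)
  by_cases hN : N = []
  · subst hN
    exact (reach_of_same_hull g g' (by rw [e, e']; simp)).mono (by omega)
  have lastN : ∀ u ∈ N.getLast?, SeesPast ξ C u := by
    intro u hu'
    refine hu u ?_
    rw [← List.getLast?_append_of_ne_nil Q hP, e, List.getLast?_append_of_ne_nil _ hN]
    exact hu'
  have headM : ∀ u ∈ M.head?, SeesPast ξ C u := by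
    intro u hu'
    refine hv u ?_
    rw [Option.mem_def, ← List.head?_append_of_ne_nil Q hQ (l₂ := P), e,
      List.head?_append_of_ne_nil _ hM]
    exact hu'
  have lastM : ∀ u ∈ M.getLast?, SeesPast ξ C u := by
    intro u hu
    refine hu' u ?_
    rw [← List.getLast?_append_of_ne_nil Q' hP', e', List.getLast?_append_of_ne_nil _ hM]
    exact hu
  have headN : ∀ u ∈ N.head?, SeesPast ξ C u := by
    intro u hu
    refine hv' u ?_
    rw [Option.mem_def, ← List.head?_append_of_ne_nil Q' hQ' (l₂ := P'), e',
      List.head?_append_of_ne_nil _ hN]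
    exact hu
  rw [e] at hl
  rw [e'] at hl'
  have g1 := hD.good_detour h hl hN hM lastN headM
  have g4 := hD.good_detour h hl' hM hN lastM headN
  have g2 : Good D (join ξ N.reverse M.reverse) :=
    hD.good h hl' (pathOn_reverse hN) (pathOn_reverse hM)
      (fun a ha => lastN a (by simpa using ha)) (fun a ha => lastM a (by simpa using ha))
  have g3 : Good D (join ξ N M.reverse) := by
    have := g4.reverse
    simpa [join] using this
  have e1 : N ++ ξ :: M = join ξ N.reverse M := by simp [join]
  have e3 : (M ++ ξ :: N) = (join ξ N M.reverse).reverse := by simp [join]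
  have s1 := reach_of_same_hull g g1 e
  have s4 := reach_of_same_hull g4 g' e'.symm
  rw [e1] at s1 g1
  have s2 := reach_reverse_right g1 g2
  have s3 := reach_reverse_left g2 (by rw [List.reverse_reverse]; exact g3)
  rw [List.reverse_reverse] at s3
  have s3' := s3.reverse_right
  rw [← e3] at s3'
  exact ((s1.trans s2).trans s3').trans s4

theorem IsHullDetour.exists_ccw {p : List Plane} (hp : IsHullDetour C ξ p) :
    ∃ P Q, (p = P ++ ξ :: Q ∨ p = (P ++ ξ :: Q).reverse) ∧ IsHull C (Q ++ P) ∧ CCW (Q ++ P) ∧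
      P ≠ [] ∧ Q ≠ [] ∧ (∀ u ∈ P.getLast?, SeesPast ξ C u) ∧ ∀ v ∈ Q.head?, SeesPast ξ C v := by
  obtain ⟨P, Q, rfl, hl, hP, hQ, hu, hv⟩ := hp
  rcases hl.cyclic with hc | hc
  · exact ⟨P, Q, Or.inl rfl, hl, hc, hP, hQ, hu, hv⟩
  · have hl' := hl.reverse
    rw [List.reverse_append] at hc hl'
    exact ⟨Q.reverse, P.reverse, Or.inr (by simp), hl', hc, by simpa using hQ, by simpa using hP,
      by simpa using hv, by simpa using hu⟩

theorem AdmitsInner.reach_detour (hD : AdmitsInner D) (h : OuterPoint C ξ) {p q : List Plane}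
    (hp : IsHullDetour C ξ p) (hq : IsHullDetour C ξ q) : ListReach D 4 p q := by
  obtain ⟨P, Q, e, hl, hc, hP, hQ, hu, hv⟩ := hp.exists_ccw
  obtain ⟨P', Q', e', hl', hc', hP', hQ', hu', hv'⟩ := hq.exists_ccw
  have key := hD.reach_of_ccw h hl hc hP hQ hu hv hl' hc' hP' hQ' hu' hv'
  rcases e with rfl | rfl <;> rcases e' with rfl | rfl
  · exact key
  · exact key.reverse_right
  · exact key.reverse_left
  · exact key.reverse_left.reverse_right

end PlanePaths

/-! ### The arms when both neighbours of `ξ` are visible -/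

namespace PlanePaths

variable {C : Set Plane} {ξ : Plane} {D : Set (PlanePath (insert ξ C))} {k : ℕ}

theorem PlaneList.join_facts (hξ : ξ ∉ C) {A B : List Plane}
    (hp : PlaneList (insert ξ C) (join ξ A B)) :
    A.Nodup ∧ B.Nodup ∧ (∀ x ∈ A, x ∉ B) ∧ ∀ x, (x ∈ A ∨ x ∈ B) ↔ x ∈ C := by
  have hn := hp.nodup
  unfold join at hn
  rw [List.nodup_middle, List.nodup_cons, List.nodup_append] at hn
  obtain ⟨h1, h2, h3, h4⟩ := hn
  refine ⟨List.nodup_reverse.1 h2, h3, fun x hx hx' => h4 x (by simpa using hx) x hx' rfl, ?_⟩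
  intro x
  have := hp.mem_iff x
  unfold join at this
  simp only [List.mem_append, List.mem_cons, List.mem_reverse, Set.mem_insert_iff] at this
  simp only [List.mem_append, List.mem_reverse] at h1
  constructor
  · intro hx
    refine (this.1 (by tauto)).resolve_left ?_
    rintro rfl
    exact h1 hx
  · intro hx
    have h5 : x ≠ ξ := by rintro rfl; exact hξ hx
    have := this.2 (Or.inr hx)
    tauto

theorem PlaneList.nonCrossing_left {A B : List Plane} {S : Set Plane}
    (hp : PlaneList S (join ξ A B)) : NonCrossing A := by
  intro a b c d hab hcd h1 h2 h3 h4 hm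
  exact hp.noncrossing b a d c (consec_join.2 (Or.inl hab)) (consec_join.2 (Or.inl hcd)) h4 h3 h2 h1
    hm.swap_left.swap_right

theorem PlaneList.join_comm {A B : List Plane} {S : Set Plane}
    (hp : PlaneList S (join ξ A B)) : PlaneList S (join ξ B A) := by
  rw [← join_reverse]
  exact hp.reverse

theorem PlaneList.not_meets_across (hξ : ξ ∉ C) {A B : List Plane}
    (hp : PlaneList (insert ξ C) (join ξ A B)) {a b c d : Plane} (hab : Consec a b A)
    (hcd : Consec c d B) : ¬ Meets a b c d := by
  obtain ⟨-, -, hd, -⟩ := hp.join_facts hξ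
  intro hm
  refine hp.noncrossing b a c d (consec_join.2 (Or.inl hab)) (consec_join.2 (Or.inr (Or.inl hcd)))
    ?_ ?_ ?_ ?_ hm.swap_left
  · rintro rfl; exact hd _ hab.mem.2 hcd.mem.1
  · rintro rfl; exact hd _ hab.mem.2 hcd.mem.2
  · rintro rfl; exact hd _ hab.mem.1 hcd.mem.1
  · rintro rfl; exact hd _ hab.mem.1 hcd.mem.2

theorem PlaneList.not_meets_first (hξ : ξ ∉ C) {w B : List Plane} {a : Plane}
    (hp : PlaneList (insert ξ C) (join ξ (a :: w) B)) {c d : Plane}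
    (hcd : Consec c d w ∨ Consec c d B) : ¬ Meets ξ a c d := by
  obtain ⟨hn, -, hd, hm'⟩ := hp.join_facts hξ
  intro hm
  have haw := (List.nodup_cons.1 hn).1
  have hc : c ∈ C ∧ d ∈ C ∧ a ≠ c ∧ a ≠ d := by
    rcases hcd with h | h
    · refine ⟨(hm' c).1 (by simp [h.mem.1]), (hm' d).1 (by simp [h.mem.2]), ?_, ?_⟩
      · rintro rfl; exact haw h.mem.1
      · rintro rfl; exact haw h.mem.2
    · refine ⟨(hm' c).1 (by simp [h.mem.1]), (hm' d).1 (by simp [h.mem.2]), ?_, ?_⟩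
      · rintro rfl; exact hd a (by simp) h.mem.1
      · rintro rfl; exact hd a (by simp) h.mem.2
  obtain ⟨hc1, hd1, hac, had⟩ := hc
  have hξc : ξ ≠ c := by rintro rfl; exact hξ hc1
  have hξd : ξ ≠ d := by rintro rfl; exact hξ hd1
  have haξ : Consec a ξ (join ξ (a :: w) B) := consec_join.2 (Or.inr (Or.inr (Or.inl ⟨rfl, rfl⟩)))
  rcases hcd with h | h
  · exact hp.noncrossing a ξ d c haξ (consec_join.2 (Or.inl (Or.inr h))) had hac hξd hξc
      hm.swap_left.swap_right
  · exact hp.noncrossing a ξ c d haξ (consec_join.2 (Or.inr (Or.inl h))) hac had hξc hξd hm.swap_left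

theorem not_separated_by_segment {u v b b' : Plane} {G H B : List Plane}
    (hc : CyclicOrder (u :: G ++ v :: H)) (hn : (u :: G ++ v :: H).Nodup)
    (hB : ∀ x ∈ B, x ∈ u :: G ++ v :: H) (hu : u ∉ B) (hv : v ∉ B)
    (hm : ∀ c d, Consec c d B → ¬ Meets u v c d) (hb : b ∈ B) (hb' : b' ∈ B) (hbG : b ∈ G)
    (hbH : b' ∈ H) : False := by
  have hGH : ∀ x ∈ G, x ∉ H := fun x hx hx' =>
    (List.nodup_append.1 hn).2.2 x (by simp [hx]) x (by simp [hx']) rfl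
  obtain ⟨c, d, hcd, hcG, hdG⟩ := exists_consec (· ∈ G) hb hb' hbG (fun h => hGH _ h hbH)
  have hd : d ∈ B := hcd.elim (fun h => h.mem.2) (fun h => h.mem.1)
  have hdH : d ∈ H := by
    have := hB d hd
    simp only [List.cons_append, List.mem_cons, List.mem_append] at this
    rcases this with rfl | h | rfl | h
    · exact absurd hd hu
    · exact absurd h hdG
    · exact absurd hd hv
    · exact h
  have key : Meets u v c d := by
    refine (CyclicOrder.four (x := u) (y := c) (z := v) (w := d) (hc.sublist ?_)).2.2
    exact ((List.singleton_sublist.2 hcG).cons_cons u).append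
      ((List.singleton_sublist.2 hdH).cons_cons v)
  rcases hcd with h | h
  · exact hm c d h key
  · exact hm d c h key.swap_right

/-- If `B` had points on both sides, it would have an edge `cd` from `G` to `H`. This chord
separates `a` from `x`, and `A` contains both without crossing it, contrary to
`not_separated_by_segment`. -/
theorem not_separated_by_path {a x b b' : Plane} {G H A B : List Plane}
    (hc : CyclicOrder (a :: G ++ x :: H)) (hn : (a :: G ++ x :: H).Nodup)
    (hA : ∀ y ∈ A, y ∈ a :: G ++ x :: H) (hB : ∀ y ∈ B, y ∈ a :: G ++ x :: H)
    (hAB : ∀ y ∈ A, y ∉ B) (hm : ∀ s t c d, Consec s t A → Consec c d B → ¬ Meets s t c d)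
    (ha : a ∈ A) (hx : x ∈ A) (hb : b ∈ B) (hb' : b' ∈ B) (hbG : b ∈ G) (hbH : b' ∈ H) :
    False := by
  have hGH : ∀ x ∈ G, x ∉ H := fun x hx hx' =>
    (List.nodup_append.1 hn).2.2 x (by simp [hx]) x (by simp [hx']) rfl
  obtain ⟨c, d, hcd, hcG, hdG⟩ := exists_consec (· ∈ G) hb hb' hbG (fun h => hGH _ h hbH)
  have hc' : c ∈ B := hcd.elim (fun h => h.mem.1) (fun h => h.mem.2)
  have hd : d ∈ B := hcd.elim (fun h => h.mem.2) (fun h => h.mem.1)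
  have hdH : d ∈ H := by
    have := hB d hd
    simp only [List.cons_append, List.mem_cons, List.mem_append] at this
    rcases this with rfl | h | rfl | h
    · exact absurd hd (hAB _ ha)
    · exact absurd h hdG
    · exact absurd hd (hAB _ hx)
    · exact h
  obtain ⟨G₁, G₂, rfl⟩ := List.append_of_mem hcG
  obtain ⟨H₁, H₂, rfl⟩ := List.append_of_mem hdH
  have e : a :: (G₁ ++ c :: G₂) ++ x :: (H₁ ++ d :: H₂) =
      (a :: G₁) ++ (c :: (G₂ ++ x :: H₁) ++ d :: H₂) := by simp
  have e' : (c :: (G₂ ++ x :: H₁) ++ d :: H₂) ++ (a :: G₁) =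
      c :: (G₂ ++ x :: H₁) ++ d :: (H₂ ++ a :: G₁) := by simp
  rw [e] at hc hn hA
  have hc2 := hc.rotate
  have hn2 := List.perm_append_comm.nodup_iff.1 hn
  rw [e'] at hc2 hn2
  refine not_separated_by_segment (b := x) (b' := a) (B := A) hc2 hn2 ?_ (fun h => hAB _ h hc')
    (fun h => hAB _ h hd) ?_ hx ha (by simp) (by simp)
  · intro y hy
    rw [← e', List.mem_append, or_comm, ← List.mem_append]
    exact hA y hy
  · intro s t hst hm'
    rcases hcd with h | h
    · exact hm s t c d hst h hm'.symm
    · exact hm s t d c hst h hm'.symm.swap_right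

theorem exists_interval {α : Type*} (T : α → Prop) (l : List α)
    (h : ∀ x y z, [x, y, z].Sublist l → T x → T z → T y) :
    ∃ P M Q, l = P ++ (M ++ Q) ∧ (∀ x ∈ P, ¬ T x) ∧ (∀ x ∈ M, T x) ∧ ∀ x ∈ Q, ¬ T x := by
  induction l with
  | nil => exact ⟨[], [], [], by simp⟩
  | cons a t ih =>
    obtain ⟨P, M, Q, rfl, hP, hM, hQ⟩ := ih (fun x y z hs => h x y z (hs.cons a))
    by_cases ha : T a
    · rcases M with _ | ⟨m, M⟩
      · refine ⟨[], [a], P ++ Q, by simp, by simp, by simpa using ha, ?_⟩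
        intro x hx
        exact (List.mem_append.1 hx).elim (hP x) (hQ x)
      · rcases P with _ | ⟨p, P⟩
        · refine ⟨[], a :: m :: M, Q, rfl, by simp, ?_, hQ⟩
          intro x hx
          rcases List.mem_cons.1 hx with rfl | hx
          · exact ha
          · exact hM x hx
        · refine absurd (h a p m ?_ ha (hM m (by simp))) (hP p (by simp))
          refine List.Sublist.cons_cons a (List.Sublist.cons_cons p ?_)
          simp
    · refine ⟨a :: P, M, Q, rfl, ?_, hM, hQ⟩
      intro x hx
      rcases List.mem_cons.1 hx with rfl | hx
      · exact ha
      · exact hP x hx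

theorem append_cons_inj {α : Type*} {b : α} {X Y X' Y' : List α} (h : X ++ b :: Y = X' ++ b :: Y')
    (hn : (X ++ b :: Y).Nodup) : X = X' ∧ Y = Y' := by
  have hX : b ∉ X := fun hb => (List.nodup_append.1 hn).2.2 b hb b (by simp) rfl
  have hX' : b ∉ X' := by
    rw [h] at hn
    exact fun hb => (List.nodup_append.1 hn).2.2 b hb b (by simp) rfl
  induction X generalizing X' with
  | nil =>
    rcases X' with _ | ⟨x, X'⟩
    · simpa using h
    · simp only [List.nil_append, List.cons_append, List.cons.injEq] at h
      exact absurd (by simp [h.1]) hX'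
  | cons x X ih =>
    rcases X' with _ | ⟨x', X'⟩
    · simp only [List.nil_append, List.cons_append, List.cons.injEq] at h
      exact absurd (by simp [h.1]) hX
    · simp only [List.cons_append, List.cons.injEq] at h
      obtain ⟨rfl, h⟩ := h
      simp only [List.cons_append, List.nodup_cons] at hn
      obtain ⟨rfl, rfl⟩ := ih h hn.2 (fun h => hX (by simp [h])) (fun h => hX' (by simp [h]))
      exact ⟨rfl, rfl⟩

/-- The arms do not cross, so the points of the second arm form a contiguous block around `b` in the
cyclic order after `a`. This cuts the arcs into `X₂ X₁` and `Y₁ Y₂`, and both arms are zigzags on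
their parts. -/
theorem AdmitsInner.reachesDetour_of_sees (hD : AdmitsInner D) (h : OuterPoint C ξ) {a b : Plane}
    {w w' : List Plane} (hp : PlaneList (insert ξ C) (join ξ (a :: w) (b :: w')))
    (ha : SeesPast ξ C a) (hb : SeesPast ξ C b) :
    ReachesDetour D (w.length + w'.length + 1) (join ξ (a :: w) (b :: w')) := by
  obtain ⟨hnA, hnB, hd, hm⟩ := hp.join_facts h.notMem
  have haC := (hm a).1 (by simp)
  have hbC := (hm b).1 (by simp)
  have hab : a ≠ b := by rintro rfl; exact hd a (by simp) (by simp)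
  obtain ⟨X, Y, hl, hX⟩ := h.exists_visible_arc haC hbC hab ha hb
  have hmem : ∀ x, x ∈ a :: X ++ b :: Y ↔ x ∈ a :: w ∨ x ∈ b :: w' := fun x => by
    rw [hl.mem_iff, hm]
  -- A point `y` of the first arm between two points of the second would, together with `a`,
  -- separate them.
  obtain ⟨P, M, Q, e, hP, hM, hQ⟩ := exists_interval (· ∈ b :: w') (X ++ b :: Y) (by
    intro x y z hs hx hz
    by_contra hy
    have hyA : y ∈ a :: w :=
      ((hmem y).1 (List.mem_cons_of_mem _ (hs.subset (by simp)))).resolve_right hy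
    have hsub : [x, y, z].Sublist (X ++ b :: Y) := hs
    obtain ⟨r₁, r₂, e, h1, h2⟩ := List.cons_sublist_iff.1 hsub
    obtain ⟨r₃, r₄, rfl, h3, h4⟩ := List.cons_sublist_iff.1 h2
    obtain ⟨s, t, rfl⟩ := List.append_of_mem h3
    have e' : a :: X ++ b :: Y = a :: (r₁ ++ s) ++ y :: (t ++ r₄) := by
      rw [List.cons_append, e]; simp
    have hc := hl.cyclic
    have hn := hl.nodup
    rw [e'] at hc hn
    refine not_separated_by_path (A := a :: w) (B := b :: w') hc hn ?_ ?_ hd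
      (fun _ _ _ _ => hp.not_meets_across h.notMem) (by simp) hyA hx hz (by simp [h1])
      (by simp [List.singleton_sublist.1 h4])
    · intro v hv
      rw [← e']
      exact (hmem v).2 (Or.inl hv)
    · intro v hv
      rw [← e']
      exact (hmem v).2 (Or.inr hv))
  have hnl := (List.nodup_cons.1 hl.nodup).2
  have hal := (List.nodup_cons.1 hl.nodup).1
  have hbM : b ∈ M := by
    have : b ∈ P ++ (M ++ Q) := by rw [← e]; simp
    simp only [List.mem_append] at this
    rcases this with h | h | h
    · exact absurd (by simp) (hP b h)
    · exact h
    · exact absurd (by simp) (hQ b h)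
  obtain ⟨M₁, M₂, rfl⟩ := List.append_of_mem hbM
  have e2 : P ++ (M₁ ++ b :: M₂ ++ Q) = (P ++ M₁) ++ b :: (M₂ ++ Q) := by simp
  rw [e2] at e
  obtain ⟨rfl, rfl⟩ := append_cons_inj e hnl
  have hnl' : (P ++ (M₁ ++ b :: M₂) ++ Q).Nodup := by simpa using hnl
  have hcA : (a :: (P ++ Q)).Sublist (a :: (P ++ M₁) ++ b :: (M₂ ++ Q)) := by
    rw [List.cons_append, List.append_assoc]
    refine List.Sublist.cons_cons a (List.Sublist.append (List.Sublist.refl _) ?_)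
    refine List.Sublist.trans ?_ (List.sublist_append_right _ _)
    exact (List.sublist_append_right _ _).cons _
  have hw : w.Perm (P ++ Q) := by
    refine (List.perm_ext_iff_of_nodup (List.nodup_cons.1 hnA).2 ?_).2 ?_
    · exact (List.nodup_cons.1 (hl.nodup.sublist hcA)).2
    · intro x
      constructor
      · intro hx
        have h1 := (hmem x).2 (Or.inl (List.mem_cons_of_mem _ hx))
        have h2 : x ≠ a := by rintro rfl; exact (List.nodup_cons.1 hnA).1 hx
        have h3 : ¬ x ∈ M₁ ++ b :: M₂ := fun h => hd x (List.mem_cons_of_mem _ hx) (hM x h)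
        simp only [List.mem_append, List.mem_cons, List.cons_append] at h1 h3 ⊢
        tauto
      · intro hx
        have h1 : x ∉ b :: w' := (List.mem_append.1 hx).elim (hP x) (hQ x)
        have h2 : x ∈ (P ++ M₁) ++ b :: (M₂ ++ Q) := by
          simp only [List.mem_append, List.mem_cons] at hx ⊢
          tauto
        have h3 := ((hmem x).1 (List.mem_cons_of_mem _ h2)).resolve_right h1
        refine (List.mem_cons.1 h3).resolve_left ?_
        rintro rfl
        exact hal h2
  have hnM : (b :: (M₂ ++ M₁)).Nodup := by
    have h1 : (M₁ ++ b :: M₂).Nodup :=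
      hnl'.sublist ((List.sublist_append_right _ _).trans (List.sublist_append_left _ _))
    exact List.perm_append_comm.nodup_iff.1 h1
  have hw' : w'.Perm (M₂ ++ M₁) := by
    refine (List.perm_ext_iff_of_nodup (List.nodup_cons.1 hnB).2 (List.nodup_cons.1 hnM).2).2 ?_
    intro x
    constructor
    · intro hx
      have h1 := (hmem x).2 (Or.inr (List.mem_cons_of_mem _ hx))
      have h2 : x ≠ b := by rintro rfl; exact (List.nodup_cons.1 hnB).1 hx
      have h3 : x ≠ a := by rintro rfl; exact hd x (by simp) (List.mem_cons_of_mem _ hx)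
      have h4 : x ∉ P := fun h => hP x h (List.mem_cons_of_mem _ hx)
      have h5 : x ∉ Q := fun h => hQ x h (List.mem_cons_of_mem _ hx)
      simp only [List.mem_append, List.mem_cons, List.cons_append] at h1 ⊢
      tauto
    · intro hx
      refine (List.mem_cons.1 (hM x ?_)).resolve_left ?_
      · simp only [List.mem_append, List.mem_cons] at hx ⊢
        tauto
      · rintro rfl
        exact (List.nodup_cons.1 hnM).1 hx
  have hcM : (M₁ ++ b :: M₂).Sublist (a :: (P ++ M₁) ++ b :: (M₂ ++ Q)) := by
    refine List.Sublist.append ((List.sublist_append_right _ _).cons _) ?_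
    exact (List.sublist_append_left _ _).cons_cons _
  have zA : Zig (P ++ Q) w :=
    hp.nonCrossing_left.zig hw (hl.cyclic.sublist hcA) (hl.nodup.sublist hcA)
  have zB : Zig (M₂ ++ M₁) w' :=
    hp.join_comm.nonCrossing_left.zig hw' ((hl.cyclic.sublist hcM).rotate) hnM
  obtain ⟨q, hq, hr⟩ := hD.reachesDetour_of_visible h hl ha hb hX zA zB
  refine ⟨q, hq, hr.mono ?_⟩
  have h1 := hw.length_eq
  have h2 := hw'.length_eq
  simp at h1 h2
  omega

end PlanePaths

/-! ### The arms when a neighbour of `ξ` is hidden -/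

namespace PlanePaths

variable {C : Set Plane} {ξ : Plane} {D : Set (PlanePath (insert ξ C))} {k : ℕ}

theorem IsSplit.subset_or_subset {a : Plane} {R L T : List Plane} (hs : IsSplit C ξ a R L)
    (hT : ∀ x ∈ T, x ∈ R ∨ x ∈ L) (hm : ∀ c d, Consec c d T → ¬ Meets ξ a c d) :
    T ⊆ R ∨ T ⊆ L := by
  by_contra hne
  rw [not_or] at hne
  obtain ⟨x, hx, hxR⟩ : ∃ x ∈ T, x ∉ R := by
    by_contra hcon
    push Not at hcon
    exact hne.1 hcon
  obtain ⟨y, hy, hyL⟩ : ∃ y ∈ T, y ∉ L := by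
    by_contra hcon
    push Not at hcon
    exact hne.2 hcon
  obtain ⟨c, d, hcd, hc, hd⟩ := exists_consec (· ∈ R) hy hx ((hT y hy).resolve_right hyL) hxR
  have hdT : d ∈ T := hcd.elim (fun h => h.mem.2) (fun h => h.mem.1)
  have key := hs.meets c hc d ((hT d hdT).resolve_left hd)
  rcases hcd with h | h
  · exact hm c d h key
  · exact hm d c h key.swap_right

/-- No path segment crosses `ξa`, so each of `w` and `B` stays on one side. Both sides are nonempty,
so they do not share a side and each fills its own. -/
theorem IsSplit.perm_or_perm (hξ : ξ ∉ C) {a : Plane} {R L w B : List Plane}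
    (hs : IsSplit C ξ a R L) (hl : IsHull C (a :: (R ++ L)))
    (hp : PlaneList (insert ξ C) (join ξ (a :: w) B)) :
    (w.Perm R ∧ B.Perm L) ∨ (w.Perm L ∧ B.Perm R) := by
  obtain ⟨hnA, hnB, hd, hm⟩ := hp.join_facts hξ
  have hnw := List.nodup_cons.1 hnA
  have hnl := List.nodup_cons.1 hl.nodup
  have hn2 := List.nodup_append.1 hnl.2
  have hRL : ∀ x ∈ R, x ∉ L := fun x hx hx' => hn2.2.2 x hx x hx' rfl
  have hmem : ∀ x, (x ∈ w ∨ x ∈ B) ↔ (x ∈ R ∨ x ∈ L) := by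
    intro x
    have h1 := hm x
    rw [← hl.mem_iff] at h1
    simp only [List.mem_cons, List.mem_append] at h1
    have h2 : x = a → x ∉ w ∧ x ∉ B ∧ x ∉ R ∧ x ∉ L := by
      rintro rfl
      have := hnl.1
      simp only [List.mem_append, not_or] at this
      exact ⟨hnw.1, hd x (by simp), this⟩
    tauto
  have h1 := hs.subset_or_subset (T := w) (fun x hx => (hmem x).1 (Or.inl hx))
    (fun c d hcd => hp.not_meets_first hξ (Or.inl hcd))
  have h2 := hs.subset_or_subset (T := B) (fun x hx => (hmem x).1 (Or.inr hx))
    (fun c d hcd => hp.not_meets_first hξ (Or.inr hcd))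
  obtain ⟨r, hr⟩ := List.exists_mem_of_ne_nil _ hs.left_ne
  obtain ⟨l, hl'⟩ := List.exists_mem_of_ne_nil _ hs.right_ne
  have hdw : ∀ x ∈ w, x ∉ B := fun x hx => hd x (List.mem_cons_of_mem _ hx)
  rcases h1 with h1 | h1 <;> rcases h2 with h2 | h2
  · exact absurd hl' (hRL l (((hmem l).2 (Or.inr hl')).elim (@h1 l) (@h2 l)))
  · left
    constructor
    · refine (List.perm_ext_iff_of_nodup hnw.2 hn2.1).2 fun x => ⟨@h1 x, fun hx => ?_⟩
      exact ((hmem x).2 (Or.inl hx)).resolve_right fun h => hRL x hx (h2 h)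
    · refine (List.perm_ext_iff_of_nodup hnB hn2.2.1).2 fun x => ⟨@h2 x, fun hx => ?_⟩
      exact ((hmem x).2 (Or.inr hx)).resolve_left fun h => hRL x (h1 h) hx
  · right
    constructor
    · refine (List.perm_ext_iff_of_nodup hnw.2 hn2.2.1).2 fun x => ⟨@h1 x, fun hx => ?_⟩
      exact ((hmem x).2 (Or.inr hx)).resolve_right fun h => hRL x (h2 h) hx
    · refine (List.perm_ext_iff_of_nodup hnB hn2.1).2 fun x => ⟨@h2 x, fun hx => ?_⟩
      exact ((hmem x).2 (Or.inl hx)).resolve_left fun h => hRL x hx (h1 h)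
  · exact absurd (((hmem r).2 (Or.inl hr)).elim (@h1 r) (@h2 r)) (hRL r hr)

theorem IsHull.reverse_tail {a : Plane} {R L : List Plane} (hl : IsHull C (a :: (R ++ L))) :
    IsHull C (a :: (L.reverse ++ R.reverse)) := by
  have e : (a :: (R ++ L)).reverse = (L.reverse ++ R.reverse) ++ [a] := by simp
  have := hl.reverse
  rw [e] at this
  simpa using this.rotate

/-- If the neighbour `a` of `ξ` is hidden, then the two parts of the path lie on the two sides of
the line through `ξ` and `a`. -/
theorem OuterPoint.exists_sides (h : OuterPoint C ξ) {a : Plane} {w B : List Plane}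
    (hp : PlaneList (insert ξ C) (join ξ (a :: w) B)) (ha : ¬ SeesPast ξ C a) :
    ∃ R L, IsHull C (a :: (R ++ L)) ∧ IsSplit C ξ a R L ∧ w.Perm R ∧ B.Perm L := by
  have haC : a ∈ C := ((hp.join_facts h.notMem).2.2.2 a).1 (by simp)
  obtain ⟨l₀, hl₀, -⟩ := exists_hull h.fin ⟨a, haC⟩ h.convex
    (fun x hx y hy z hz => h.general x (Or.inr hx) y (Or.inr hy) z (Or.inr hz))
  obtain ⟨s, t, rfl⟩ := List.append_of_mem ((hl₀.mem_iff a).2 haC)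
  have hl : IsHull C (a :: (t ++ s)) := hl₀.rotate
  obtain ⟨R, L, e, hs⟩ := h.exists_isSplit hl ha
  rw [e] at hl
  rcases hs.perm_or_perm h.notMem hl hp with h1 | h1
  · exact ⟨R, L, hl, hs, h1⟩
  · exact ⟨L.reverse, R.reverse, hl.reverse_tail, hs.reverse,
      h1.1.trans (List.reverse_perm L).symm, h1.2.trans (List.reverse_perm R).symm⟩

/-- The work lies in the case where `b` is hidden as well: the split around `b` must be the same as
the one around `a`, and `b` must be the last point of its side, so that `Y` is empty. -/
theorem AdmitsInner.reachesDetour_of_not_sees (hD : AdmitsInner D) (h : OuterPoint C ξ)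
    {a b : Plane} {w w' : List Plane} (hp : PlaneList (insert ξ C) (join ξ (a :: w) (b :: w')))
    (ha : ¬ SeesPast ξ C a) :
    ReachesDetour D (w.length + w'.length + 1) (join ξ (a :: w) (b :: w')) := by
  obtain ⟨R, L, hl, hs, hw, hB⟩ := h.exists_sides hp ha
  obtain ⟨X, Y, rfl⟩ := List.append_of_mem (hB.mem_iff.1 (List.mem_cons_self))
  have hw' : w'.Perm (Y ++ X) :=
    ((hB.trans List.perm_middle).cons_inv).trans List.perm_append_comm
  have hl₁ : IsHull C ((a :: R) ++ (X ++ b :: Y)) := hl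
  have hsub₁ : (a :: R).Sublist (a :: (R ++ (X ++ b :: Y))) :=
    (List.sublist_append_left _ _).cons_cons a
  have hsub₂ : (X ++ b :: Y).Sublist (a :: (R ++ (X ++ b :: Y))) :=
    (List.sublist_append_right _ _).cons a
  have zA : Zig R w :=
    hp.nonCrossing_left.zig hw (hl.cyclic.sublist hsub₁) (hl.nodup.sublist hsub₁)
  have zB : Zig (Y ++ X) w' :=
    hp.join_comm.nonCrossing_left.zig hw' ((hl.cyclic.sublist hsub₂).rotate)
      (List.perm_append_comm.nodup_iff.1 (hl.nodup.sublist hsub₂))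
  have hbsee : SeesPast ξ {x | x ∈ a :: R} b ∧ SeesPast ξ {x | x ∈ X ++ b :: Y} b ∧
      (Y = [] ∨ SeesPast ξ C b) := by
    by_cases hb : SeesPast ξ C b
    · exact ⟨(hl₁.sees hb).1, (hl₁.sees hb).2, Or.inr hb⟩
    have hl₂ : IsHull C (b :: (Y ++ ((a :: R) ++ X))) := by
      have : IsHull C (((a :: R) ++ X) ++ (b :: Y)) := by simpa using hl₁
      exact this.rotate
    obtain ⟨R', L', e, hs'⟩ := h.exists_isSplit hl₂ hb
    have hn₂ := hl₂.nodup
    have hl₃ := hl₂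
    rw [e] at hl₃
    have hn₃ := (List.nodup_append.1 (List.nodup_cons.1 hl₃.nodup).2).2.2
    rcases hs'.perm_or_perm h.notMem hl₃ hp.join_comm with ⟨h1, h2⟩ | ⟨h1, h2⟩
    · -- the side of `a` comes last
      exfalso
      -- A point of `X` at the end of the list would lie in `L'`, while the rest of the arm of `b`
      -- fills `R'`. With `X` empty, `L'` starts at `a`, which would make `a` visible.
      have hX : X = [] := by
        rcases X.eq_nil_or_concat with rfl | ⟨X', x, rfl⟩
        · rfl
        exfalso
        have h3 : L'.getLast? = some x := by
          rw [← List.getLast?_append_of_ne_nil R' hs'.right_ne, ← e]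
          have e' : Y ++ (a :: R ++ X'.concat x) = (Y ++ a :: R ++ X') ++ [x] := by simp
          rw [e', List.getLast?_append_of_ne_nil _ (by simp)]
          rfl
        have h4 : x ∈ R' := h1.mem_iff.1 (hw'.mem_iff.2 (by simp))
        exact hn₃ x h4 x (List.mem_of_getLast? h3) rfl
      subst hX
      rw [List.append_nil] at e
      have hlen : (a :: R).length = L'.length := by
        rw [← h2.length_eq, List.length_cons, List.length_cons, hw.length_eq]
      obtain ⟨-, rfl⟩ := List.append_inj' e hlen
      exact ha (hs'.head_visible a rfl)
    · have hmemR : ∀ x, x ∈ a :: R ↔ x ∈ R' := fun x => by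
        rw [← h2.mem_iff, List.mem_cons, List.mem_cons, hw.mem_iff]
      have hmemL : ∀ x, x ∈ Y ++ X ↔ x ∈ L' := fun x => by
        rw [← h1.mem_iff, hw'.mem_iff]
      refine ⟨?_, ?_, Or.inl ?_⟩
      · refine hs'.sees_left.mono fun x hx => ?_
        exact List.mem_cons_of_mem _ ((hmemR x).1 hx)
      · refine (seesPast_cons hs'.sees_right).mono fun x hx => ?_
        simp only [List.mem_append, List.mem_cons, Set.mem_ofPred_eq] at hx
        have := hmemL x
        simp only [List.mem_append] at this
        simp only [Set.mem_insert_iff, Set.mem_ofPred_eq]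
        tauto
      · rcases Y with _ | ⟨y, Y⟩
        · rfl
        exfalso
        have h3 : R'.head? = some y := by
          rw [← List.head?_append_of_ne_nil R' hs'.left_ne (l₂ := L'), ← e]
          rfl
        exact hn₃ y (List.mem_of_head? h3) y ((hmemL y).1 (by simp)) rfl
  obtain ⟨q, hq, hr⟩ := hD.reachesDetour_of_hidden h hl₁ hs.left_ne hs.sees_left hs.sees_right
    hbsee.1 hbsee.2.1 hbsee.2.2 hs.last_visible hs.head_visible zA zB
  refine ⟨q, hq, hr.mono ?_⟩
  have h1 := hw.length_eq
  have h2 := hw'.length_eq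
  simp at h2
  omega

theorem AdmitsInner.reachesDetour (hD : AdmitsInner D) (h : OuterPoint C ξ)
    {a b : Plane} {w w' : List Plane} (hp : PlaneList (insert ξ C) (join ξ (a :: w) (b :: w'))) :
    ReachesDetour D (w.length + w'.length + 1) (join ξ (a :: w) (b :: w')) := by
  by_cases ha : SeesPast ξ C a
  · by_cases hb : SeesPast ξ C b
    · exact hD.reachesDetour_of_sees h hp ha hb
    · obtain ⟨q, hq, hr⟩ := hD.reachesDetour_of_not_sees h hp.join_comm hb
      exact ⟨q, hq, hr.join_comm.mono (by omega)⟩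
  · exact hD.reachesDetour_of_not_sees h hp ha

end PlanePaths

/-! ### Paths that end at `ξ` -/

namespace PlanePaths

variable {C : Set Plane} {ξ : Plane} {D : Set (PlanePath (insert ξ C))} {k : ℕ}

theorem OuterPoint.exists_hull_cons (h : OuterPoint C ξ) {a : Plane} (haC : a ∈ C) :
    ∃ l, IsHull C (a :: l) := by
  obtain ⟨l₀, hl₀, -⟩ := exists_hull h.fin ⟨a, haC⟩ h.convex
    (fun x hx y hy z hz => h.general x (Or.inr hx) y (Or.inr hy) z (Or.inr hz))
  obtain ⟨s, t, rfl⟩ := List.append_of_mem ((hl₀.mem_iff a).2 haC)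
  exact ⟨t ++ s, hl₀.rotate⟩

/-- If some point is hidden, the split around it has two distinct visible points at the change of
side, and one of them differs from `c`. -/
theorem OuterPoint.exists_seesPast_ne (h : OuterPoint C ξ) {b c : Plane} (hb : b ∈ C)
    (hbc : b ≠ c) : ∃ d ∈ C, d ≠ c ∧ SeesPast ξ C d := by
  by_cases hall : ∀ a ∈ C, SeesPast ξ C a
  · exact ⟨b, hb, hbc, hall b hb⟩
  push Not at hall
  obtain ⟨a, haC, ha⟩ := hall
  obtain ⟨l, hl⟩ := h.exists_hull_cons haC
  obtain ⟨R, L, rfl, hs⟩ := h.exists_isSplit hl ha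
  have hn := (List.nodup_append.1 (List.nodup_cons.1 hl.nodup).2).2.2
  have hu := List.getLast?_eq_some_getLast hs.left_ne
  have hv := List.head?_eq_some_head hs.right_ne
  generalize R.getLast hs.left_ne = u at hu
  generalize L.head hs.right_ne = v at hv
  have hne := hn u (List.mem_of_getLast? hu) v (List.mem_of_head? hv)
  by_cases huc : u = c
  · exact ⟨v, (hl.mem_iff v).1 (by simp [List.mem_of_head? hv]), fun e => hne (huc.trans e.symm),
      hs.head_visible v hv⟩
  · exact ⟨u, (hl.mem_iff u).1 (by simp [List.mem_of_getLast? hu]), huc, hs.last_visible u hu⟩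

/-- If `c` were hidden, the empty second arm would have to fill a nonempty side. -/
theorem OuterPoint.sees_of_end (h : OuterPoint C ξ) {c : Plane} {w : List Plane}
    (hp : PlaneList (insert ξ C) (join ξ [] (c :: w))) : SeesPast ξ C c := by
  by_contra hc
  obtain ⟨R, L, -, hs, -, hL⟩ := h.exists_sides hp.join_comm hc
  exact hs.right_ne hL.nil_eq.symm

theorem OuterPoint.zig_of_end (h : OuterPoint C ξ) {c : Plane} {l w : List Plane}
    (hp : PlaneList (insert ξ C) (join ξ [] (c :: w))) (hl : IsHull C (c :: l)) : Zig l w := by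
  obtain ⟨-, hn, -, hm⟩ := hp.join_facts h.notMem
  have : (c :: w).Perm (c :: l) :=
    (List.perm_ext_iff_of_nodup hn hl.nodup).2 fun x => by
      rw [hl.mem_iff, ← hm]; simp
  exact hp.join_comm.nonCrossing_left.zig this.cons_inv hl.cyclic hl.nodup

/-- Unwind to a run around the hull from `c` in the direction whose first point is visible.
Reversing the prefix `ξ, c` then puts `ξ` between `c` and that point. -/
theorem OuterPoint.reachesDetour_of_end (hI : AdmitsInner D) (hO : AdmitsOuter D)
    (h : OuterPoint C ξ) {c x : Plane} {w : List Plane}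
    (hp : PlaneList (insert ξ C) (join ξ [] (c :: x :: w))) :
    ReachesDetour D (w.length + 1) (join ξ [] (c :: x :: w)) := by
  have hc := h.sees_of_end hp
  obtain ⟨-, hn, -, hm⟩ := hp.join_facts h.notMem
  have hcC := (hm c).1 (by simp)
  have hxc : x ≠ c := by
    rintro rfl
    simp at hn
  obtain ⟨b, hbC, hbc, hb⟩ := h.exists_seesPast_ne ((hm x).1 (by simp)) hxc
  obtain ⟨X, Y, hl, hX⟩ := h.exists_visible_arc hcC hbC hbc.symm hc hb
  have hz := h.zig_of_end hp hl
  have hhead : ∀ v ∈ (X ++ b :: Y).head?, SeesPast ξ C v := by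
    intro v hv
    rcases X with _ | ⟨y, X⟩
    · simp at hv
      exact hv ▸ hb
    · simp at hv
      exact hX v (by simp [hv])
  have s1 := (zig_reach_right hz fun u hu => hO.good h hl hu hc).1
  have hl' : IsHull C ((X ++ b :: Y) ++ [c]) := IsHull.rotate (l₁ := [c]) hl
  have hlast : ∀ u ∈ [c].getLast?, SeesPast ξ C u := by
    intro u hu
    simp at hu
    exact hu ▸ hc
  have g1 : Good D ([ξ, c] ++ (X ++ b :: Y)) := hO.good h hl (zig_self _) hc
  have g2 : Good D ([ξ, c].reverse ++ (X ++ b :: Y)) :=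
    hI.good_detour h hl' (by simp) (by simp) hlast hhead
  have s2 := g1.reverse_prefix g2
  refine ⟨_, ⟨[c], X ++ b :: Y, rfl, hl', by simp, by simp, hlast, hhead⟩, (s1.trans s2).mono ?_⟩
  have := hz.perm.length_eq
  simp at this ⊢
  omega

/-- The two targets trace the same path on `C`, from `c` to `c'`, with `ξ` attached to opposite
ends, so one flip connects them. -/
theorem AdmitsOuter.reach_of_head_of_head (hD : AdmitsOuter D) (h : OuterPoint C ξ) {c c' : Plane}
    {X Y : List Plane} (hl : IsHull C (c :: X ++ c' :: Y)) (hc : SeesPast ξ C c)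
    (hc' : SeesPast ξ C c') {m m' : ℕ} {p p' : List Plane}
    (h₁ : ListReach D m p (join ξ [] (c :: (X ++ (c' :: Y).reverse))))
    (h₂ : ListReach D m' p' (join ξ [] (c' :: (Y ++ (c :: X).reverse)))) :
    ListReach D (m + m' + 1) p p' := by
  have g1 := hD.good h hl ((zig_reverse (c' :: Y)).prepend X) hc
  have g2 := hD.good h hl.rotate ((zig_reverse (c :: X)).prepend Y) hc'
  have e : c' :: (Y ++ (c :: X).reverse) = (c :: (X ++ (c' :: Y).reverse)).reverse := by simp
  rw [e] at g2 h₂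
  exact ((h₁.trans (reach_reverse_right g1 g2)).trans h₂.symm).mono (by omega)

theorem AdmitsOuter.reach_turn (hD : AdmitsOuter D) (h : OuterPoint C ξ) {c c' : Plane}
    {X Y w : List Plane} (hl : IsHull C (c :: X ++ c' :: Y)) (hc : SeesPast ξ C c)
    (hw : Zig (X ++ c' :: Y) w)
    (hhead : X = [] ∨ ∃ x l v, X ++ c' :: Y = x :: l ∧ w = x :: v ∧ Zig l v) :
    ListReach D (X.length + Y.length) (join ξ [] (c :: w))
      (join ξ [] (c :: (X ++ (c' :: Y).reverse))) := by
  have := zig_reach_turn_right hw rfl (fun u hu => hD.good h hl hu hc) hhead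
  exact this.mono (by simp)

/-- With no information on the first step of the zigzag, unwind it to the full run and reverse the
tail `c' :: Y`, which is free if `Y` is empty. -/
theorem AdmitsOuter.reach_turn_of_any (hD : AdmitsOuter D) (h : OuterPoint C ξ) {c c' : Plane}
    {X Y w : List Plane} (hl : IsHull C (c :: X ++ c' :: Y)) (hc : SeesPast ξ C c)
    (hw : Zig (X ++ c' :: Y) w) :
    ListReach D (X.length + Y.length + min Y.length 1) (join ξ [] (c :: w))
      (join ξ [] (c :: (X ++ (c' :: Y).reverse))) := by
  have s := (zig_reach_right hw (fun u hu => hD.good h hl hu hc)).1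
  have g1 := hD.good h hl (zig_self _) hc
  have g2 := hD.good h hl ((zig_reverse (c' :: Y)).prepend X) hc
  rcases Y with _ | ⟨y, Y⟩
  · exact s.mono (by simp)
  · have := reach_reverse_tail (B := c :: X) (M := c' :: y :: Y) g1 g2
    exact (s.trans this).mono (by simp)

theorem AdmitsOuter.reach_turn_of_singleton (hD : AdmitsOuter D) (h : OuterPoint C ξ)
    {c c' x : Plane} {Y v : List Plane} (hl : IsHull C (c :: [x] ++ c' :: Y))
    (hc : SeesPast ξ C c) (hv : Zig (c' :: Y) v) :
    ListReach D Y.length (join ξ [] (c :: x :: v))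
      (join ξ [] (c :: ([x] ++ (c' :: Y).reverse))) := by
  have := (zig_reach (p₀ := [ξ, c, x]) hv fun u hu => hD.good h hl (hu.head x) hc).2
  exact this.mono (by simp)

theorem AdmitsOuter.reach_of_head_of_last (hD : AdmitsOuter D) (h : OuterPoint C ξ) {c c' : Plane}
    {X Y w w' : List Plane} (hl : IsHull C (c :: X ++ c' :: Y)) (hc : SeesPast ξ C c)
    (hc' : SeesPast ξ C c') (hw : Zig (X ++ c' :: Y) w) (hw' : Zig (Y ++ c :: X) w')
    (hhead : ∃ x l v, X ++ c' :: Y = x :: l ∧ w = x :: v ∧ Zig l v) :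
    ∃ k, k ≤ 2 * w.length ∧ (w.length = 3 → k ≤ 5) ∧
      ListReach D k (join ξ [] (c :: w)) (join ξ [] (c' :: w')) := by
  have hlen : w.length = X.length + Y.length + 1 := by
    rw [hw.perm.length_eq]; simp; omega
  have s' := hD.reach_turn_of_any h hl.rotate hc' hw'
  have key := hD.reach_of_head_of_head h hl hc hc' (hD.reach_turn h hl hc hw (Or.inr hhead)) s'
  -- The general count is `2 * w.length` at most. For `w.length = 3` one flip must be saved: if `X`
  -- is a single point, only the zigzag after it has to be unwound; if `Y` is empty, the second path
  -- reaches its target without an extra reversal; otherwise `X` is empty and that reversal is free.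
  by_cases hX : X.length = 1
  · obtain ⟨x, rfl⟩ := List.length_eq_one_iff.1 hX
    obtain ⟨x', l, v, e, rfl, hv⟩ := hhead
    simp only [List.cons_append, List.nil_append, List.cons.injEq] at e
    obtain ⟨rfl, rfl⟩ := e
    refine ⟨_, ?_, ?_, hD.reach_of_head_of_head h hl hc hc'
      (hD.reach_turn_of_singleton h hl hc hv) s'⟩ <;> simp at hlen ⊢ <;> omega
  by_cases hY : Y = []
  · subst hY
    have s := hD.reach_turn h hl.rotate hc' hw' (Or.inl rfl)
    refine ⟨_, ?_, ?_, hD.reach_of_head_of_head h hl hc hc'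
      (hD.reach_turn h hl hc hw (Or.inr hhead)) s⟩ <;> simp at hlen ⊢ <;> omega
  · have := List.length_pos_iff.2 hY
    exact ⟨_, by omega, by omega, key⟩

/-- For equal neighbours both zigzags are unwound to the same run. Otherwise the first steps decide:
if both start in the same rotational sense, the two turned paths are reached cheaply, after a
reflection if necessary; opposite senses are the expensive case. -/
theorem AdmitsOuter.reach (hD : AdmitsOuter D) (h : OuterPoint C ξ) {c c' : Plane}
    {w w' : List Plane} (hp : PlaneList (insert ξ C) (join ξ [] (c :: w)))
    (hp' : PlaneList (insert ξ C) (join ξ [] (c' :: w'))) :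
    ∃ k, k ≤ 2 * w.length ∧ (w.length = 3 → k ≤ 5) ∧
      ListReach D k (join ξ [] (c :: w)) (join ξ [] (c' :: w')) := by
  have hc := h.sees_of_end hp
  have hc' := h.sees_of_end hp'
  have hcC := ((hp.join_facts h.notMem).2.2.2 c).1 (by simp)
  have hcC' := ((hp'.join_facts h.notMem).2.2.2 c').1 (by simp)
  by_cases hcc : c = c'
  · subst hcc
    obtain ⟨l, hl⟩ := h.exists_hull_cons hcC
    have hz := h.zig_of_end hp hl
    have s := (zig_reach_right hz fun u hu => hD.good h hl hu hc).1
    have s' := (zig_reach_right (h.zig_of_end hp' hl) fun u hu => hD.good h hl hu hc).1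
    have := hz.perm.length_eq
    exact ⟨_, by omega, by omega, s.trans s'.symm⟩
  obtain ⟨X, Y, hl, -⟩ := h.exists_visible_arc hcC hcC' hcc hc hc'
  have hl' : IsHull C (c' :: Y ++ c :: X) := hl.rotate
  have hz := h.zig_of_end hp hl
  have hz' := h.zig_of_end hp' hl'
  have hr : IsHull C (c :: Y.reverse ++ c' :: X.reverse) := by
    have := IsHull.reverse_tail (R := X ++ [c']) (L := Y) (by simpa using hl)
    simpa using this
  have hzr : Zig (Y.reverse ++ c' :: X.reverse) w := by simpa using hz.reverse_left
  have hzr' : Zig (X.reverse ++ c :: Y.reverse) w' := by simpa using hz'.reverse_left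
  have hlen : w.length = X.length + Y.length + 1 := by
    rw [hz.perm.length_eq]; simp; omega
  have hlen' : w'.length = X.length + Y.length + 1 := by
    rw [hz'.perm.length_eq]; simp; omega
  have flip : ∀ {l u : List Plane}, (∃ x l' u', l = l' ++ [x] ∧ u = x :: u' ∧ Zig l' u') →
      ∃ x l' u', l.reverse = x :: l' ∧ u = x :: u' ∧ Zig l' u' := by
    rintro l u ⟨x, l', u', rfl, e, hz⟩
    exact ⟨x, l'.reverse, u', by simp, e, hz.reverse_left⟩
  rcases hz.cases_ends with ⟨e, -⟩ | hh | hh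
  · simp at e
  · rcases hz'.cases_ends with ⟨e, -⟩ | hh' | hh'
    · simp at e
    · exact ⟨_, by omega, by omega, hD.reach_of_head_of_head h hl hc hc'
        (hD.reach_turn h hl hc hz (Or.inr hh)) (hD.reach_turn h hl' hc' hz' (Or.inr hh'))⟩
    · exact hD.reach_of_head_of_last h hl hc hc' hz hz' hh
  · rcases hz'.cases_ends with ⟨e, -⟩ | hh' | hh'
    · simp at e
    · obtain ⟨k, h1, h2, hk⟩ := hD.reach_of_head_of_last h hl' hc' hc hz' hz hh'
      exact ⟨k, by omega, by omega, hk.symm⟩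
    · refine ⟨_, ?_, ?_, hD.reach_of_head_of_head h hr hc hc'
        (hD.reach_turn h hr hc hzr (Or.inr (by simpa using flip hh)))
        (hD.reach_turn h hr.rotate hc' hzr' (Or.inr (by simpa using flip hh')))⟩ <;>
      simp <;> omega

end PlanePaths

/-! ### From lists to the flip graph, and the final counts -/

namespace PlanePaths

variable {C : Set Plane} {ξ : Plane} {D : Set (PlanePath (insert ξ C))} {k : ℕ}

theorem ListReach.reach {S : Set Plane} {D : Set (PlanePath S)} {p q : List Plane}
    {P Q : PlanePath S} (h : ListReach D k p q) (hP : P.1 = pathOf S p) (hQ : Q.1 = pathOf S q) :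
    Reach D k P Q := by
  obtain ⟨P', Q', hP', hQ', h⟩ := h
  have e : P' = P := Subtype.ext (hP'.trans hP.symm)
  have e' : Q' = Q := Subtype.ext (hQ'.trans hQ.symm)
  exact e ▸ e' ▸ h

theorem PlaneList.length_join (hξ : ξ ∉ C) {A B : List Plane}
    (hp : PlaneList (insert ξ C) (join ξ A B)) : A.length + B.length = C.ncard := by
  classical
  obtain ⟨hA, hB, hd, hm⟩ := hp.join_facts hξ
  have hn : (A ++ B).Nodup :=
    List.nodup_append.2 ⟨hA, hB, fun x hx y hy e => hd x hx (e ▸ hy)⟩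
  have hC : C = ((A ++ B).toFinset : Set Plane) := by
    ext x
    rw [← hm]
    simp
  rw [hC, Set.ncard_coe_finset, List.toFinset_card_of_nodup hn, List.length_append]

theorem OuterPoint.exists_list (h : OuterPoint C ξ) (hC : 2 ≤ C.ncard)
    (P : PlanePath (insert ξ C)) :
    (∃ c x w, PlaneList (insert ξ C) (join ξ [] (c :: x :: w)) ∧
      P.1 = pathOf _ (join ξ [] (c :: x :: w)) ∧ w.length + 2 = C.ncard) ∨
    ∃ a w b w', PlaneList (insert ξ C) (join ξ (a :: w) (b :: w')) ∧
      P.1 = pathOf _ (join ξ (a :: w) (b :: w')) ∧ w.length + w'.length + 2 = C.ncard := by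
  obtain ⟨p, hp, hP⟩ := exists_planeList P
  obtain ⟨s, t, rfl⟩ := List.append_of_mem ((hp.mem_iff ξ).2 (Set.mem_insert ξ C))
  have e : s ++ ξ :: t = join ξ s.reverse t := by simp [join]
  rw [e] at hp hP
  generalize s.reverse = A at hp hP
  have hout : ∀ B, PlaneList (insert ξ C) (join ξ [] B) → P.1 = pathOf _ (join ξ [] B) →
      ∃ c x w, PlaneList (insert ξ C) (join ξ [] (c :: x :: w)) ∧
        P.1 = pathOf _ (join ξ [] (c :: x :: w)) ∧ w.length + 2 = C.ncard := by
    intro B hB hP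
    have hlen := hB.length_join h.notMem
    rcases B with _ | ⟨c, _ | ⟨x, w⟩⟩
    · simp at hlen; omega
    · simp at hlen; omega
    · refine ⟨c, x, w, hB, hP, ?_⟩
      simp at hlen
      omega
  rcases A with _ | ⟨a, w⟩
  · exact Or.inl (hout t hp hP)
  rcases t with _ | ⟨b, w'⟩
  · refine Or.inl (hout _ hp.join_comm ?_)
    rw [hP, ← pathOf_reverse, join_reverse]
  · refine Or.inr ⟨a, w, b, w', hp, hP, ?_⟩
    have hlen := hp.length_join h.notMem
    simp at hlen
    omega

theorem admitsInner_univ : AdmitsInner (Set.univ : Set (PlanePath (insert ξ C))) :=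
  fun _ _ _ _ _ _ _ => Set.mem_univ _

theorem admitsOuter_univ : AdmitsOuter (Set.univ : Set (PlanePath (insert ξ C))) :=
  fun _ _ _ _ _ => Set.mem_univ _

theorem admitsInner_pathsWithDegree :
    AdmitsInner (pathsWithDegree (insert ξ C) ⟨ξ, Set.mem_insert ξ C⟩ 2) := by
  intro A B hA hB hp P hP
  change (P.1.neighborSet _).ncard = 2
  rw [hP]
  exact ncard_neighborSet_of_ne_nil _ hp hA hB

theorem admitsOuter_pathsWithDegree :
    AdmitsOuter (pathsWithDegree (insert ξ C) ⟨ξ, Set.mem_insert ξ C⟩ 1) := by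
  intro B hB hp P hP
  change (P.1.neighborSet _).ncard = 1
  rw [hP]
  exact ncard_neighborSet_of_nil _ hp hB

theorem OuterPoint.exists_visible_hull (h : OuterPoint C ξ) (hC : 2 ≤ C.ncard) :
    ∃ a X b Y, IsHull C (a :: X ++ b :: Y) ∧ SeesPast ξ C a ∧ SeesPast ξ C b := by
  obtain ⟨x, hx, y, hy, hxy⟩ := (Set.one_lt_ncard h.fin).1 hC
  obtain ⟨a, haC, hax, ha⟩ := h.exists_seesPast_ne hy hxy.symm
  obtain ⟨b, hbC, hba, hb⟩ := h.exists_seesPast_ne hx hax.symm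
  obtain ⟨X, Y, hl, -⟩ := h.exists_visible_arc haC hbC hba.symm ha hb
  exact ⟨a, X, b, Y, hl, ha, hb⟩

theorem AdmitsInner.nonempty (hD : AdmitsInner D) (h : OuterPoint C ξ) (hC : 2 ≤ C.ncard) :
    D.Nonempty := by
  obtain ⟨a, X, b, Y, hl, ha, hb⟩ := h.exists_visible_hull hC
  obtain ⟨P, hP, -⟩ := (hD.good h hl (pathOn_self (by simp)) (pathOn_self (by simp))
    (fun x hx => head?_of_mem hx ha) (fun x hx => head?_of_mem hx hb)).exists_path
  exact ⟨P, hP⟩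

theorem AdmitsOuter.nonempty (hD : AdmitsOuter D) (h : OuterPoint C ξ) (hC : 2 ≤ C.ncard) :
    D.Nonempty := by
  obtain ⟨a, X, b, Y, hl, ha, -⟩ := h.exists_visible_hull hC
  obtain ⟨P, hP, -⟩ := (hD.good h hl (zig_self _) ha).exists_path
  exact ⟨P, hP⟩

/-- Each path takes `k` flips to a detour path, and the two detour paths are at most 4 flips apart.
It is used with `k = |C| - 1 = n - 2`, so that the total is `2n`. -/
theorem AdmitsInner.reach_of_reachesDetour (hD : AdmitsInner D) (h : OuterPoint C ξ)
    {P Q : PlanePath (insert ξ C)} {p q : List Plane} (hP : P.1 = pathOf _ p)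
    (hQ : Q.1 = pathOf _ q) (hp : ReachesDetour D k p) (hq : ReachesDetour D k q) :
    Reach D (2 * k + 4) P Q := by
  obtain ⟨p', hp', hpp⟩ := hp
  obtain ⟨q', hq', hqq⟩ := hq
  exact (((hpp.trans (hD.reach_detour h hp' hq')).trans hqq.symm).mono (by omega)).reach hP hQ

theorem reach_univ (h : OuterPoint C ξ) (hC : 2 ≤ C.ncard) (P Q : PlanePath (insert ξ C)) :
    Reach Set.univ (2 * C.ncard + 2) P Q := by
  have key : ∀ P : PlanePath (insert ξ C), ∃ p, P.1 = pathOf _ p ∧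
      ReachesDetour (C := C) (ξ := ξ) Set.univ (C.ncard - 1) p := by
    intro P
    rcases h.exists_list hC P with ⟨c, x, w, hp, hP, hlen⟩ | ⟨a, w, b, w', hp, hP, hlen⟩
    · obtain ⟨q, hq, hr⟩ := h.reachesDetour_of_end admitsInner_univ admitsOuter_univ hp
      exact ⟨_, hP, q, hq, hr.mono (by omega)⟩
    · obtain ⟨q, hq, hr⟩ := admitsInner_univ.reachesDetour h hp
      exact ⟨_, hP, q, hq, hr.mono (by omega)⟩
  obtain ⟨p, hP, hp⟩ := key P
  obtain ⟨q, hQ, hq⟩ := key Q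
  exact (admitsInner_univ.reach_of_reachesDetour h hP hQ hp hq).mono (by omega)

theorem reach_degree_two (h : OuterPoint C ξ) (hC : 2 ≤ C.ncard) (P Q : PlanePath (insert ξ C))
    (hPd : P ∈ pathsWithDegree (insert ξ C) ⟨ξ, Set.mem_insert ξ C⟩ 2)
    (hQd : Q ∈ pathsWithDegree (insert ξ C) ⟨ξ, Set.mem_insert ξ C⟩ 2) :
    Reach (pathsWithDegree (insert ξ C) ⟨ξ, Set.mem_insert ξ C⟩ 2) (2 * C.ncard + 2) P Q := by
  have key : ∀ P ∈ pathsWithDegree (insert ξ C) ⟨ξ, Set.mem_insert ξ C⟩ 2, ∃ p, P.1 = pathOf _ p ∧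
      ReachesDetour (pathsWithDegree (insert ξ C) ⟨ξ, Set.mem_insert ξ C⟩ 2) (C.ncard - 1) p := by
    intro P hPd
    rcases h.exists_list hC P with ⟨c, x, w, hp, hP, hlen⟩ | ⟨a, w, b, w', hp, hP, hlen⟩
    · have h1 : (P.1.neighborSet _).ncard = 2 := hPd
      rw [hP, ncard_neighborSet_of_nil _ hp (by simp)] at h1
      omega
    · obtain ⟨q, hq, hr⟩ := admitsInner_pathsWithDegree.reachesDetour h hp
      exact ⟨_, hP, q, hq, hr.mono (by omega)⟩
  obtain ⟨p, hP, hp⟩ := key P hPd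
  obtain ⟨q, hQ, hq⟩ := key Q hQd
  exact (admitsInner_pathsWithDegree.reach_of_reachesDetour h hP hQ hp hq).mono (by omega)

theorem reach_degree_one (h : OuterPoint C ξ) (hC : 2 ≤ C.ncard) (P Q : PlanePath (insert ξ C))
    (hPd : P ∈ pathsWithDegree (insert ξ C) ⟨ξ, Set.mem_insert ξ C⟩ 1)
    (hQd : Q ∈ pathsWithDegree (insert ξ C) ⟨ξ, Set.mem_insert ξ C⟩ 1) :
    ∃ k, k ≤ 2 * (C.ncard - 1) ∧ (C.ncard = 4 → k ≤ 5) ∧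
      Reach (pathsWithDegree (insert ξ C) ⟨ξ, Set.mem_insert ξ C⟩ 1) k P Q := by
  have key : ∀ P ∈ pathsWithDegree (insert ξ C) ⟨ξ, Set.mem_insert ξ C⟩ 1, ∃ c w,
      PlaneList (insert ξ C) (join ξ [] (c :: w)) ∧ P.1 = pathOf _ (join ξ [] (c :: w)) ∧
        w.length + 1 = C.ncard := by
    intro P hPd
    rcases h.exists_list hC P with ⟨c, x, w, hp, hP, hlen⟩ | ⟨a, w, b, w', hp, hP, hlen⟩
    · exact ⟨c, x :: w, hp, hP, by simpa using hlen⟩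
    · have h1 : (P.1.neighborSet _).ncard = 1 := hPd
      rw [hP, ncard_neighborSet_of_ne_nil _ hp (by simp) (by simp)] at h1
      omega
  obtain ⟨c, w, hp, hP, hlen⟩ := key P hPd
  obtain ⟨c', w', hq, hQ, -⟩ := key Q hQd
  obtain ⟨k, h1, h2, hk⟩ := admitsOuter_pathsWithDegree.reach h hp hq
  exact ⟨k, by omega, by omega, hk.reach hP hQ⟩

theorem connected_and_ediam_le {V : Type*} [Nonempty V] {G : SimpleGraph V} {k : ℕ}
    (h : ∀ u v, G.edist u v ≤ (k : ℕ∞)) : G.Connected ∧ G.ediam ≤ (k : ℕ∞) := by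
  have hd := SimpleGraph.ediam_le_of_edist_le h
  exact ⟨SimpleGraph.connected_of_ediam_ne_top
    (ne_top_of_le_ne_top (ENat.natCast_ne_top k) hd), hd⟩

end PlanePaths

theorem theorem1 (n : ℕ) (hn : 3 ≤ n) (C : Set Plane) (ξ : Plane)
    (hfin : C.Finite) (hcard : C.ncard = n - 1)
    (hconv : InConvexPosition C) (hξ : ξ ∉ convexHull ℝ C)
    (hgen : InGeneralPosition (insert ξ C)) :
    ((flipGraph (insert ξ C)).Connected ∧
      (flipGraph (insert ξ C)).ediam ≤ ((2 * n : ℕ) : ℕ∞)) ∧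
    (((flipGraph (insert ξ C)).induce
        (pathsWithDegree (insert ξ C) ⟨ξ, Set.mem_insert ξ C⟩ 1)).Connected ∧
      (5 ≤ n →
        ((flipGraph (insert ξ C)).induce
          (pathsWithDegree (insert ξ C) ⟨ξ, Set.mem_insert ξ C⟩ 1)).ediam
            ≤ ((4 * n - 15 : ℕ) : ℕ∞))) ∧
    (((flipGraph (insert ξ C)).induce
        (pathsWithDegree (insert ξ C) ⟨ξ, Set.mem_insert ξ C⟩ 2)).Connected ∧
      ((flipGraph (insert ξ C)).induce
        (pathsWithDegree (insert ξ C) ⟨ξ, Set.mem_insert ξ C⟩ 2)).ediam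
          ≤ ((2 * n : ℕ) : ℕ∞)) := by
  have h : PlanePaths.OuterPoint C ξ := ⟨hfin, hconv, hξ, hgen⟩
  have hC : 2 ≤ C.ncard := by omega
  obtain ⟨P₁, hP₁⟩ := PlanePaths.admitsOuter_pathsWithDegree.nonempty h hC
  obtain ⟨P₂, hP₂⟩ := PlanePaths.admitsInner_pathsWithDegree.nonempty h hC
  have : Nonempty (PlanePath (insert ξ C)) := ⟨P₁⟩
  have : Nonempty (pathsWithDegree (insert ξ C) ⟨ξ, Set.mem_insert ξ C⟩ 1) := ⟨⟨P₁, hP₁⟩⟩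
  have : Nonempty (pathsWithDegree (insert ξ C) ⟨ξ, Set.mem_insert ξ C⟩ 2) := ⟨⟨P₂, hP₂⟩⟩
  refine ⟨PlanePaths.connected_and_ediam_le fun P Q => ?_, ⟨?_, fun hn5 => ?_⟩,
    PlanePaths.connected_and_ediam_le fun P Q => ?_⟩
  · exact ((PlanePaths.reach_univ h hC P Q).mono (by omega)).of_univ_edist_le
  · refine (PlanePaths.connected_and_ediam_le (k := 2 * (C.ncard - 1)) fun P Q => ?_).1
    obtain ⟨k, hk, -, hr⟩ := PlanePaths.reach_degree_one h hC P.1 Q.1 P.2 Q.2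
    exact (hr.mono hk).edist_le P.2 Q.2
  · refine (PlanePaths.connected_and_ediam_le fun P Q => ?_).2
    obtain ⟨k, hk, hk5, hr⟩ := PlanePaths.reach_degree_one h hC P.1 Q.1 P.2 Q.2
    -- The bound `2(n - 2) ≤ 4n - 15` holds from `n = 6` on; for `n = 5` the right side is 5, which
    -- is supplied by `hk5`.
    exact (hr.mono (by omega)).edist_le P.2 Q.2
  · exact ((PlanePaths.reach_degree_two h hC P.1 Q.1 P.2 Q.2).mono (by omega)).edist_le P.2 Q.2
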